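/- Let $S^1=\mathbb R/\mathbb Z$, let $\lambda=2$ ($\mu$CH) or $\lambda=3$ ($\mu$DP), let $u_0\in C^2(S^1)$, $\sigma=\int_{S^1}u_0\,d\theta$, and let $m_0=\sigma-u_0''$ be the initial momentum. Consider $$m_t+u\,m_\theta+\lambda u_\theta m=0,\qquad m=\sigma(t)-u_{\theta\theta},\qquad \sigma(t)=\int_{S^1}u(t,\theta)\,d\theta,\qquad u(0,\cdot)=u_0 .\tag{1}$$ A $C^2$ solution of (1) on a time interval $J$ ($J=[0,T)$ or $J=[0,\infty)$) is a function $u$ with $u(0,\cdot)=u_0$ such that $t\mapsto u(t,\cdot)$ is continuous from $J$ to $C^2(S^1)$, $\sigma(t)$ and $u_\theta(t,\theta)$ are differentiable in $t$, and the equation holds in the form integrated once in $\theta$: for some function $I$ of time alone, $$u_{t\theta}+u\,u_{\theta\theta}+\tfrac{\lambda-1}{2}u_\theta^2-\lambda\sigma(t)\,u-\sigma'(t)\,\theta=I(t)\qquad(t\in J,\ \theta\in\mathbb R),$$ where functions on $S^1$ are read as $1$-periodic functions on $\mathbb R$ (periodicity forces $\sigma'=0$). Then: 1. $C^2$ solutions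 are unique: two $C^2$ solutions of (1) on $[0,T)$ with the same initial data $u_0$ coincide. 2. There is a $C^2$ solution on $[0,\infty)$ if and only if $m_0$ never changes sign, i.e. $m_0\ge 0$ everywhere or $m_0\le 0$ everywhere. 3. If $m_0$ changes sign, then there are $T\in(0,\infty)$, a $C^2$ solution $u$ on $[0,T)$ with Lagrangian flow $\eta$ (that is, $\eta_t(t,\theta)=u(t,\eta(t,\theta))$, $\eta(0,\theta)=\theta$), and a point $\theta_*$ where $m_0$ changes from positive to negative, such that $$u_\theta\big(t,\eta(t,\theta_*)\big)\to-\infty\quad\text{as } t\uparrow T .$$ Here "$m_0$ changes from positive to negative at $\theta_*$" means that $\theta_*$ lies in an interval $[p,q]$, possibly a single point, on which $m_0=0$, such that $m_0$ takes positive values arbitrarily close to $p$ on its left and negative values arbitrarily close to $q$ on its right. -/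

import Mathlib

open Set Filter Topology

/-! Functions on the circle `ℝ / ℤ` are represented by `1`-periodic functions on `ℝ`. -/

/-- The mean `∫_{S¹} f dθ` of a function on the circle. -/
noncomputable def circleMean (f : ℝ → ℝ) : ℝ := ∫ θ in (0 : ℝ)..1, f θ

/-- The momentum `m = σ - f''`, `σ = ∫_{S¹} f dθ`, of a velocity field `f` on the circle. -/
noncomputable def momentum (f : ℝ → ℝ) (θ : ℝ) : ℝ := circleMean f - deriv (deriv f) θ

/-- `u` is a `C²` solution, on the time interval `J ∋ 0`, of
`m_t + u m_θ + lam u_θ m = 0`, `m = σ(t) - u_θθ`, `σ(t) = ∫_{S¹} u(t,θ) dθ`, `u(0,·) = u₀`.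

For `u(t,·) ∈ C²` the momentum is only continuous in `θ`, and the equation is understood in the
form that is obtained by integrating it once in `θ`:
`u_tθ + u u_θθ + (lam - 1)/2 u_θ² - lam σ(t) u - σ'(t) θ = I(t)` for all `θ ∈ ℝ`,
for some function `I` of time only.  (Periodicity in `θ` then forces `σ'(t) = 0`.)
The three continuity conditions say that `t ↦ u(t,·)` is continuous from `J` to `C²(S¹)`. -/
structure IsC2Solution (lam : ℝ) (u₀ : ℝ → ℝ) (J : Set ℝ) (u : ℝ → ℝ → ℝ) : Prop where
  initial : u 0 = u₀
  periodic : ∀ t ∈ J, Function.Periodic (u t) 1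
  contDiff : ∀ t ∈ J, ContDiff ℝ 2 (u t)
  cont₀ : ContinuousOn (fun p : ℝ × ℝ => u p.1 p.2) (J ×ˢ univ)
  cont₁ : ContinuousOn (fun p : ℝ × ℝ => deriv (u p.1) p.2) (J ×ˢ univ)
  cont₂ : ContinuousOn (fun p : ℝ × ℝ => deriv (deriv (u p.1)) p.2) (J ×ˢ univ)
  equation : ∃ dσ I : ℝ → ℝ, ∀ t ∈ J,
    HasDerivWithinAt (fun s => circleMean (u s)) (dσ t) J t ∧
    ∀ θ : ℝ, HasDerivWithinAt (fun s => deriv (u s) θ)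
      (I t + dσ t * θ + lam * circleMean (u t) * u t θ
        - (lam - 1) / 2 * (deriv (u t) θ) ^ 2 - u t θ * deriv (deriv (u t)) θ) J t

/-- `η` is the (lift to `ℝ` of the) Lagrangian flow of `u` on the time interval `J`:
`η_t(t,θ) = u(t, η(t,θ))`, `η(0,θ) = θ`. -/
def IsFlow (J : Set ℝ) (u η : ℝ → ℝ → ℝ) : Prop :=
  ∀ θ : ℝ, η 0 θ = θ ∧ ∀ t ∈ J, HasDerivWithinAt (fun s => η s θ) (u t (η t θ)) J t

/-- `m` takes both a negative and a positive value. -/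
def ChangesSign (m : ℝ → ℝ) : Prop := (∃ θ, m θ < 0) ∧ ∃ θ, 0 < m θ

/-- `m` changes from positive to negative at `θ`: the point `θ` lies in an interval `[p, q]`
(possibly a single point) of zeros of `m` such that `m` takes positive values arbitrarily close to
`p` on its left, and negative values arbitrarily close to `q` on its right. -/
def ChangesPosToNegAt (m : ℝ → ℝ) (θ : ℝ) : Prop :=
  ∃ p q : ℝ, p ≤ θ ∧ θ ≤ q ∧ (∀ φ ∈ Icc p q, m φ = 0) ∧
    (∃ᶠ φ in 𝓝[<] p, 0 < m φ) ∧ ∃ᶠ φ in 𝓝[>] q, m φ < 0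

/-! Everything is done along particle paths. With `ζ = log η_θ`, `V = u_θ(η)`, `κ = lam - 1`,
transport of the momentum reads `m(t, η) η_θ ^ lam = m₀`, so `V_θ = σ e^ζ - m₀ e^{-κζ}`, while `ζ_t
= V`. Together with `∫ V e^ζ = 0` this determines `V` from `ζ`, without loss of derivatives: the
problem is an ODE `ζ_t = strain ζ` with a `C¹` right-hand side on the Banach space `C(S¹)`. A
maximal solution exists, and it can end at a finite time only if `V` is unbounded there
(`exists_lagrangianSolution`).

Differentiating in time gives a Riccati equation along each path, `V_t = -(κ/2) V² + q`
(`LagrangianSolution.dV_eq`). A conserved quantity, `∫ u_θ²` for `κ = 1` and `∫ (u - σ)²` for `κ =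
2`, bounds the forcing `q` by an affine function of time (`exists_forcing_bound`).

If `m₀` changes sign, the solution is not global (`not_changesSign_of_global`). Otherwise the
Riccati inequality would force `V ≥ -R(1 + t)`. For `σ ≥ 0`, take an interval where `m₀ ≤ -δ`: there
`V` and `ζ` increase in `θ`, and the fixed total mass of `e^ζ` bounds `ζ` away from the right end.
The strain differences then drive `ζ` to `-∞` linearly further left, `e^{-κζ}` grows exponentially,
and `V` becomes so large that `ζ` must exceed its bound. The case `σ ≤ 0` is the mirror image.

At a finite breakdown time `T` the substitution `φ = e^{κζ/2}` linearises the Riccati equation to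
`φ_tt = (κ/2) q φ`. Hence `φ` and `φ_t` have limits at `T` that do not vanish together, and `V → -∞`
exactly at the zeros of `lim φ`; there is a zero because `V` is unbounded. By the formula for `V_θ`,
blow-up spreads to the right through `m₀ ≥ 0` and to the left through `m₀ ≤ 0`, yet it does not
occur everywhere, as `e^ζ` has mean one. So it occurs at a change from positive to negative
(`exists_blowup`). In particular there is no breakdown if `m₀` has one sign.

Uniqueness is an `L²` estimate for the difference of the `u_θ` (`IsC2Solution.unique`). It also
excludes a global solution when `m₀` changes sign, since such a solution would coincide with the one
that blows up. -/

/-! ### Integrals depending on a parameter -/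

section ParametricIntegral

variable {J : Set ℝ} {f f' : ℝ → ℝ → ℝ}

theorem ContinuousOn.slice (hf : ContinuousOn (fun p : ℝ × ℝ => f p.1 p.2) (J ×ˢ univ)) {t : ℝ}
    (ht : t ∈ J) : Continuous (f t) := by
  have h : ContinuousOn (fun θ : ℝ => f t θ) univ :=
    hf.comp (f := fun θ : ℝ => ((t, θ) : ℝ × ℝ)) (by fun_prop) (fun θ _ => ⟨ht, mem_univ _⟩)
  exact continuousOn_univ.mp h

theorem continuousOn_intervalIntegral
    (hf : ContinuousOn (fun p : ℝ × ℝ => f p.1 p.2) (J ×ˢ univ)) (a b : ℝ) :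
    ContinuousOn (fun t => ∫ θ in a..b, f t θ) J := by
  rw [continuousOn_iff_continuous_domRestrict]
  have h : Continuous (Function.uncurry fun (t : J) (θ : ℝ) => f t θ) := by
    refine hf.comp_continuous (f := fun q : J × ℝ => (((q.1 : ℝ), q.2) : ℝ × ℝ)) (by fun_prop) ?_
    exact fun q => ⟨q.1.2, mem_univ _⟩
  exact intervalIntegral.continuous_parametric_intervalIntegral_of_continuous' h a b

theorem exists_bound_of_continuousOn {K : Set ℝ} (hK : IsCompact K)
    (hf : ContinuousOn (fun p : ℝ × ℝ => f p.1 p.2) (J ×ˢ univ)) (hKJ : K ⊆ J) (a b : ℝ) :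
    ∃ C, ∀ t ∈ K, ∀ θ ∈ Icc a b, |f t θ| ≤ C := by
  obtain ⟨C, hC⟩ := (hK.prod (isCompact_Icc (a := a) (b := b))).exists_bound_of_continuousOn
    (hf.mono (prod_mono hKJ (subset_univ _)))
  exact ⟨C, fun t ht θ hθ => hC (t, θ) ⟨ht, hθ⟩⟩

theorem hasDerivAt_intervalIntegral (hJ : IsOpen J)
    (hf : ContinuousOn (fun p : ℝ × ℝ => f p.1 p.2) (J ×ˢ univ))
    (hf' : ContinuousOn (fun p : ℝ × ℝ => f' p.1 p.2) (J ×ˢ univ))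
    (hd : ∀ t ∈ J, ∀ θ, HasDerivAt (fun s => f s θ) (f' t θ) t) {t : ℝ} (ht : t ∈ J) (a b : ℝ) :
    HasDerivAt (fun s => ∫ θ in a..b, f s θ) (∫ θ in a..b, f' t θ) t := by
  obtain ⟨ε, hε, hball⟩ := Metric.nhds_basis_closedBall.mem_iff.1 (hJ.mem_nhds ht)
  obtain ⟨C, hC⟩ := exists_bound_of_continuousOn (isCompact_closedBall t ε) hf' hball
    (min a b) (max a b)
  refine (intervalIntegral.hasDerivAt_integral_of_dominated_loc_of_deriv_le
    (F := f) (F' := f') (bound := fun _ => C)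
    (Metric.closedBall_mem_nhds t hε) ?_ ?_ ?_ ?_ ?_ ?_).2
  · filter_upwards [hJ.mem_nhds ht] with s hs
    exact (hf.slice hs).aestronglyMeasurable
  · exact (hf.slice ht).intervalIntegrable _ _
  · exact (hf'.slice ht).aestronglyMeasurable
  · refine Eventually.of_forall fun θ hθ s hs => ?_
    exact hC s hs θ (uIoc_subset_uIcc hθ)
  · exact intervalIntegrable_const
  · exact Eventually.of_forall fun θ _ s hs => hd s (hball hs) θ

end ParametricIntegral

/-! ### Autonomous differential equations in a Banach space -/

section Flow

variable {E : Type*} [NormedAddCommGroup E] [NormedSpace ℝ E]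

/-- A `C¹` field is only locally Lipschitz, so the Grönwall argument gives agreement near each
common point. The set of agreement is thus open, relatively closed by continuity, and connectedness
finishes. -/
theorem eqOn_of_hasDerivAt_of_contDiff {F : E → E} (hF : ContDiff ℝ 1 F) {J : Set ℝ}
    (hJ : IsOpen J) (hJc : IsPreconnected J) {f g : ℝ → E}
    (hf : ∀ t ∈ J, HasDerivAt f (F (f t)) t) (hg : ∀ t ∈ J, HasDerivAt g (F (g t)) t)
    {t₀ : ℝ} (ht₀ : t₀ ∈ J) (h₀ : f t₀ = g t₀) : EqOn f g J := by
  have hloc : ∀ t ∈ J, f t = g t → f =ᶠ[𝓝 t] g := by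
    intro t ht hfg
    obtain ⟨K, s, hs, hL⟩ := (hF.contDiffAt (x := f t)).exists_lipschitzOnWith
    refine ODE_solution_unique_of_eventually (v := fun _ => F) (s := fun _ => s) (K := K)
      (Eventually.of_forall fun _ => hL) ?_ ?_ hfg
    · filter_upwards [hJ.mem_nhds ht, (hf t ht).continuousAt hs] with r hr hr'
      exact ⟨hf r hr, hr'⟩
    · rw [hfg] at hs
      filter_upwards [hJ.mem_nhds ht, (hg t ht).continuousAt hs] with r hr hr'
      exact ⟨hg r hr, hr'⟩
  have hsub : J ⊆ {t | f =ᶠ[𝓝 t] g} := by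
    refine hJc.subset_of_closure_inter_subset isOpen_setOfPred_eventually_nhds
      ⟨t₀, ht₀, hloc t₀ ht₀ h₀⟩ ?_
    rintro t ⟨htc, ht⟩
    refine hloc t ht ?_
    have hfreq : ∃ᶠ r in 𝓝 t, f r = g r :=
      (mem_closure_iff_frequently.mp htc).mono fun r hr => hr.self_of_nhds
    by_contra hne
    have h1 : Tendsto (fun r => f r - g r) (𝓝 t) (𝓝 (f t - g t)) :=
      ((hf t ht).continuousAt).sub ((hg t ht).continuousAt)
    have h2 := h1.eventually_ne (sub_ne_zero.mpr hne)
    obtain ⟨r, hr1, hr2⟩ := (hfreq.and_eventually h2).exists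
    exact hr2 (sub_eq_zero.mpr hr1)
  exact fun t ht => (hsub ht).self_of_nhds

/-- The maximal forward solution of an autonomous equation with `C¹` right hand side either is
global or has no limit at the end of its interval of existence. -/
theorem exists_maximal_solution [CompleteSpace E] {F : E → E} (hF : ContDiff ℝ 1 F) (x₀ : E) :
    ∃ ε > 0, ∃ γ : ℝ → E, γ 0 = x₀ ∧
      ((∀ t ∈ Ioi (-ε), HasDerivAt γ (F (γ t)) t) ∨
        ∃ T > 0, (∀ t ∈ Ioo (-ε) T, HasDerivAt γ (F (γ t)) t) ∧
          ∀ x, ¬ Tendsto γ (𝓝[<] T) (𝓝 x)) := by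
  obtain ⟨α₀, hα₀, ε, hε, hα⟩ :=
    ContDiffAt.exists_forall_mem_closedBall_exists_eq_forall_mem_Ioo_hasDerivAt₀
      (hF.contDiffAt (x := x₀)) 0
  simp only [zero_sub, zero_add] at hα
  set S : Set ℝ := {T | 0 < T ∧ ∃ α : ℝ → E, α 0 = x₀ ∧
    ∀ t ∈ Ioo (-ε) T, HasDerivAt α (F (α t)) t} with hS
  have hεS : ε ∈ S := ⟨hε, α₀, hα₀, hα⟩
  have hglue : ∃ γ : ℝ → E, γ 0 = x₀ ∧
      ∀ T ∈ S, ∀ t ∈ Ioo (-ε) T, HasDerivAt γ (F (γ t)) t := by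
    classical
    choose! α hα0 hαd using fun T (hT : T ∈ S) => hT.2
    have hagree : ∀ T₁ ∈ S, ∀ T₂ ∈ S, T₁ ≤ T₂ → EqOn (α T₁) (α T₂) (Ioo (-ε) T₁) := by
      intro T₁ h₁ T₂ h₂ h12
      refine eqOn_of_hasDerivAt_of_contDiff hF isOpen_Ioo isPreconnected_Ioo (hαd T₁ h₁)
        (fun t ht => hαd T₂ h₂ t ⟨ht.1, ht.2.trans_le h12⟩)
        (t₀ := 0) ⟨by linarith, h₁.1⟩ (by rw [hα0 T₁ h₁, hα0 T₂ h₂])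
    have hagree' : ∀ T₁ ∈ S, ∀ T₂ ∈ S, ∀ t, -ε < t → t < T₁ → t < T₂ → α T₁ t = α T₂ t := by
      intro T₁ h₁ T₂ h₂ t ht h1 h2
      rcases le_total T₁ T₂ with h | h
      · exact hagree T₁ h₁ T₂ h₂ h ⟨ht, h1⟩
      · exact (hagree T₂ h₂ T₁ h₁ h ⟨ht, h2⟩).symm
    set γ : ℝ → E := fun t => if h : ∃ T ∈ S, t < T then α h.choose t else 0 with hγ
    have hγ_eq : ∀ T ∈ S, ∀ t ∈ Ioo (-ε) T, γ t = α T t := by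
      intro T hT t ht
      have h : ∃ T ∈ S, t < T := ⟨T, hT, ht.2⟩
      simp only [hγ, dif_pos h]
      exact hagree' _ h.choose_spec.1 T hT t ht.1 h.choose_spec.2 ht.2
    refine ⟨γ, ?_, ?_⟩
    · rw [hγ_eq ε hεS 0 ⟨by linarith, hε⟩, hα0 ε hεS]
    · intro T hT t ht
      rw [hγ_eq T hT t ht]
      refine (hαd T hT t ht).congr_of_eventuallyEq ?_
      filter_upwards [isOpen_Ioo.mem_nhds ht] with r hr using hγ_eq T hT r hr
  obtain ⟨γ, hγ0, hγ⟩ := hglue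
  refine ⟨ε, hε, γ, hγ0, ?_⟩
  by_cases hbdd : BddAbove S
  · right
    set T := sSup S with hT
    have hTpos : 0 < T := hε.trans_le (le_csSup hbdd hεS)
    have hγT : ∀ t ∈ Ioo (-ε) T, HasDerivAt γ (F (γ t)) t := by
      intro t ht
      obtain ⟨T', hT', htT'⟩ := exists_lt_of_lt_csSup ⟨ε, hεS⟩ ht.2
      exact hγ T' hT' t ⟨ht.1, htT'⟩
    refine ⟨T, hTpos, hγT, fun x hx => ?_⟩
    -- The existence time `δ` is uniform for initial values near the supposed limit `x`. Restarting
    -- at some `t₁` with `T - t₁ < δ` carries the solution past `T`, against the choice of `T` as a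
    -- supremum.
    obtain ⟨r, hr, δ, hδ, hsol⟩ :=
      ContDiffAt.exists_forall_mem_closedBall_exists_eq_forall_mem_Ioo_hasDerivAt
        (hF.contDiffAt (x := x)) 0
    simp only [zero_sub, zero_add] at hsol
    have hev : ∀ᶠ t in 𝓝[<] T, γ t ∈ Metric.closedBall x r ∧ t ∈ Ioo (max 0 (T - δ)) T :=
      (hx.eventually (Metric.closedBall_mem_nhds x hr)).and
        (Ioo_mem_nhdsLT (max_lt hTpos (by linarith)))
    obtain ⟨t₁, ht₁, ht₁'⟩ := hev.exists
    obtain ⟨β, hβ0, hβ⟩ := hsol _ ht₁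
    have ht₁0 : 0 < t₁ := (le_max_left _ _).trans_lt ht₁'.1
    have ht₁δ : T < t₁ + δ := by linarith [(le_max_right 0 (T - δ)).trans_lt ht₁'.1]
    have hβ' : ∀ t ∈ Ioo (t₁ - δ) (t₁ + δ),
        HasDerivAt (fun s => β (s - t₁)) (F (β (t - t₁))) t := by
      intro t ht
      have := hβ (t - t₁) ⟨by linarith [ht.1], by linarith [ht.2]⟩
      exact this.comp_sub_const t t₁
    have hcommon : EqOn γ (fun s => β (s - t₁)) (Ioo (max (-ε) (t₁ - δ)) T) := by
      refine eqOn_of_hasDerivAt_of_contDiff hF isOpen_Ioo isPreconnected_Ioo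
        (fun t ht => hγT t ⟨(le_max_left _ _).trans_lt ht.1, ht.2⟩)
        (fun t ht => hβ' t ⟨(le_max_right _ _).trans_lt ht.1, ht.2.trans ht₁δ⟩)
        (t₀ := t₁) ⟨max_lt (by linarith) (by linarith), ht₁'.2⟩ ?_
      simp [hβ0]
    have hmem : t₁ + δ ∈ S := by
      refine ⟨by linarith, fun t => if t < T then γ t else β (t - t₁), by simp [hTpos, hγ0], ?_⟩
      intro t ht
      rcases lt_or_ge t T with htT | htT
      · simp only [if_pos htT]
        refine (hγT t ⟨ht.1, htT⟩).congr_of_eventuallyEq ?_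
        filter_upwards [Iio_mem_nhds htT] with s hs
        exact if_pos hs
      · simp only [if_neg htT.not_gt]
        refine (hβ' t ⟨by linarith [ht₁'.2], ht.2⟩).congr_of_eventuallyEq ?_
        have hlt : max (-ε) (t₁ - δ) < t :=
          (max_lt (by linarith) (by linarith) : max (-ε) (t₁ - δ) < t₁).trans (ht₁'.2.trans_le htT)
        filter_upwards [Ioi_mem_nhds hlt] with s hs
        by_cases hsT : s < T
        · simp only [if_pos hsT]; exact hcommon ⟨hs, hsT⟩
        · simp only [if_neg hsT]
    exact absurd (le_csSup hbdd hmem) (by rw [← hT]; linarith)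
  · left
    intro t ht
    obtain ⟨T, hT, htT⟩ := not_bddAbove_iff.mp hbdd t
    exact hγ T hT t ⟨ht, htT⟩

end Flow

/-! ### Two real-variable lemmas: sign changes and a Riccati inequality -/

/-- If the points of a property `Bad` propagate to the right through `0 ≤ m` and to the left through
`m ≤ 0`, some `Bad` point is a change of `m` from positive to negative. -/
theorem exists_changesPosToNegAt {m : ℝ → ℝ} (hm : Continuous m) {Bad : ℝ → Prop}
    (hright : ∀ x y, x ≤ y → (∀ φ ∈ Icc x y, 0 ≤ m φ) → Bad x → Bad y)
    (hleft : ∀ x y, x ≤ y → (∀ φ ∈ Icc x y, m φ ≤ 0) → Bad y → Bad x)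
    (hgoodl : ∀ x, ∃ y < x, ¬ Bad y) (hgoodr : ∀ x, ∃ y > x, ¬ Bad y) {x₀ : ℝ} (h₀ : Bad x₀) :
    ∃ θ, ChangesPosToNegAt m θ ∧ Bad θ := by
  have hsup : ∀ x, Bad x → ∃ p ≤ x, IsLUB {y | y ≤ x ∧ 0 < m y} p ∧ 0 ≤ m p ∧
      ∀ y ∈ Ioc p x, m y ≤ 0 := by
    intro x hx
    have hne : {y | y ≤ x ∧ 0 < m y}.Nonempty := by
      obtain ⟨y, hyx, hy⟩ := hgoodl x
      by_contra hem
      rw [not_nonempty_iff_eq_empty] at hem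
      refine hy (hleft y x hyx.le (fun φ hφ => ?_) hx)
      by_contra hpos
      exact (hem ▸ (⟨hφ.2, not_le.mp hpos⟩ : φ ∈ {y | y ≤ x ∧ 0 < m y}) : φ ∈ (∅ : Set ℝ))
    have hlub := isLUB_csSup hne ⟨x, fun y hy => hy.1⟩
    refine ⟨_, hlub.2 fun y hy => hy.1, hlub, ?_, fun y hy => ?_⟩
    · exact closure_minimal (fun y (hy : y ≤ x ∧ 0 < m y) => hy.2.le)
        (isClosed_le continuous_const hm) (hlub.mem_closure hne)
    · by_contra hpos
      exact hy.1.not_ge (hlub.1 ⟨hy.2, not_le.mp hpos⟩)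
  -- `p` is the supremum of the positive points up to `x₀`; badness moves left to it. From `p` it
  -- moves right to `q`, the infimum of the negative points beyond `p`.
  obtain ⟨p, hpx, hlubp, hmp, hp⟩ := hsup x₀ h₀
  have hBp : Bad p := by
    rcases hpx.eq_or_lt with rfl | hlt
    · exact h₀
    · refine hleft p x₀ hpx (fun φ hφ => ?_) h₀
      exact closure_minimal (s := Ioc p x₀) (t := {y | m y ≤ 0}) hp
        (isClosed_le hm continuous_const) (by rwa [closure_Ioc hlt.ne])
  obtain ⟨y₀, hy₀, hgood⟩ := hgoodr p
  have hne : {y | p ≤ y ∧ m y < 0}.Nonempty := by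
    by_contra hem
    rw [not_nonempty_iff_eq_empty] at hem
    refine hgood (hright p y₀ hy₀.le (fun φ hφ => ?_) hBp)
    by_contra hneg
    exact (hem ▸ (⟨hφ.1, not_le.mp hneg⟩ : φ ∈ {y | p ≤ y ∧ m y < 0}) : φ ∈ (∅ : Set ℝ))
  have hglb := isGLB_csInf hne ⟨p, fun y hy => hy.1⟩
  set q := sInf {y | p ≤ y ∧ m y < 0}
  have hpq : p ≤ q := hglb.2 fun y hy => hy.1
  have hmq : m q ≤ 0 := closure_minimal (fun y (hy : p ≤ y ∧ m y < 0) => hy.2.le)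
    (isClosed_le hm continuous_const) (hglb.mem_closure hne)
  have hIco : ∀ y ∈ Ico p q, 0 ≤ m y := fun y hy => by
    by_contra hneg
    exact hy.2.not_ge (hglb.1 ⟨hy.1, not_le.mp hneg⟩)
  have hIcc : ∀ y ∈ Icc p q, 0 ≤ m y := by
    intro y hy
    rcases hpq.eq_or_lt with heq | hlt
    · rwa [le_antisymm (hy.2.trans heq.ge) hy.1]
    · exact closure_minimal (s := Ico p q) (t := {y | 0 ≤ m y}) hIco
        (isClosed_le continuous_const hm) (by rwa [closure_Ico hlt.ne])
  have hBq : Bad q := hright p q hpq hIcc hBp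
  have hmq0 : m q = 0 := le_antisymm hmq (hIcc q ⟨hpq, le_rfl⟩)
  -- `m` may still be positive between `p` and `q`, so the left end of the zero interval is sought
  -- again, now starting from `q`.
  obtain ⟨r, hrq, hlub, hmr, hr⟩ := hsup q hBq
  have hpr : p ≤ r := by
    refine hlubp.2 fun y hy => ?_
    exact hlub.1 ⟨(hlubp.1 hy).trans hpq, hy.2⟩
  have hzero : ∀ y ∈ Icc r q, m y = 0 := by
    intro y hy
    refine le_antisymm ?_ (hIcc y ⟨hpr.trans hy.1, hy.2⟩)
    rcases hrq.eq_or_lt with heq | hlt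
    · rw [le_antisymm hy.2 (heq.ge.trans hy.1), hmq0]
    · exact closure_minimal (s := Ioc r q) (t := {y | m y ≤ 0}) hr
        (isClosed_le hm continuous_const) (by rwa [closure_Ioc hlt.ne])
  have hne' : {y | y ≤ q ∧ 0 < m y}.Nonempty := by
    by_contra hem
    rw [not_nonempty_iff_eq_empty] at hem
    rw [hem] at hlub
    have := hlub.2 (fun y hy => hy.elim : r - 1 ∈ upperBounds ∅)
    linarith
  refine ⟨q, ⟨r, q, hrq, le_rfl, hzero, ?_, ?_⟩, hBq⟩
  · have h := frequently_nhdsWithin_iff.mp (hlub.frequently_mem hne')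
    refine frequently_nhdsWithin_iff.mpr (h.mono fun y hy =>
      ⟨hy.1.2, mem_Iio.mpr (lt_of_le_of_ne (mem_Iic.mp hy.2) ?_)⟩)
    rintro rfl
    exact hy.1.2.ne' (hzero _ ⟨le_rfl, hrq⟩)
  · have h := frequently_nhdsWithin_iff.mp (hglb.frequently_mem hne)
    refine frequently_nhdsWithin_iff.mpr (h.mono fun y hy =>
      ⟨hy.1.2, mem_Ioi.mpr (lt_of_le_of_ne (mem_Ici.mp hy.2) ?_)⟩)
    rintro rfl
    exact hy.1.2.ne hmq0

/-- A global solution of a Riccati inequality with affine forcing has an affine lower bound. -/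
theorem exists_lower_bound_of_riccati {β A B : ℝ} (hβ : 0 < β) (hA : 0 ≤ A) (hB : 0 ≤ B) :
    ∃ R : ℝ, ∀ w w' : ℝ → ℝ, (∀ t, 0 ≤ t → HasDerivAt w (w' t) t) →
      (∀ t, 0 ≤ t → w' t ≤ -β * w t ^ 2 + (A + B * t)) → ∀ t, 0 ≤ t → -R * (1 + t) ≤ w t := by
  -- Suppose `w < -r` at `t₀`, where `r = R(1 + t₀)`. The middle term of `R` makes the forcing at
  -- most `β r² / 2` on `[t₀, t₀ + 1]`, so that `w' ≤ -β w² / 2` there; the last makes the resulting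
  -- blow-up time `2 / (β r)` less than one. `R` does not depend on `w`, hence will serve all
  -- particles at once.
  set R := 1 + 2 * (A + B) / β + 4 / β with hR
  have hq : 0 ≤ 2 * (A + B) / β := by positivity
  have hp : 0 < 4 / β := by positivity
  have hR1 : 1 ≤ R := by linarith
  have hβR : 4 ≤ β * R := by
    have : β * (4 / β) = 4 := by field_simp
    nlinarith
  have hβR2 : 2 * (A + B) ≤ β * R := by
    have : β * (2 * (A + B) / β) = 2 * (A + B) := by field_simp
    nlinarith
  refine ⟨R, fun w w' hw hle t₀ ht₀ => ?_⟩
  by_contra! hlt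
  set r := R * (1 + t₀) with hr
  have hr1 : 1 ≤ r := by nlinarith
  have hRr : R ≤ r := by nlinarith
  have hforce : ∀ t ∈ Icc t₀ (t₀ + 1), A + B * t ≤ β * r ^ 2 / 2 := by
    intro t ht
    have h1 : A + B * t ≤ A + B * (t₀ + 1) := by nlinarith [ht.2]
    have h2 : A + B * (t₀ + 1) ≤ (A + B) * (1 + t₀) := by nlinarith
    have h3 : 2 * ((A + B) * (1 + t₀)) ≤ β * r := by rw [hr]; nlinarith
    have h4 : β * r ≤ β * r ^ 2 := by
      nlinarith [mul_nonneg (mul_nonneg hβ.le (by linarith : 0 ≤ r)) (sub_nonneg.2 hr1)]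
    linarith
  have hcont : ContinuousOn w (Icc t₀ (t₀ + 1)) := fun t ht =>
    (hw t (ht₀.trans ht.1)).continuousAt.continuousWithinAt
  have hbelow : ∀ t ∈ Icc t₀ (t₀ + 1), w t ≤ -r := by
    refine image_le_of_deriv_right_lt_deriv_boundary' (B := fun _ => -r) (B' := fun _ => 0) hcont
      (fun t ht => (hw t (ht₀.trans ht.1)).hasDerivWithinAt) (by simpa [hr] using hlt.le)
      continuousOn_const (fun t _ => hasDerivWithinAt_const _ _ _) ?_
    intro t ht hwt
    have := hle t (ht₀.trans ht.1)
    have h5 := hforce t ⟨ht.1, ht.2.le⟩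
    rw [hwt] at this
    nlinarith
  have hinv : ∀ t ∈ Icc t₀ (t₀ + 1), -1 / r + β / 2 * (t - t₀) ≤ (w t)⁻¹ := by
    refine image_le_of_deriv_right_le_deriv_boundary (B := fun t => (w t)⁻¹)
      (f' := fun _ => β / 2) (B' := fun t => -w' t / w t ^ 2)
      (by fun_prop) (fun t _ => ?_) ?_ ?_ ?_ ?_
    · simpa using ((((hasDerivAt_id t).sub_const t₀).const_mul (β / 2)).const_add
        (-1 / r)).hasDerivWithinAt
    · have h0 := hbelow t₀ ⟨le_rfl, by linarith⟩
      have : (-w t₀)⁻¹ ≤ r⁻¹ := inv_anti₀ (by linarith) (by linarith)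
      rw [inv_neg] at this
      simp only [sub_self, mul_zero, add_zero]
      rw [neg_div, one_div]; linarith
    · exact hcont.inv₀ fun t ht => by have := hbelow t ht; linarith
    · intro t ht
      have := hbelow t ⟨ht.1, ht.2.le⟩
      exact ((hw t (ht₀.trans ht.1)).inv (by linarith)).hasDerivWithinAt
    · intro t ht
      have h6 := hbelow t ⟨ht.1, ht.2.le⟩
      have h7 := hle t (ht₀.trans ht.1)
      have h8 := hforce t ⟨ht.1, ht.2.le⟩
      have h9 : r ^ 2 ≤ w t ^ 2 := by nlinarith
      rw [le_div_iff₀ (by nlinarith)]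
      nlinarith
  have h1 := hinv (t₀ + 1) ⟨by linarith, le_rfl⟩
  have h2 := hbelow (t₀ + 1) ⟨by linarith, le_rfl⟩
  have h3 : (w (t₀ + 1))⁻¹ < 0 := inv_lt_zero.mpr (by linarith)
  have h4 : -1 / r + β / 2 * (t₀ + 1 - t₀) < 0 := h1.trans_lt h3
  have h5 : 1 / r * r = 1 := by field_simp
  have h6 : 4 ≤ β * r := by nlinarith
  have h7 : 0 < 1 / r := by positivity
  rw [neg_div] at h4
  have h8 : β / 2 < 1 / r := by linarith
  nlinarith

/-! ### The Banach algebra of continuous functions on the circle -/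

section CircleFunctions

/-- The continuous function on the circle with a given `1`-periodic lift. -/
noncomputable def Function.Periodic.toCircle {g : ℝ → ℝ} (hp : Function.Periodic g 1)
    (hg : Continuous g) : C(UnitAddCircle, ℝ) :=
  ⟨hp.lift, continuous_coinduced_dom.mpr hg⟩

@[simp] theorem Function.Periodic.toCircle_coe {g : ℝ → ℝ} (hp : Function.Periodic g 1)
    (hg : Continuous g) (θ : ℝ) : hp.toCircle hg (θ : UnitAddCircle) = g θ := rfl

theorem ContinuousMap.continuous_coe_circle (f : C(UnitAddCircle, ℝ)) :
    Continuous fun θ : ℝ => f θ :=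
  f.continuous.comp (AddCircle.continuous_mk' 1)

theorem ContinuousMap.periodic_circle (f : C(UnitAddCircle, ℝ)) :
    Function.Periodic (fun θ : ℝ => f θ) 1 := fun θ => by
  simp only [AddCircle.coe_add_period]

theorem UnitAddCircle.exists_rep (x : UnitAddCircle) : ∃ θ ∈ Icc (0 : ℝ) 1, (θ : UnitAddCircle) = x := by
  have h := AddCircle.coe_image_Icc_eq (1 : ℝ) 0
  rw [zero_add] at h
  have : x ∈ ((↑) '' Icc (0 : ℝ) 1 : Set UnitAddCircle) := by rw [h]; exact mem_univ x
  exact this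

theorem ContinuousMap.norm_circle_le {f : C(UnitAddCircle, ℝ)} {C : ℝ} (hC : 0 ≤ C)
    (h : ∀ θ ∈ Icc (0 : ℝ) 1, |f θ| ≤ C) : ‖f‖ ≤ C := by
  refine (ContinuousMap.norm_le _ hC).mpr fun x => ?_
  obtain ⟨θ, hθ, rfl⟩ := UnitAddCircle.exists_rep x
  exact h θ hθ

theorem ContinuousMap.norm_intervalIntegral_circle_le (f : C(UnitAddCircle, ℝ)) (θ : ℝ) :
    |∫ φ in (0 : ℝ)..θ, f φ| ≤ ‖f‖ * |θ| := by
  have := intervalIntegral.norm_integral_le_of_norm_le_const (a := 0) (b := θ)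
    (f := fun φ : ℝ => f φ) (C := ‖f‖) fun φ _ => f.norm_coe_le_norm φ
  simpa using this

/-- The mean value of a continuous function on the circle. -/
noncomputable def circleMeanL : C(UnitAddCircle, ℝ) →L[ℝ] ℝ :=
  LinearMap.mkContinuous
    { toFun := fun f => ∫ θ in (0 : ℝ)..1, f θ
      map_add' := fun f g => by
        have := intervalIntegral.integral_add (μ := MeasureTheory.volume)
          (f.continuous_coe_circle.intervalIntegrable 0 1)
          (g.continuous_coe_circle.intervalIntegrable 0 1)
        simpa using this
      map_smul' := fun c f => by simp } 1
    fun f => by simpa using f.norm_intervalIntegral_circle_le 1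

theorem circleMeanL_apply (f : C(UnitAddCircle, ℝ)) :
    circleMeanL f = ∫ θ in (0 : ℝ)..1, f θ := rfl

theorem ContinuousMap.periodic_primitive (f : C(UnitAddCircle, ℝ)) :
    Function.Periodic (fun θ : ℝ => (∫ φ in (0 : ℝ)..θ, f φ) - θ * circleMeanL f) 1 := fun θ => by
  have h1 := intervalIntegral.integral_add_adjacent_intervals (μ := MeasureTheory.volume)
    (f.continuous_coe_circle.intervalIntegrable 0 θ)
    (f.continuous_coe_circle.intervalIntegrable θ (θ + 1))
  have h2 := f.periodic_circle.intervalIntegral_add_eq θ 0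
  simp only [← h1, h2, circleMeanL_apply, zero_add]
  ring

theorem ContinuousMap.continuous_primitive (f : C(UnitAddCircle, ℝ)) :
    Continuous (fun θ : ℝ => (∫ φ in (0 : ℝ)..θ, f φ) - θ * circleMeanL f) :=
  (intervalIntegral.continuous_primitive (μ := MeasureTheory.volume)
    (fun a b => f.continuous_coe_circle.intervalIntegrable a b) 0).sub (by fun_prop)

/-- The primitive, vanishing at `0`, of a continuous function on the circle minus its mean. -/
noncomputable def circlePrimL : C(UnitAddCircle, ℝ) →L[ℝ] C(UnitAddCircle, ℝ) :=
  LinearMap.mkContinuous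
    { toFun := fun f => f.periodic_primitive.toCircle f.continuous_primitive
      map_add' := fun f g => by
        ext x
        obtain ⟨θ, -, rfl⟩ := UnitAddCircle.exists_rep x
        have := intervalIntegral.integral_add (μ := MeasureTheory.volume)
          (f.continuous_coe_circle.intervalIntegrable 0 θ)
          (g.continuous_coe_circle.intervalIntegrable 0 θ)
        simp only [ContinuousMap.add_apply, Function.Periodic.toCircle_coe, map_add, this]
        ring
      map_smul' := fun c f => by
        ext x
        obtain ⟨θ, -, rfl⟩ := UnitAddCircle.exists_rep x
        simp only [ContinuousMap.smul_apply, Function.Periodic.toCircle_coe, map_smul, smul_eq_mul,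
          RingHom.id_apply, intervalIntegral.integral_const_mul]
        ring } 2
    fun f => by
      refine ContinuousMap.norm_circle_le (by positivity) fun θ hθ => ?_
      have h1 := f.norm_intervalIntegral_circle_le θ
      have h2 := f.norm_intervalIntegral_circle_le 1
      rw [abs_one, mul_one, ← circleMeanL_apply] at h2
      have h3 : |θ| ≤ 1 := abs_le.mpr ⟨by linarith [hθ.1], hθ.2⟩
      calc |(∫ φ in (0 : ℝ)..θ, f φ) - θ * circleMeanL f|
          ≤ |∫ φ in (0 : ℝ)..θ, f φ| + |θ * circleMeanL f| := abs_sub _ _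
        _ ≤ ‖f‖ * |θ| + |θ| * |circleMeanL f| := by rw [abs_mul]; gcongr
        _ ≤ ‖f‖ * 1 + 1 * ‖f‖ := by gcongr
        _ = 2 * ‖f‖ := by ring

theorem circlePrimL_coe (f : C(UnitAddCircle, ℝ)) (θ : ℝ) :
    circlePrimL f θ = (∫ φ in (0 : ℝ)..θ, f φ) - θ * circleMeanL f := rfl

/-- Identifies the pointwise exponential with the one of the Banach algebra; the latter is analytic,
so smoothness of `ζ ↦ e^ζ` comes for free. -/
theorem ContinuousMap.exp_apply (f : C(UnitAddCircle, ℝ)) (x : UnitAddCircle) :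
    NormedSpace.exp f x = Real.exp (f x) := by
  rw [Real.exp_eq_exp_ℝ]
  exact NormedSpace.map_exp (𝔹 := ℝ) (ContinuousMap.evalAlgHom ℝ ℝ x) (continuous_eval_const x) f

theorem ContinuousMap.contDiff_exp :
    ContDiff ℝ 1 (NormedSpace.exp : C(UnitAddCircle, ℝ) → C(UnitAddCircle, ℝ)) :=
  contDiff_iff_contDiffAt.mpr fun x => (NormedSpace.exp_analytic (𝕂 := ℝ) x).contDiffAt

theorem circleMeanL_exp_pos (f : C(UnitAddCircle, ℝ)) : 0 < circleMeanL (NormedSpace.exp f) := by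
  refine intervalIntegral.intervalIntegral_pos_of_pos
    ((ContinuousMap.continuous_coe_circle _).intervalIntegrable _ _) (fun θ => ?_) one_pos
  rw [ContinuousMap.exp_apply]; positivity

theorem continuousOn_eval_circle {J : Set ℝ} {γ : ℝ → C(UnitAddCircle, ℝ)} (hγ : ContinuousOn γ J) :
    ContinuousOn (fun p : ℝ × ℝ => γ p.1 (p.2 : UnitAddCircle)) (J ×ˢ univ) := by
  have h1 : ContinuousOn (fun p : ℝ × ℝ => γ p.1) (J ×ˢ univ) :=
    hγ.comp continuousOn_fst fun p hp => hp.1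
  exact h1.eval ((AddCircle.continuous_mk' 1).comp continuous_snd).continuousOn

theorem hasDerivAt_eval_circle {γ : ℝ → C(UnitAddCircle, ℝ)} {γ' : C(UnitAddCircle, ℝ)} {t : ℝ}
    (hγ : HasDerivAt γ γ' t) (θ : UnitAddCircle) : HasDerivAt (fun s => γ s θ) (γ' θ) t :=
  (ContinuousMap.evalCLM ℝ (M := ℝ) θ).hasFDerivAt.comp_hasDerivAt t hγ

end CircleFunctions

/-! ### The vector field on `C(S¹)` -/

section VectorField

variable (κ : ℝ) (m : C(UnitAddCircle, ℝ))

/-- The mean of the momentum that is transported by the flow with `log η_θ = ζ`. -/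
noncomputable def transportedMean (ζ : C(UnitAddCircle, ℝ)) : ℝ :=
  circleMeanL (m * NormedSpace.exp (-κ • ζ)) / circleMeanL (NormedSpace.exp ζ)

/-- `η_θ u_θθ(η)` in terms of `ζ = log η_θ`. -/
noncomputable def strainDensity (ζ : C(UnitAddCircle, ℝ)) : C(UnitAddCircle, ℝ) :=
  transportedMean κ m ζ • NormedSpace.exp ζ - m * NormedSpace.exp (-κ • ζ)

/-- `u_θ(η)` in terms of `ζ = log η_θ`. -/
noncomputable def strain (ζ : C(UnitAddCircle, ℝ)) : C(UnitAddCircle, ℝ) :=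
  circlePrimL (strainDensity κ m ζ) -
    (circleMeanL (circlePrimL (strainDensity κ m ζ) * NormedSpace.exp ζ) /
      circleMeanL (NormedSpace.exp ζ)) • (1 : C(UnitAddCircle, ℝ))

theorem contDiff_transportedMean : ContDiff ℝ 1 (transportedMean κ m) := by
  have h1 := ContinuousMap.contDiff_exp
  have h2 : ContDiff ℝ 1 fun ζ : C(UnitAddCircle, ℝ) => NormedSpace.exp (-κ • ζ) :=
    h1.comp (contDiff_id.const_smul (-κ))
  exact (circleMeanL.contDiff.comp (contDiff_const.mul h2)).div (circleMeanL.contDiff.comp h1)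
    fun ζ => (circleMeanL_exp_pos ζ).ne'

theorem contDiff_strainDensity : ContDiff ℝ 1 (strainDensity κ m) := by
  have h1 := ContinuousMap.contDiff_exp
  have h2 : ContDiff ℝ 1 fun ζ : C(UnitAddCircle, ℝ) => NormedSpace.exp (-κ • ζ) :=
    h1.comp (contDiff_id.const_smul (-κ))
  exact ((contDiff_transportedMean κ m).smul h1).sub (contDiff_const.mul h2)

theorem contDiff_strain : ContDiff ℝ 1 (strain κ m) := by
  have h1 := ContinuousMap.contDiff_exp
  have h3 := circlePrimL.contDiff.comp (contDiff_strainDensity κ m)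
  exact h3.sub (((circleMeanL.contDiff.comp (h3.mul h1)).div (circleMeanL.contDiff.comp h1)
    fun ζ => (circleMeanL_exp_pos ζ).ne').smul contDiff_const)

/-- This is the reason for the quotient in `transportedMean`: the density has a periodic primitive
at every `ζ`, also off the set `∫ e^ζ = 1`, so the field is defined on the whole space. -/
theorem circleMeanL_strainDensity (ζ : C(UnitAddCircle, ℝ)) :
    circleMeanL (strainDensity κ m ζ) = 0 := by
  have := (circleMeanL_exp_pos ζ).ne'
  simp only [strainDensity, map_sub, map_smul, transportedMean, smul_eq_mul]
  field_simp
  ring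

/-- In Eulerian terms, `u_θ` integrates to zero over the circle. Along the flow it makes `∫ e^ζ`
constant. -/
theorem circleMeanL_strain_mul_exp (ζ : C(UnitAddCircle, ℝ)) :
    circleMeanL (strain κ m ζ * NormedSpace.exp ζ) = 0 := by
  have := (circleMeanL_exp_pos ζ).ne'
  simp only [strain, sub_mul, map_sub, smul_mul_assoc, one_mul, map_smul, smul_eq_mul]
  field_simp
  ring

theorem strain_coe_sub (ζ : C(UnitAddCircle, ℝ)) (θ : ℝ) :
    strain κ m ζ θ - strain κ m ζ (0 : ℝ) = ∫ φ in (0 : ℝ)..θ, strainDensity κ m ζ φ := by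
  simp only [strain, ContinuousMap.sub_apply, circlePrimL_coe, circleMeanL_strainDensity,
    ContinuousMap.smul_apply, ContinuousMap.one_apply, intervalIntegral.integral_same]
  ring

end VectorField

/-! ### Solutions in Lagrangian variables -/

/-- A solution on the time interval `J` in Lagrangian variables: `ζ = log η_θ`, `V = u_θ(η)`,
for the momentum `m`, where `κ = lam - 1`. -/
structure LagrangianSolution (κ : ℝ) (m : ℝ → ℝ) (J : Set ℝ) (ζ V dV : ℝ → ℝ → ℝ) : Prop where
  cont_m : Continuous m
  periodic_m : Function.Periodic m 1
  isOpen : IsOpen J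
  preconnected : IsPreconnected J
  zero_mem : 0 ∈ J
  cont_ζ : ContinuousOn (fun p : ℝ × ℝ => ζ p.1 p.2) (J ×ˢ univ)
  cont_V : ContinuousOn (fun p : ℝ × ℝ => V p.1 p.2) (J ×ˢ univ)
  cont_dV : ContinuousOn (fun p : ℝ × ℝ => dV p.1 p.2) (J ×ˢ univ)
  periodic_ζ : ∀ t, Function.Periodic (ζ t) 1
  periodic_V : ∀ t, Function.Periodic (V t) 1
  ζ_zero : ∀ θ, ζ 0 θ = 0
  deriv_ζ : ∀ t ∈ J, ∀ θ, HasDerivAt (fun s => ζ s θ) (V t θ) t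
  deriv_V : ∀ t ∈ J, ∀ θ, HasDerivAt (fun s => V s θ) (dV t θ) t
  strain_eq : ∀ t ∈ J, ∀ θ, V t θ - V t 0 =
    ∫ φ in (0 : ℝ)..θ, (circleMean m * Real.exp (ζ t φ) - m φ * Real.exp (-κ * ζ t φ))
  mean_exp : ∀ t ∈ J, ∫ θ in (0 : ℝ)..1, Real.exp (ζ t θ) = 1
  mean_V : ∀ t ∈ J, ∫ θ in (0 : ℝ)..1, V t θ * Real.exp (ζ t θ) = 0

theorem eq_of_hasDerivAt_zero {J : Set ℝ} (hJ : IsOpen J) (hJc : IsPreconnected J) {f : ℝ → ℝ}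
    (hf : ∀ t ∈ J, HasDerivAt f 0 t) {s t : ℝ} (hs : s ∈ J) (ht : t ∈ J) : f s = f t :=
  hJ.is_const_of_deriv_eq_zero hJc
    (fun x hx => (hf x hx).differentiableAt.differentiableWithinAt) (fun x hx => (hf x hx).deriv)
    hs ht

/-- Two conservation laws turn the normalised field into the actual equation: `∫ e^ζ` stays `1`,
because `∫ V e^ζ = 0`, and then the transported mean stays equal to the initial mean. The time
derivative of `V` exists and is continuous because the field is `C¹`. -/
theorem lagrangianSolution_of_curve (κ : ℝ) {m : ℝ → ℝ} (hm : Continuous m)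
    (hmp : Function.Periodic m 1) {J : Set ℝ} (hJ : IsOpen J) (hJc : IsPreconnected J)
    (h0 : 0 ∈ J) {γ : ℝ → C(UnitAddCircle, ℝ)} (hγ0 : γ 0 = 0)
    (hγ : ∀ t ∈ J, HasDerivAt γ (strain κ (hmp.toCircle hm) (γ t)) t) :
    ∃ dV, LagrangianSolution κ m J (fun t θ => γ t θ)
      (fun t θ => strain κ (hmp.toCircle hm) (γ t) θ) dV := by
  set M := hmp.toCircle hm
  have hF := contDiff_strain κ M
  have hγc : ContinuousOn γ J := HasDerivAt.continuousOn hγ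
  have hVc : ContinuousOn (fun t => strain κ M (γ t)) J := hF.continuous.comp_continuousOn hγc
  have hVd : ∀ t ∈ J, HasDerivAt (fun t => strain κ M (γ t))
      (fderiv ℝ (strain κ M) (γ t) (strain κ M (γ t))) t := fun t ht =>
    ((hF.differentiable one_ne_zero) (γ t)).hasFDerivAt.comp_hasDerivAt t (hγ t ht)
  have hdVc : ContinuousOn (fun t => fderiv ℝ (strain κ M) (γ t) (strain κ M (γ t))) J :=
    ((hF.continuous_fderiv one_ne_zero).comp_continuousOn hγc).clm_apply hVc
  have cζ := continuousOn_eval_circle hγc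
  have cV := continuousOn_eval_circle hVc
  have cm : ContinuousOn (fun p : ℝ × ℝ => m p.2) (J ×ˢ univ) := by fun_prop
  have hdζ : ∀ t ∈ J, ∀ θ : ℝ, HasDerivAt (fun s => γ s θ) (strain κ M (γ t) θ) t :=
    fun t ht θ => hasDerivAt_eval_circle (hγ t ht) θ
  have hmeanV : ∀ t ∈ J, ∫ θ in (0 : ℝ)..1, strain κ M (γ t) θ * Real.exp (γ t θ) = 0 := by
    intro t _
    simpa [circleMeanL_apply, ContinuousMap.exp_apply] using circleMeanL_strain_mul_exp κ M (γ t)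
  have hmean : ∀ t ∈ J, ∫ θ in (0 : ℝ)..1, Real.exp (γ t θ) = 1 := by
    intro t ht
    have h := eq_of_hasDerivAt_zero hJ hJc (f := fun t => ∫ θ in (0 : ℝ)..1, Real.exp (γ t θ))
      (fun s hs => ?_) ht h0
    · simpa [hγ0] using h
    · refine (?_ : HasDerivAt _ _ s).congr_deriv (hmeanV s hs)
      refine hasDerivAt_intervalIntegral hJ (f := fun t θ => Real.exp (γ t θ))
        (f' := fun t θ => strain κ M (γ t) θ * Real.exp (γ t θ)) cζ.rexp (cV.mul cζ.rexp)
        (fun r hr θ => ?_) hs 0 1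
      rw [mul_comm]
      exact (hdζ r hr θ).exp
  have hexp : ∀ t, ∀ θ : ℝ, NormedSpace.exp (-κ • γ t) θ = Real.exp (-κ * γ t θ) := by
    intro t θ; simp [ContinuousMap.exp_apply]
  have htm : ∀ t ∈ J, transportedMean κ M (γ t) =
      ∫ θ in (0 : ℝ)..1, m θ * Real.exp (-κ * γ t θ) := by
    intro t ht
    have h1 : circleMeanL (NormedSpace.exp (γ t)) = 1 := by
      simp only [circleMeanL_apply, ContinuousMap.exp_apply, hmean t ht]
    rw [transportedMean, h1, div_one, circleMeanL_apply]
    simp only [ContinuousMap.mul_apply, hexp]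
    rfl
  have hdens : ∀ t, ∀ θ : ℝ, strainDensity κ M (γ t) θ =
      transportedMean κ M (γ t) * Real.exp (γ t θ) - m θ * Real.exp (-κ * γ t θ) := by
    intro t θ
    simp only [strainDensity, ContinuousMap.sub_apply, ContinuousMap.smul_apply,
      ContinuousMap.mul_apply, hexp, ContinuousMap.exp_apply, smul_eq_mul]
    rfl
  have hVθ : ∀ t, ∀ θ : ℝ, HasDerivAt (fun θ : ℝ => strain κ M (γ t) θ)
      (strainDensity κ M (γ t) θ) θ := by
    intro t θ
    have h := (intervalIntegral.integral_hasDerivAt_right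
      ((strainDensity κ M (γ t)).continuous_coe_circle.intervalIntegrable 0 θ)
      ((strainDensity κ M (γ t)).continuous_coe_circle.stronglyMeasurableAtFilter _ _)
      (strainDensity κ M (γ t)).continuous_coe_circle.continuousAt).add_const
      (strain κ M (γ t) (0 : ℝ))
    refine h.congr_of_eventuallyEq (Eventually.of_forall fun φ => ?_)
    simp only [← strain_coe_sub]
    ring
  have hconst : ∀ t ∈ J, transportedMean κ M (γ t) = circleMean m := by
    intro t ht
    rw [htm t ht]
    have h := eq_of_hasDerivAt_zero hJ hJc
      (f := fun t => ∫ θ in (0 : ℝ)..1, m θ * Real.exp (-κ * γ t θ)) (fun s hs => ?_) ht h0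
    · simpa [hγ0, circleMean] using h
    · have h1 := hasDerivAt_intervalIntegral hJ (f := fun t θ => m θ * Real.exp (-κ * γ t θ))
        (f' := fun t θ => m θ * (Real.exp (-κ * γ t θ) * (-κ * strain κ M (γ t) θ)))
        (cm.mul (continuousOn_const.mul cζ).rexp)
        (cm.mul ((continuousOn_const.mul cζ).rexp.mul (continuousOn_const.mul cV)))
        (fun r hr θ => (((hdζ r hr θ).const_mul (-κ)).exp).const_mul (m θ)) hs 0 1
      -- Eliminate `m e^{-κζ}` through the formula for `V_θ`: the integrand becomes `κ V V_θ`, an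
      -- exact derivative, minus a multiple of `V e^ζ`, whose mean vanishes.
      have h2 : ∫ θ in (0 : ℝ)..1, m θ * (Real.exp (-κ * γ s θ) * (-κ * strain κ M (γ s) θ)) = 0 := by
        have h3 : ∀ θ : ℝ, m θ * (Real.exp (-κ * γ s θ) * (-κ * strain κ M (γ s) θ)) =
            κ * (strain κ M (γ s) θ * strainDensity κ M (γ s) θ) -
              κ * transportedMean κ M (γ s) * (strain κ M (γ s) θ * Real.exp (γ s θ)) := by
          intro θ; rw [hdens]; ring
        have c1 := (strain κ M (γ s)).continuous_coe_circle
        have c2 := (strainDensity κ M (γ s)).continuous_coe_circle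
        have c3 := (γ s).continuous_coe_circle
        have h4 : ∫ θ in (0 : ℝ)..1, strain κ M (γ s) θ * strainDensity κ M (γ s) θ = 0 := by
          have h5 := intervalIntegral.integral_eq_sub_of_hasDerivAt (a := 0) (b := 1)
            (f := fun θ : ℝ => strain κ M (γ s) θ ^ 2 / 2)
            (f' := fun θ : ℝ => strain κ M (γ s) θ * strainDensity κ M (γ s) θ)
            (fun θ _ => by
              refine (((hVθ s θ).pow 2).div_const 2).congr_deriv ?_
              simp only [pow_one, Nat.cast_ofNat, Nat.add_one_sub_one]
              ring)
            ((c1.mul c2).intervalIntegrable _ _)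
          rw [h5, sub_eq_zero]
          have := (strain κ M (γ s)).periodic_circle 0
          simp only [zero_add] at this
          rw [this]
        simp only [h3]
        rw [intervalIntegral.integral_sub (Continuous.intervalIntegrable (by fun_prop) _ _)
          (Continuous.intervalIntegrable (by fun_prop) _ _),
          intervalIntegral.integral_const_mul, intervalIntegral.integral_const_mul, h4, hmeanV s hs]
        ring
      rwa [h2] at h1
  refine ⟨fun t θ => fderiv ℝ (strain κ M) (γ t) (strain κ M (γ t)) θ, ?_⟩
  exact
    { cont_m := hm
      periodic_m := hmp
      isOpen := hJ
      preconnected := hJc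
      zero_mem := h0
      cont_ζ := cζ
      cont_V := cV
      cont_dV := continuousOn_eval_circle hdVc
      periodic_ζ := fun t => (γ t).periodic_circle
      periodic_V := fun t => (strain κ M (γ t)).periodic_circle
      ζ_zero := fun θ => by simp [hγ0]
      deriv_ζ := hdζ
      deriv_V := fun t ht θ => hasDerivAt_eval_circle (hVd t ht) θ
      strain_eq := fun t ht θ => by
        rw [strain_coe_sub]
        simp only [hdens, hconst t ht]
      mean_exp := hmean
      mean_V := hmeanV }

/-- The solution in Lagrangian variables is global, or `V = u_θ(η)` is unbounded near the finite
end `T` of its interval of existence. -/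
theorem exists_lagrangianSolution (κ : ℝ) {m : ℝ → ℝ} (hm : Continuous m)
    (hmp : Function.Periodic m 1) :
    ∃ ε > 0, ∃ ζ V dV : ℝ → ℝ → ℝ, LagrangianSolution κ m (Ioi (-ε)) ζ V dV ∨
      ∃ T > 0, LagrangianSolution κ m (Ioo (-ε) T) ζ V dV ∧
        ∀ t₀ < T, ∀ C, ∃ t ∈ Ioo t₀ T, ∃ θ, C < |V t θ| := by
  obtain ⟨ε, hε, γ, hγ0, hγ | ⟨T, hT, hγ, hlim⟩⟩ :=
    exists_maximal_solution (contDiff_strain κ (hmp.toCircle hm)) 0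
  · obtain ⟨dV, h⟩ := lagrangianSolution_of_curve κ hm hmp isOpen_Ioi isPreconnected_Ioi
      (by simpa using hε) hγ0 hγ
    exact ⟨ε, hε, _, _, dV, Or.inl h⟩
  · obtain ⟨dV, h⟩ := lagrangianSolution_of_curve κ hm hmp isOpen_Ioo isPreconnected_Ioo
      (by simpa using ⟨hε, hT⟩) hγ0 hγ
    refine ⟨ε, hε, _, _, dV, Or.inr ⟨T, hT, h, fun t₀ ht₀ C => ?_⟩⟩
    by_contra! hC
    have hs : ∀ t ∈ Ioo (max t₀ (-ε)) T, ‖strain κ (hmp.toCircle hm) (γ t)‖ ≤ |C| := by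
      intro t ht
      refine ContinuousMap.norm_circle_le (abs_nonneg _) fun θ _ => ?_
      exact (hC t ⟨(le_max_left _ _).trans_lt ht.1, ht.2⟩ θ).trans (le_abs_self C)
    -- A bound on `V = ζ_t` makes the curve Lipschitz up to `T`, hence convergent, which maximality
    -- excludes.
    have hlip : LipschitzOnWith (Real.toNNReal |C|) γ (Ioo (max t₀ (-ε)) T) := by
      refine (convex_Ioo _ _).lipschitzOnWith_of_nnnorm_hasDerivWithin_le
        (fun t ht => (hγ t ⟨(le_max_right _ _).trans_lt ht.1, ht.2⟩).hasDerivWithinAt)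
        (fun t ht => ?_)
      rw [← NNReal.coe_le_coe, coe_nnnorm, Real.coe_toNNReal _ (abs_nonneg C)]
      exact hs t ht
    have hcauchy : Cauchy (map γ (𝓝[<] T)) := by
      have h1 : Cauchy (𝓝[<] T) := cauchy_nhds.mono nhdsWithin_le_nhds
      refine h1.map_of_le hlip.uniformContinuousOn ?_
      exact le_principal_iff.mpr (Ioo_mem_nhdsLT (max_lt ht₀ (by linarith)))
    obtain ⟨x, hx⟩ := CompleteSpace.complete hcauchy
    exact hlim x hx

/-! ### The Riccati equation along particle paths and the conserved energy -/

theorem continuousOn_primitive_prod {J : Set ℝ} {f : ℝ → ℝ → ℝ}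
    (hf : ContinuousOn (fun p : ℝ × ℝ => f p.1 p.2) (J ×ˢ univ)) (a : ℝ) :
    ContinuousOn (fun p : ℝ × ℝ => ∫ θ in a..p.2, f p.1 θ) (J ×ˢ univ) := by
  rw [continuousOn_iff_continuous_domRestrict]
  have h : Continuous (Function.uncurry fun (q : ↥(J ×ˢ (univ : Set ℝ))) (θ : ℝ) => f q.1.1 θ) := by
    refine hf.comp_continuous
      (f := fun r : ↥(J ×ˢ (univ : Set ℝ)) × ℝ => ((r.1.1.1, r.2) : ℝ × ℝ)) (by fun_prop) ?_
    exact fun r => ⟨r.1.2.1, mem_univ _⟩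
  exact intervalIntegral.continuous_parametric_intervalIntegral_of_continuous h
    (s := fun q : ↥(J ×ˢ (univ : Set ℝ)) => q.1.2) (by fun_prop)

theorem hasDerivAt_primitive {f : ℝ → ℝ} (hf : Continuous f) (a θ : ℝ) :
    HasDerivAt (fun x => ∫ φ in a..x, f φ) (f θ) θ :=
  intervalIntegral.integral_hasDerivAt_right (hf.intervalIntegrable a θ)
    (hf.stronglyMeasurableAtFilter _ _) hf.continuousAt

theorem ContinuousOn.comp_snd_univ {m : ℝ → ℝ} (hm : Continuous m) (J : Set ℝ) :
    ContinuousOn (fun p : ℝ × ℝ => m p.2) (J ×ˢ univ) := by fun_prop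

/-- Since `|f| ≤ (1 + f²) / 2` and `e^ζ dθ` is a probability measure, a conserved quadratic integral
controls a primitive uniformly. It will be used with `f = u_θ(η)` for the energy and with `f = u(η)
- σ` for the variance. -/
theorem abs_intervalIntegral_mul_exp_le {f ζ : ℝ → ℝ} (hf : Continuous f) (hζ : Continuous ζ)
    (hmean : ∫ θ in (0 : ℝ)..1, Real.exp (ζ θ) = 1) {θ : ℝ} (hθ : θ ∈ Icc (0 : ℝ) 1) :
    |∫ φ in (0 : ℝ)..θ, f φ * Real.exp (ζ φ)| ≤
      (1 + ∫ φ in (0 : ℝ)..1, f φ ^ 2 * Real.exp (ζ φ)) / 2 := by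
  have c1 : Continuous fun φ => |f φ * Real.exp (ζ φ)| := by fun_prop
  have c2 : Continuous fun φ => (Real.exp (ζ φ) + f φ ^ 2 * Real.exp (ζ φ)) / 2 := by fun_prop
  calc |∫ φ in (0 : ℝ)..θ, f φ * Real.exp (ζ φ)|
      ≤ ∫ φ in (0 : ℝ)..θ, |f φ * Real.exp (ζ φ)| :=
        intervalIntegral.abs_integral_le_integral_abs hθ.1
    _ ≤ ∫ φ in (0 : ℝ)..1, |f φ * Real.exp (ζ φ)| :=
        intervalIntegral.integral_mono_interval le_rfl hθ.1 hθ.2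
          (Eventually.of_forall fun φ => abs_nonneg _) (c1.intervalIntegrable _ _)
    _ ≤ ∫ φ in (0 : ℝ)..1, (Real.exp (ζ φ) + f φ ^ 2 * Real.exp (ζ φ)) / 2 := by
        refine intervalIntegral.integral_mono zero_le_one (c1.intervalIntegrable _ _)
          (c2.intervalIntegrable _ _) fun φ => ?_
        have h1 : |f φ| ≤ (1 + f φ ^ 2) / 2 := by
          rw [abs_le]; constructor <;> nlinarith [sq_nonneg (f φ + 1), sq_nonneg (f φ - 1)]
        have h2 := Real.exp_pos (ζ φ)
        simp only [abs_mul, abs_of_pos h2]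
        nlinarith
    _ = _ := by
        rw [intervalIntegral.integral_div, intervalIntegral.integral_add
          (Continuous.intervalIntegrable (by fun_prop) _ _)
          (Continuous.intervalIntegrable (by fun_prop) _ _), hmean]

namespace LagrangianSolution

/-- `∫_0^θ u_θ(η) η_θ`, the velocity along particle paths up to a function of time. -/
noncomputable def relVelocity (ζ V : ℝ → ℝ → ℝ) (t θ : ℝ) : ℝ :=
  ∫ φ in (0 : ℝ)..θ, V t φ * Real.exp (ζ t φ)

/-- The velocity `u(η)` along particle paths, with mean `σ`. -/
noncomputable def velocity (σ : ℝ) (ζ V : ℝ → ℝ → ℝ) (t θ : ℝ) : ℝ :=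
  σ - (∫ φ in (0 : ℝ)..1, relVelocity ζ V t φ * Real.exp (ζ t φ)) + relVelocity ζ V t θ

variable {κ : ℝ} {m : ℝ → ℝ} {J : Set ℝ} {ζ V dV : ℝ → ℝ → ℝ}

section

variable (h : LagrangianSolution κ m J ζ V dV)
include h

theorem continuous_ζ {t : ℝ} (ht : t ∈ J) : Continuous (ζ t) := h.cont_ζ.slice ht

theorem continuous_V {t : ℝ} (ht : t ∈ J) : Continuous (V t) := h.cont_V.slice ht

theorem continuous_dV {t : ℝ} (ht : t ∈ J) : Continuous (dV t) := h.cont_dV.slice ht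

theorem hasDerivAt_exp {t : ℝ} (ht : t ∈ J) (θ : ℝ) :
    HasDerivAt (fun s => Real.exp (ζ s θ)) (V t θ * Real.exp (ζ t θ)) t := by
  rw [mul_comm]
  exact (h.deriv_ζ t ht θ).exp

theorem hasDerivAt_V_space {t : ℝ} (ht : t ∈ J) (θ : ℝ) :
    HasDerivAt (V t) (circleMean m * Real.exp (ζ t θ) - m θ * Real.exp (-κ * ζ t θ)) θ := by
  have hζ := h.continuous_ζ ht
  have hm := h.cont_m
  have hd := (hasDerivAt_primitive
    (f := fun φ => circleMean m * Real.exp (ζ t φ) - m φ * Real.exp (-κ * ζ t φ))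
    (by fun_prop) 0 θ).add_const (V t 0)
  refine hd.congr_of_eventuallyEq (Eventually.of_forall fun φ => ?_)
  simp only [← h.strain_eq t ht]
  ring

theorem V_sub {t : ℝ} (ht : t ∈ J) (x y : ℝ) : V t y - V t x =
    ∫ φ in x..y, (circleMean m * Real.exp (ζ t φ) - m φ * Real.exp (-κ * ζ t φ)) := by
  have hζ := h.continuous_ζ ht
  have hm := h.cont_m
  exact (intervalIntegral.integral_eq_sub_of_hasDerivAt
    (fun θ _ => h.hasDerivAt_V_space ht θ)
    (Continuous.intervalIntegrable (by fun_prop) _ _)).symm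

theorem hasDerivAt_relVelocity_space {t : ℝ} (ht : t ∈ J) (θ : ℝ) :
    HasDerivAt (relVelocity ζ V t) (V t θ * Real.exp (ζ t θ)) θ := by
  have hζ := h.continuous_ζ ht
  have hV := h.continuous_V ht
  exact hasDerivAt_primitive (by fun_prop) 0 θ

theorem hasDerivAt_velocity_space {t : ℝ} (ht : t ∈ J) (θ : ℝ) :
    HasDerivAt (velocity (circleMean m) ζ V t) (V t θ * Real.exp (ζ t θ)) θ :=
  (h.hasDerivAt_relVelocity_space ht θ).const_add _

theorem cont_relVelocity :
    ContinuousOn (fun p : ℝ × ℝ => relVelocity ζ V p.1 p.2) (J ×ˢ univ) :=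
  continuousOn_primitive_prod (f := fun t φ => V t φ * Real.exp (ζ t φ))
    (h.cont_V.mul h.cont_ζ.rexp) 0

theorem cont_velocity :
    ContinuousOn (fun p : ℝ × ℝ => velocity (circleMean m) ζ V p.1 p.2) (J ×ˢ univ) := by
  have h1 := continuousOn_intervalIntegral
    (f := fun t φ => relVelocity ζ V t φ * Real.exp (ζ t φ))
    (h.cont_relVelocity.mul h.cont_ζ.rexp) 0 1
  have h2 : ContinuousOn (fun p : ℝ × ℝ =>
      ∫ φ in (0 : ℝ)..1, relVelocity ζ V p.1 φ * Real.exp (ζ p.1 φ)) (J ×ˢ univ) :=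
    h1.comp continuousOn_fst fun p hp => hp.1
  exact (continuousOn_const.sub h2).add h.cont_relVelocity

theorem continuous_velocity {t : ℝ} (ht : t ∈ J) :
    Continuous (velocity (circleMean m) ζ V t) := h.cont_velocity.slice ht

theorem continuous_relVelocity {t : ℝ} (ht : t ∈ J) :
    Continuous (relVelocity ζ V t) := h.cont_relVelocity.slice ht

theorem periodic_relVelocity {t : ℝ} (ht : t ∈ J) :
    Function.Periodic (relVelocity ζ V t) 1 := by
  intro θ
  have hζ := h.continuous_ζ ht
  have hV := h.continuous_V ht
  have hc : Continuous fun φ => V t φ * Real.exp (ζ t φ) := by fun_prop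
  have hp : Function.Periodic (fun φ => V t φ * Real.exp (ζ t φ)) 1 := fun φ => by
    simp only [h.periodic_ζ t φ, h.periodic_V t φ]
  have h1 := intervalIntegral.integral_add_adjacent_intervals (μ := MeasureTheory.volume)
    (hc.intervalIntegrable 0 θ) (hc.intervalIntegrable θ (θ + 1))
  have h2 := hp.intervalIntegral_add_eq θ 0
  rw [zero_add, h.mean_V t ht] at h2
  simp only [relVelocity, ← h1, h2, add_zero]

theorem periodic_velocity {t : ℝ} (ht : t ∈ J) :
    Function.Periodic (velocity (circleMean m) ζ V t) 1 := fun θ => by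
  simp only [velocity, h.periodic_relVelocity ht θ]

theorem mean_velocity {t : ℝ} (ht : t ∈ J) :
    ∫ θ in (0 : ℝ)..1, velocity (circleMean m) ζ V t θ * Real.exp (ζ t θ) = circleMean m := by
  have hζ := h.continuous_ζ ht
  have hY := h.continuous_relVelocity ht
  simp only [velocity, add_mul]
  rw [intervalIntegral.integral_add (Continuous.intervalIntegrable (by fun_prop) _ _)
    (Continuous.intervalIntegrable (by fun_prop) _ _), intervalIntegral.integral_const_mul,
    h.mean_exp t ht]
  ring

/-- Differentiate `strain_eq` in time. By the formula for `V_θ`, the new integrand is the exact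
`θ`-derivative of `-(κ/2) V² + (κ+1) σ Y`, with `Y` the relative velocity. -/
theorem dV_sub {t : ℝ} (ht : t ∈ J) (θ : ℝ) : dV t θ - dV t 0 =
    -(κ / 2) * (V t θ ^ 2 - V t 0 ^ 2) + (κ + 1) * circleMean m * relVelocity ζ V t θ := by
  have hζ := h.continuous_ζ ht
  have hV := h.continuous_V ht
  have hm := h.cont_m
  have cm := ContinuousOn.comp_snd_univ hm J
  have hd := hasDerivAt_intervalIntegral h.isOpen
    (f := fun t φ => circleMean m * Real.exp (ζ t φ) - m φ * Real.exp (-κ * ζ t φ))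
    (f' := fun t φ => circleMean m * (V t φ * Real.exp (ζ t φ)) -
      m φ * (Real.exp (-κ * ζ t φ) * (-κ * V t φ)))
    ((continuousOn_const.mul h.cont_ζ.rexp).sub (cm.mul (continuousOn_const.mul h.cont_ζ).rexp))
    ((continuousOn_const.mul (h.cont_V.mul h.cont_ζ.rexp)).sub
      (cm.mul ((continuousOn_const.mul h.cont_ζ).rexp.mul (continuousOn_const.mul h.cont_V))))
    (fun s hs φ => ((h.hasDerivAt_exp hs φ).const_mul _).sub
      ((((h.deriv_ζ s hs φ).const_mul (-κ)).exp).const_mul (m φ))) ht 0 θ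
  have hd' := (h.deriv_V t ht θ).sub (h.deriv_V t ht 0)
  have heq : (fun s => ∫ φ in (0 : ℝ)..θ,
      (circleMean m * Real.exp (ζ s φ) - m φ * Real.exp (-κ * ζ s φ))) =ᶠ[𝓝 t]
      (fun s => V s θ) - fun s => V s 0 := by
    filter_upwards [h.isOpen.mem_nhds ht] with s hs
    exact (h.strain_eq s hs θ).symm
  rw [hd'.unique (hd.congr_of_eventuallyEq heq.symm)]
  have hF : ∀ φ, HasDerivAt (fun φ => -(κ / 2) * V t φ ^ 2 +
      (κ + 1) * circleMean m * relVelocity ζ V t φ)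
      (circleMean m * (V t φ * Real.exp (ζ t φ)) -
      m φ * (Real.exp (-κ * ζ t φ) * (-κ * V t φ))) φ := by
    intro φ
    refine ((((h.hasDerivAt_V_space ht φ).pow 2).const_mul (-(κ / 2))).add
      ((h.hasDerivAt_relVelocity_space ht φ).const_mul
        ((κ + 1) * circleMean m))).congr_deriv ?_
    simp only [Nat.cast_ofNat, Nat.add_one_sub_one, pow_one]
    ring
  rw [intervalIntegral.integral_eq_sub_of_hasDerivAt (fun φ _ => hF φ)
    (Continuous.intervalIntegrable (by fun_prop) _ _)]
  have h0 : relVelocity ζ V t 0 = 0 := intervalIntegral.integral_same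
  rw [h0]
  ring

/-- The equation for `u_θ` along particle paths. -/
theorem dV_eq {t : ℝ} (ht : t ∈ J) (θ : ℝ) : dV t θ = -(κ / 2) * V t θ ^ 2 +
    (κ + 1) * circleMean m * velocity (circleMean m) ζ V t θ +
    ((κ / 2 - 1) * (∫ φ in (0 : ℝ)..1, V t φ ^ 2 * Real.exp (ζ t φ)) -
      (κ + 1) * circleMean m ^ 2) := by
  have hζ := h.continuous_ζ ht
  have hV := h.continuous_V ht
  have hdV := h.continuous_dV ht
  have hU := h.continuous_velocity ht
  obtain ⟨c, hc⟩ : ∃ c, ∀ φ, dV t φ = -(κ / 2) * V t φ ^ 2 +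
      (κ + 1) * circleMean m * velocity (circleMean m) ζ V t φ + c := by
    refine ⟨dV t 0 + κ / 2 * V t 0 ^ 2 - (κ + 1) * circleMean m * (circleMean m -
      ∫ φ in (0 : ℝ)..1, relVelocity ζ V t φ * Real.exp (ζ t φ)), fun φ => ?_⟩
    have := h.dV_sub ht φ
    simp only [velocity]
    linear_combination this
  -- The constant `c` left open by `dV_sub` is determined by differentiating the constraint `∫ V e^ζ
  -- = 0` in time.
  have hd := hasDerivAt_intervalIntegral h.isOpen
    (f := fun t φ => V t φ * Real.exp (ζ t φ))
    (f' := fun t φ => dV t φ * Real.exp (ζ t φ) + V t φ * (V t φ * Real.exp (ζ t φ)))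
    (h.cont_V.mul h.cont_ζ.rexp)
    ((h.cont_dV.mul h.cont_ζ.rexp).add (h.cont_V.mul (h.cont_V.mul h.cont_ζ.rexp)))
    (fun s hs φ => (h.deriv_V s hs φ).mul (h.hasDerivAt_exp hs φ)) ht 0 1
  have hz : HasDerivAt (fun s => ∫ φ in (0 : ℝ)..1, V s φ * Real.exp (ζ s φ)) 0 t := by
    refine (hasDerivAt_const t (0 : ℝ)).congr_of_eventuallyEq ?_
    filter_upwards [h.isOpen.mem_nhds ht] with s hs using h.mean_V s hs
  have hI := hd.unique hz
  have hi : ∀ φ, dV t φ * Real.exp (ζ t φ) + V t φ * (V t φ * Real.exp (ζ t φ)) =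
      (1 - κ / 2) * (V t φ ^ 2 * Real.exp (ζ t φ)) +
      (κ + 1) * circleMean m * (velocity (circleMean m) ζ V t φ * Real.exp (ζ t φ)) +
      c * Real.exp (ζ t φ) := by
    intro φ; rw [hc φ]; ring
  simp only [hi] at hI
  rw [intervalIntegral.integral_add (Continuous.intervalIntegrable (by fun_prop) _ _)
    (Continuous.intervalIntegrable (by fun_prop) _ _),
    intervalIntegral.integral_add (Continuous.intervalIntegrable (by fun_prop) _ _)
    (Continuous.intervalIntegrable (by fun_prop) _ _),
    intervalIntegral.integral_const_mul, intervalIntegral.integral_const_mul,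
    intervalIntegral.integral_const_mul, h.mean_exp t ht, h.mean_velocity ht] at hI
  rw [hc θ]
  linear_combination hI

/-- `u(η) - σ` is the relative velocity minus its average against the probability measure `e^ζ dθ`,
and both are at most `C`. -/
theorem velocity_bound_of_relVelocity_bound {t C : ℝ} (ht : t ∈ J)
    (hC : ∀ θ ∈ Icc (0 : ℝ) 1, |relVelocity ζ V t θ| ≤ C) (θ : ℝ) :
    |velocity (circleMean m) ζ V t θ - circleMean m| ≤ 2 * C := by
  have hζ := h.continuous_ζ ht
  have hY := h.continuous_relVelocity ht
  have h1 : |∫ φ in (0 : ℝ)..1, relVelocity ζ V t φ * Real.exp (ζ t φ)| ≤ C := by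
    calc |∫ φ in (0 : ℝ)..1, relVelocity ζ V t φ * Real.exp (ζ t φ)|
        ≤ ∫ φ in (0 : ℝ)..1, |relVelocity ζ V t φ * Real.exp (ζ t φ)| :=
          intervalIntegral.abs_integral_le_integral_abs zero_le_one
      _ ≤ ∫ φ in (0 : ℝ)..1, C * Real.exp (ζ t φ) := by
          refine intervalIntegral.integral_mono_on zero_le_one
            (Continuous.intervalIntegrable (by fun_prop) _ _)
            (Continuous.intervalIntegrable (by fun_prop) _ _) fun φ hφ => ?_
          rw [abs_mul, abs_of_pos (Real.exp_pos _)]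
          exact mul_le_mul_of_nonneg_right (hC φ hφ) (Real.exp_pos _).le
      _ = C := by rw [intervalIntegral.integral_const_mul, h.mean_exp t ht, mul_one]
  obtain ⟨φ, hφ, hφθ⟩ := (h.periodic_relVelocity ht).exists_mem_Ico₀ one_pos θ
  have h2 := hC φ (Ico_subset_Icc_self hφ)
  rw [← hφθ] at h2
  rw [abs_le] at h1 h2 ⊢
  simp only [velocity]
  constructor <;> linarith [h1.1, h1.2, h2.1, h2.2]

end

/-- For `κ = 1` the energy `∫ u_θ²` is conserved. -/
theorem energy_eq (h : LagrangianSolution 1 m J ζ V dV) {t : ℝ} (ht : t ∈ J) :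
    ∫ φ in (0 : ℝ)..1, V t φ ^ 2 * Real.exp (ζ t φ) =
      ∫ φ in (0 : ℝ)..1, V 0 φ ^ 2 * Real.exp (ζ 0 φ) := by
  refine eq_of_hasDerivAt_zero h.isOpen h.preconnected
    (f := fun t => ∫ φ in (0 : ℝ)..1, V t φ ^ 2 * Real.exp (ζ t φ)) (fun s hs => ?_) ht h.zero_mem
  have hζ := h.continuous_ζ hs
  have hV := h.continuous_V hs
  have hdV := h.continuous_dV hs
  have hU := h.continuous_velocity hs
  refine (hasDerivAt_intervalIntegral h.isOpen
    (f := fun t φ => V t φ ^ 2 * Real.exp (ζ t φ))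
    (f' := fun t φ => (2 * V t φ * dV t φ) * Real.exp (ζ t φ) +
      V t φ ^ 2 * (V t φ * Real.exp (ζ t φ)))
    ((h.cont_V.pow 2).mul h.cont_ζ.rexp)
    ((((continuousOn_const.mul h.cont_V).mul h.cont_dV).mul h.cont_ζ.rexp).add
      ((h.cont_V.pow 2).mul (h.cont_V.mul h.cont_ζ.rexp)))
    (fun r hr φ => ?_) hs 0 1).congr_deriv ?_
  · refine (((h.deriv_V r hr φ).pow 2).mul (h.hasDerivAt_exp hr φ)).congr_deriv ?_
    simp
  · set c := ((1 / 2 - 1) * (∫ φ in (0 : ℝ)..1, V s φ ^ 2 * Real.exp (ζ s φ)) -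
      (1 + 1) * circleMean m ^ 2) with hc
    -- The cubic terms cancel exactly because `κ = 1`; what is left is a combination of `U U_θ` and
    -- `U_θ`, with `U = u(η)` periodic.
    have hi : ∀ φ, (2 * V s φ * dV s φ) * Real.exp (ζ s φ) +
        V s φ ^ 2 * (V s φ * Real.exp (ζ s φ)) =
        4 * circleMean m * (velocity (circleMean m) ζ V s φ * (V s φ * Real.exp (ζ s φ))) +
        2 * c * (V s φ * Real.exp (ζ s φ)) := by
      intro φ; rw [h.dV_eq hs φ]; ring
    have hUU : ∫ φ in (0 : ℝ)..1,
        velocity (circleMean m) ζ V s φ * (V s φ * Real.exp (ζ s φ)) = 0 := by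
      rw [intervalIntegral.integral_eq_sub_of_hasDerivAt
        (f := fun φ => velocity (circleMean m) ζ V s φ ^ 2 / 2) (fun φ _ => ?_)
        (Continuous.intervalIntegrable (by fun_prop) _ _)]
      · have := h.periodic_velocity hs 0
        rw [zero_add] at this
        rw [this]; ring
      · refine (((h.hasDerivAt_velocity_space hs φ).pow 2).div_const 2).congr_deriv ?_
        simp only [Nat.cast_ofNat, Nat.add_one_sub_one, pow_one]
        ring
    simp only [hi]
    rw [intervalIntegral.integral_add (Continuous.intervalIntegrable (by fun_prop) _ _)
      (Continuous.intervalIntegrable (by fun_prop) _ _), intervalIntegral.integral_const_mul,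
      intervalIntegral.integral_const_mul, hUU, h.mean_V s hs]
    ring

end LagrangianSolution

/-! ### The conserved variance and the bound on the forcing -/

namespace LagrangianSolution

variable {κ : ℝ} {m : ℝ → ℝ} {J : Set ℝ} {ζ V dV : ℝ → ℝ → ℝ}

/-- `∫_0^θ (u - σ)` along particle paths. -/
noncomputable def velocityPrim (σ : ℝ) (ζ V : ℝ → ℝ → ℝ) (t θ : ℝ) : ℝ :=
  ∫ φ in (0 : ℝ)..θ, (velocity σ ζ V t φ - σ) * Real.exp (ζ t φ)

/-- For `κ = 2` both the coefficient `1 - κ/2` of `V²` in `V_t + V²` and that of the nonlocal term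
vanish, leaving only `3σ(u(η) - σ)`. -/
theorem hasDerivAt_relVelocity_time (h : LagrangianSolution 2 m J ζ V dV) {t : ℝ} (ht : t ∈ J)
    (θ : ℝ) : HasDerivAt (fun s => relVelocity ζ V s θ)
      (3 * circleMean m * velocityPrim (circleMean m) ζ V t θ) t := by
  refine (hasDerivAt_intervalIntegral h.isOpen
    (f := fun t φ => V t φ * Real.exp (ζ t φ))
    (f' := fun t φ => dV t φ * Real.exp (ζ t φ) + V t φ * (V t φ * Real.exp (ζ t φ)))
    (h.cont_V.mul h.cont_ζ.rexp)
    ((h.cont_dV.mul h.cont_ζ.rexp).add (h.cont_V.mul (h.cont_V.mul h.cont_ζ.rexp)))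
    (fun s hs φ => (h.deriv_V s hs φ).mul (h.hasDerivAt_exp hs φ)) ht 0 θ).congr_deriv ?_
  rw [velocityPrim, ← intervalIntegral.integral_const_mul]
  congr 1
  ext φ
  rw [h.dV_eq ht φ]
  ring

section

variable (h : LagrangianSolution κ m J ζ V dV)
include h

theorem cont_velocityPrim :
    ContinuousOn (fun p : ℝ × ℝ => velocityPrim (circleMean m) ζ V p.1 p.2) (J ×ˢ univ) :=
  continuousOn_primitive_prod
    (f := fun t φ => (velocity (circleMean m) ζ V t φ - circleMean m) * Real.exp (ζ t φ))
    ((h.cont_velocity.sub continuousOn_const).mul h.cont_ζ.rexp) 0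

theorem hasDerivAt_velocityPrim_space {t : ℝ} (ht : t ∈ J) (θ : ℝ) :
    HasDerivAt (velocityPrim (circleMean m) ζ V t)
      ((velocity (circleMean m) ζ V t θ - circleMean m) * Real.exp (ζ t θ)) θ := by
  have hζ := h.continuous_ζ ht
  have hU := h.continuous_velocity ht
  exact hasDerivAt_primitive (by fun_prop) 0 θ

theorem mean_velocity_sub {t : ℝ} (ht : t ∈ J) :
    ∫ φ in (0 : ℝ)..1, (velocity (circleMean m) ζ V t φ - circleMean m) * Real.exp (ζ t φ) = 0 := by
  have hζ := h.continuous_ζ ht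
  have hU := h.continuous_velocity ht
  simp only [sub_mul]
  rw [intervalIntegral.integral_sub (Continuous.intervalIntegrable (by fun_prop) _ _)
    (Continuous.intervalIntegrable (by fun_prop) _ _), intervalIntegral.integral_const_mul,
    h.mean_exp t ht, h.mean_velocity ht]
  ring

end

/-- For `κ = 2` the variance `∫ (u - σ)²` is conserved. -/
theorem variance_eq (h : LagrangianSolution 2 m J ζ V dV) {t : ℝ} (ht : t ∈ J) :
    ∫ φ in (0 : ℝ)..1, (velocity (circleMean m) ζ V t φ - circleMean m) ^ 2 * Real.exp (ζ t φ) =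
      ∫ φ in (0 : ℝ)..1,
        (velocity (circleMean m) ζ V 0 φ - circleMean m) ^ 2 * Real.exp (ζ 0 φ) := by
  set σ := circleMean m with hσ
  refine eq_of_hasDerivAt_zero h.isOpen h.preconnected
    (f := fun t => ∫ φ in (0 : ℝ)..1, (velocity σ ζ V t φ - σ) ^ 2 * Real.exp (ζ t φ))
    (fun s hs => ?_) ht h.zero_mem
  set G := velocityPrim σ ζ V with hG
  have cG : ContinuousOn (fun p : ℝ × ℝ => G p.1 p.2) (J ×ˢ univ) := h.cont_velocityPrim
  have cY := h.cont_relVelocity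
  have cU := h.cont_velocity
  set P : ℝ → ℝ := fun t => ∫ φ in (0 : ℝ)..1,
    (3 * σ * G t φ * Real.exp (ζ t φ) + relVelocity ζ V t φ * (V t φ * Real.exp (ζ t φ))) with hP
  have cPint : ContinuousOn (fun p : ℝ × ℝ => 3 * σ * G p.1 p.2 * Real.exp (ζ p.1 p.2) +
      relVelocity ζ V p.1 p.2 * (V p.1 p.2 * Real.exp (ζ p.1 p.2))) (J ×ˢ univ) :=
    ((continuousOn_const.mul cG).mul h.cont_ζ.rexp).add (cY.mul (h.cont_V.mul h.cont_ζ.rexp))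
  have cP : ContinuousOn (fun p : ℝ × ℝ => P p.1) (J ×ˢ univ) :=
    (continuousOn_intervalIntegral (f := fun t φ => 3 * σ * G t φ * Real.exp (ζ t φ) +
      relVelocity ζ V t φ * (V t φ * Real.exp (ζ t φ))) cPint 0 1).comp continuousOn_fst
      fun p hp => hp.1
  have hdU : ∀ r ∈ J, ∀ φ, HasDerivAt (fun r => velocity σ ζ V r φ)
      (3 * σ * G r φ - P r) r := by
    intro r hr φ
    have h1 := hasDerivAt_intervalIntegral h.isOpen
      (f := fun t φ => relVelocity ζ V t φ * Real.exp (ζ t φ))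
      (f' := fun t φ => 3 * σ * G t φ * Real.exp (ζ t φ) +
        relVelocity ζ V t φ * (V t φ * Real.exp (ζ t φ)))
      (cY.mul h.cont_ζ.rexp) cPint
      (fun s hs φ => (h.hasDerivAt_relVelocity_time hs φ).mul (h.hasDerivAt_exp hs φ)) hr 0 1
    refine ((h1.const_sub σ).add (h.hasDerivAt_relVelocity_time hr φ)).congr_deriv ?_
    ring
  have hζ := h.continuous_ζ hs
  have hV := h.continuous_V hs
  have hU := h.continuous_velocity hs
  have hGs : Continuous (G s) := cG.slice hs
  refine (hasDerivAt_intervalIntegral h.isOpen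
    (f := fun t φ => (velocity σ ζ V t φ - σ) ^ 2 * Real.exp (ζ t φ))
    (f' := fun t φ => (2 * (velocity σ ζ V t φ - σ) * (3 * σ * G t φ - P t)) * Real.exp (ζ t φ) +
      (velocity σ ζ V t φ - σ) ^ 2 * (V t φ * Real.exp (ζ t φ)))
    (((cU.sub continuousOn_const).pow 2).mul h.cont_ζ.rexp)
    ((((continuousOn_const.mul (cU.sub continuousOn_const)).mul
      ((continuousOn_const.mul cG).sub cP)).mul h.cont_ζ.rexp).add
      (((cU.sub continuousOn_const).pow 2).mul (h.cont_V.mul h.cont_ζ.rexp)))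
    (fun r hr φ => ?_) hs 0 1).congr_deriv ?_
  · refine ((((hdU r hr φ).sub_const σ).pow 2).mul (h.hasDerivAt_exp hr φ)).congr_deriv ?_
    simp
  -- An explicit antiderivative of the integrand. It takes equal values at `0` and `1`: `G` vanishes
  -- at both since `u - σ` has mean zero, and the velocity is periodic.
  · have hF : ∀ φ, HasDerivAt (fun φ => 3 * σ * G s φ ^ 2 - 2 * P s * G s φ +
        (velocity σ ζ V s φ - σ) ^ 3 / 3)
        ((2 * (velocity σ ζ V s φ - σ) * (3 * σ * G s φ - P s)) * Real.exp (ζ s φ) +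
        (velocity σ ζ V s φ - σ) ^ 2 * (V s φ * Real.exp (ζ s φ))) φ := by
      intro φ
      have hg := h.hasDerivAt_velocityPrim_space hs φ
      refine ((((hg.pow 2).const_mul (3 * σ)).sub (hg.const_mul (2 * P s))).add
        ((((h.hasDerivAt_velocity_space hs φ).sub_const σ).pow 3).div_const 3)).congr_deriv ?_
      simp only [Nat.cast_ofNat, Nat.add_one_sub_one, pow_one, ← hσ, ← hG]
      ring
    rw [intervalIntegral.integral_eq_sub_of_hasDerivAt (fun φ _ => hF φ)
      (Continuous.intervalIntegrable (by fun_prop) _ _)]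
    have h0 : G s 0 = 0 := intervalIntegral.integral_same
    have h1 : G s 1 = 0 := h.mean_velocity_sub hs
    have h2 := h.periodic_velocity hs 0
    rw [zero_add] at h2
    rw [h0, h1, h2]
    ring

/-- The forcing of the Riccati equation along particle paths grows at most linearly. -/
theorem exists_forcing_bound (hκ : κ = 1 ∨ κ = 2) (h : LagrangianSolution κ m J ζ V dV) :
    ∃ A B : ℝ, 0 ≤ A ∧ 0 ≤ B ∧ ∀ t ∈ J, 0 ≤ t → ∀ θ,
      |dV t θ + κ / 2 * V t θ ^ 2| ≤ A + B * t := by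
  rcases hκ with rfl | rfl
  -- `κ = 1`: the conserved energy bounds the velocity and the nonlocal term uniformly in time, so
  -- `B = 0`.
  · set E := ∫ φ in (0 : ℝ)..1, V 0 φ ^ 2 * Real.exp (ζ 0 φ) with hE
    set c := (1 / 2 - 1) * E - (1 + 1) * circleMean m ^ 2 with hc
    refine ⟨|2 * circleMean m| * (|2 * ((1 + E) / 2)| + |circleMean m|) + |c|, 0, by positivity,
      le_rfl, fun t ht _ θ => ?_⟩
    have hU := h.velocity_bound_of_relVelocity_bound ht (C := (1 + E) / 2) (fun φ hφ => by
      rw [hE, ← h.energy_eq ht]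
      exact abs_intervalIntegral_mul_exp_le (h.continuous_V ht) (h.continuous_ζ ht)
        (h.mean_exp t ht) hφ) θ
    have h1 : dV t θ + 1 / 2 * V t θ ^ 2 =
        2 * circleMean m * velocity (circleMean m) ζ V t θ + c := by
      rw [h.dV_eq ht θ, h.energy_eq ht]; ring
    have h2 : |velocity (circleMean m) ζ V t θ| ≤ |2 * ((1 + E) / 2)| + |circleMean m| := by
      calc |velocity (circleMean m) ζ V t θ|
          = |(velocity (circleMean m) ζ V t θ - circleMean m) + circleMean m| := by ring_nf
        _ ≤ |velocity (circleMean m) ζ V t θ - circleMean m| + |circleMean m| := abs_add_le _ _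
        _ ≤ _ := add_le_add (hU.trans (le_abs_self _)) le_rfl
    rw [h1, zero_mul, add_zero]
    refine (abs_add_le _ _).trans ?_
    rw [abs_mul]
    gcongr
  -- `κ = 2`: the conserved variance bounds only the primitive of `u - σ`. Up to the factor `3σ`
  -- this is the time derivative of the relative velocity, which therefore grows at most linearly.
  · set σ := circleMean m with hσ
    set E := ∫ φ in (0 : ℝ)..1, (velocity σ ζ V 0 φ - σ) ^ 2 * Real.exp (ζ 0 φ) with hE
    have hE0 : 0 ≤ E := intervalIntegral.integral_nonneg zero_le_one fun φ _ => by positivity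
    have hG : ∀ t ∈ J, ∀ φ ∈ Icc (0 : ℝ) 1, |velocityPrim σ ζ V t φ| ≤ (1 + E) / 2 := by
      intro t ht φ hφ
      rw [hE, ← h.variance_eq ht]
      exact abs_intervalIntegral_mul_exp_le ((h.continuous_velocity ht).sub continuous_const)
        (h.continuous_ζ ht) (h.mean_exp t ht) hφ
    obtain ⟨C, hC⟩ := exists_bound_of_continuousOn (K := {0}) isCompact_singleton
      h.cont_relVelocity (by simpa using h.zero_mem) 0 1
    have hC0 : 0 ≤ C := (abs_nonneg _).trans (hC 0 rfl 0 ⟨le_rfl, zero_le_one⟩)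
    set B := |3 * σ| * ((1 + E) / 2) with hB
    have hY : ∀ t ∈ J, 0 ≤ t → ∀ φ ∈ Icc (0 : ℝ) 1, |relVelocity ζ V t φ| ≤ C + B * t := by
      intro t ht ht0 φ hφ
      have hsub : Icc 0 t ⊆ J := h.preconnected.ordConnected.out h.zero_mem ht
      have h1 := (convex_Icc (0 : ℝ) t).norm_image_sub_le_of_norm_hasDerivWithin_le
        (f := fun s => relVelocity ζ V s φ) (C := B)
        (fun s hs => (h.hasDerivAt_relVelocity_time (hsub hs) φ).hasDerivWithinAt)
        (fun s hs => by
          rw [Real.norm_eq_abs, abs_mul]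
          exact mul_le_mul_of_nonneg_left (hG s (hsub hs) φ hφ) (abs_nonneg _))
        ⟨le_rfl, ht0⟩ ⟨ht0, le_rfl⟩
      rw [Real.norm_eq_abs, Real.norm_eq_abs, sub_zero, abs_of_nonneg ht0] at h1
      have h2 := hC 0 rfl φ hφ
      calc |relVelocity ζ V t φ|
          = |(relVelocity ζ V t φ - relVelocity ζ V 0 φ) + relVelocity ζ V 0 φ| := by ring_nf
        _ ≤ |relVelocity ζ V t φ - relVelocity ζ V 0 φ| + |relVelocity ζ V 0 φ| := abs_add_le _ _
        _ ≤ C + B * t := by linarith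
    refine ⟨|3 * σ| * (2 * C), |3 * σ| * (2 * B), by positivity, by positivity,
      fun t ht ht0 θ => ?_⟩
    have hU := h.velocity_bound_of_relVelocity_bound ht (hY t ht ht0) θ
    have h1 : dV t θ + 2 / 2 * V t θ ^ 2 = 3 * σ * (velocity σ ζ V t θ - σ) := by
      rw [h.dV_eq ht θ]; ring
    rw [h1, abs_mul]
    calc |3 * σ| * |velocity σ ζ V t θ - σ| ≤ |3 * σ| * (2 * (C + B * t)) := by gcongr
      _ = _ := by ring

/-- `[x, y]` lies within `n` periods, each of mass one; the point is that `n` does not depend on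
`t`. -/
theorem exists_mean_exp_bound (h : LagrangianSolution κ m J ζ V dV) (x y : ℝ) :
    ∃ n : ℕ, 0 < n ∧ ∀ t ∈ J, ∫ φ in x..y, Real.exp (ζ t φ) ≤ n := by
  obtain ⟨n, hn⟩ := exists_nat_ge (max (y - x) 1)
  have hn1 : (1 : ℝ) ≤ n := (le_max_right _ _).trans hn
  refine ⟨n, by exact_mod_cast one_pos.trans_le hn1, fun t ht => ?_⟩
  have hζ := h.continuous_ζ ht
  have hc : Continuous fun φ => Real.exp (ζ t φ) := by fun_prop
  have hp : Function.Periodic (fun φ => Real.exp (ζ t φ)) 1 := fun φ => by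
    simp only [h.periodic_ζ t φ]
  have h1 := intervalIntegral.integral_add_adjacent_intervals (μ := MeasureTheory.volume)
    (hc.intervalIntegrable x y) (hc.intervalIntegrable y (x + n))
  have h2 : 0 ≤ ∫ φ in y..(x + n), Real.exp (ζ t φ) :=
    intervalIntegral.integral_nonneg (by linarith [(le_max_left _ _).trans hn])
      fun φ _ => (Real.exp_pos _).le
  have h3 := hp.intervalIntegral_add_zsmul_eq (n : ℤ) x
    (fun a b => hc.intervalIntegrable a b)
  rw [hp.intervalIntegral_add_eq x 0, zero_add, h.mean_exp t ht] at h3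
  simp only [natCast_zsmul, nsmul_eq_mul, mul_one] at h3
  linarith

end LagrangianSolution

/-! ### A momentum of both signs excludes global solutions -/

/-- `V` cannot stay above an affine function of time while `log ρ = ζ`, `ζ_t = V`, and `V` increases
in `θ` on `[a, b]` at the rate `δ ρ^{-κ}` at least, with `∫ ρ` bounded. -/
theorem false_of_increasing_strain {κ δ R C a b : ℝ} (hκ : 0 < κ) (hδ : 0 < δ) (hab : a < b)
    (hC : 0 < C) {ζ V : ℝ → ℝ → ℝ}
    (hζ0 : ∀ θ, ζ 0 θ = 0) (hζ : ∀ t, 0 ≤ t → ∀ θ, HasDerivAt (fun s => ζ s θ) (V t θ) t)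
    (hmono : ∀ t, 0 ≤ t → ∀ x y, a ≤ x → x ≤ y → y ≤ b → V t x ≤ V t y)
    (hinc : ∀ t, 0 ≤ t → ∀ x y L, a ≤ x → x ≤ y → y ≤ b → (∀ z ∈ Icc x y, ζ t z ≤ L) →
      δ * (y - x) * Real.exp (-κ * L) ≤ V t y - V t x)
    (hmass : ∀ t, 0 ≤ t → ∀ x y L, a ≤ x → x ≤ y → y ≤ b → (∀ z ∈ Icc x y, L ≤ ζ t z) →
      Real.exp L * (y - x) ≤ C)
    (hlow : ∀ t, 0 ≤ t → ∀ θ, -R * (1 + t) ≤ V t θ) : False := by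
  have hlin : ∀ f f' : ℝ → ℝ, ∀ c t₀ : ℝ, (∀ t, t₀ ≤ t → HasDerivAt f (f' t) t) →
      (∀ t, t₀ ≤ t → c ≤ f' t) → ∀ t, t₀ ≤ t → f t₀ + c * (t - t₀) ≤ f t := by
    intro f f' c t₀ hf hf' t ht
    have := image_le_of_deriv_right_le_deriv_boundary (a := t₀) (b := t)
      (f := fun s => f t₀ + c * (s - t₀)) (f' := fun _ => c) (B := f) (B' := f')
      (by fun_prop) (fun s _ => by
        simpa using ((((hasDerivAt_id s).sub_const t₀).const_mul c).const_add
          (f t₀)).hasDerivWithinAt)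
      (by simp) (fun s hs => (hf s hs.1).continuousAt.continuousWithinAt)
      (fun s hs => (hf s hs.1).hasDerivWithinAt) (fun s hs => hf' s hs.1)
    exact this ⟨ht, le_rfl⟩
  have hζmono : ∀ t, 0 ≤ t → ∀ x y, a ≤ x → x ≤ y → y ≤ b → ζ t x ≤ ζ t y := by
    intro t ht x y hx hxy hy
    have := hlin (fun s => ζ s y - ζ s x) (fun s => V s y - V s x) 0 0
      (fun s hs => (hζ s hs y).sub (hζ s hs x))
      (fun s hs => sub_nonneg.mpr (hmono s hs x y hx hxy hy)) t ht
    simp only [hζ0] at this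
    linarith
  -- The last quarter of `[a, b]` gives the bound `L` through its mass, the third makes `ζ` decay
  -- linearly to its left, and the second then makes `V` grow exponentially at the midpoint `a +
  -- 2d`.
  set d := (b - a) / 4 with hd
  have hdpos : 0 < d := by rw [hd]; linarith
  set L := Real.log (C / d) with hL
  have hζL : ∀ t, 0 ≤ t → ∀ x, a ≤ x → x ≤ a + 3 * d → ζ t x ≤ L := by
    intro t ht x hx hx3
    have h1 := hmass t ht x b (ζ t x) hx (by rw [hd] at hx3; linarith) le_rfl
      (fun z hz => hζmono t ht x z hx hz.1 hz.2)
    have h2 : d ≤ b - x := by rw [hd] at hx3 ⊢; linarith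
    rw [hL, Real.le_log_iff_exp_le (by positivity), le_div_iff₀ hdpos]
    exact (mul_le_mul_of_nonneg_left h2 (Real.exp_pos _).le).trans h1
  set c := δ * d * Real.exp (-κ * L) with hc
  have hcpos : 0 < c := by positivity
  -- Across the third quarter `V` gains at least `c`, so the gap in `ζ` widens at rate `c` while the
  -- right end stays below `L`.
  have hdecay : ∀ t, 0 ≤ t → ∀ x, a ≤ x → x ≤ a + 2 * d → ζ t x ≤ L - c * t := by
    intro t ht x hx hx2
    have h1 := hlin (fun s => ζ s (a + 3 * d) - ζ s (a + 2 * d))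
      (fun s => V s (a + 3 * d) - V s (a + 2 * d)) c 0
      (fun s hs => (hζ s hs _).sub (hζ s hs _))
      (fun s hs => by
        have := hinc s hs (a + 2 * d) (a + 3 * d) L (by linarith) (by linarith)
          (by rw [hd]; linarith) (fun z hz => hζL s hs z (by linarith [hz.1]) hz.2)
        rw [hc]
        have e : a + 3 * d - (a + 2 * d) = d := by ring
        rwa [e] at this) t ht
    simp only [hζ0] at h1
    have h2 := hζL t ht (a + 3 * d) (by linarith) le_rfl
    have h3 := hζmono t ht x (a + 2 * d) hx hx2 (by rw [hd]; linarith)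
    linarith
  -- Across the second quarter `ζ ≤ L - ct`, so the gain of `V` is at least `c e^{κct}`; this beats
  -- the affine lower bound at `a + d`.
  have hgrow : ∀ t, 0 ≤ t → c * Real.exp (κ * c * t) - R * (1 + t) ≤ V t (a + 2 * d) := by
    intro t ht
    have h1 := hinc t ht (a + d) (a + 2 * d) (L - c * t) (by linarith) (by linarith)
      (by rw [hd]; linarith) (fun z hz => hdecay t ht z (by linarith [hz.1]) hz.2)
    have h2 := hlow t ht (a + d)
    have e : δ * (a + 2 * d - (a + d)) * Real.exp (-κ * (L - c * t)) =
        c * Real.exp (κ * c * t) := by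
      have h3 : -κ * (L - c * t) = -κ * L + κ * c * t := by ring
      have h4 : a + 2 * d - (a + d) = d := by ring
      rw [h3, h4, Real.exp_add, ← mul_assoc]
    rw [e] at h1
    linarith
  obtain ⟨t₁, ht₁, hbig⟩ : ∃ t₁, 0 ≤ t₁ ∧ ∀ t, t₁ ≤ t → 1 ≤ V t (a + 2 * d) := by
    have hkc : 0 < κ * c := by positivity
    have h1 := (Real.tendsto_mul_exp_add_div_pow_atTop c 0 1 hcpos).comp
      (tendsto_id.const_mul_atTop hkc)
    have h2 := h1.eventually_ge_atTop ((1 + |R| * 2) / (κ * c))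
    obtain ⟨t₁, ht₁⟩ := (h2.and (eventually_ge_atTop (1 : ℝ))).exists_forall_of_atTop
    refine ⟨max t₁ 0, le_max_right _ _, fun t ht => ?_⟩
    obtain ⟨h3, h4⟩ := ht₁ t ((le_max_left _ _).trans ht)
    have h5 := hgrow t (by linarith)
    simp only [Function.comp, id, add_zero, pow_one] at h3
    rw [div_le_div_iff₀ hkc (by positivity)] at h3
    have h6 : (1 + |R| * 2) * t ≤ c * Real.exp (κ * c * t) := by
      have : (1 + |R| * 2) * t * (κ * c) ≤ c * Real.exp (κ * c * t) * (κ * c) := by linarith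
      exact le_of_mul_le_mul_right this hkc
    have h7 : R * (1 + t) ≤ |R| * (2 * t) :=
      mul_le_mul (le_abs_self R) (by linarith) (by linarith) (abs_nonneg R)
    nlinarith
  -- From `t₁` on, `ζ` grows at unit rate at the midpoint; the chosen time is one unit more than is
  -- needed to exceed `L`.
  have h1 := hlin (fun s => ζ s (a + 2 * d)) (fun s => V s (a + 2 * d)) 1 t₁
    (fun s hs => hζ s (ht₁.trans hs) _) hbig
    (t₁ + (|L - ζ t₁ (a + 2 * d)| + 1)) (by linarith [abs_nonneg (L - ζ t₁ (a + 2 * d))])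
  have h2 := hζL (t₁ + (|L - ζ t₁ (a + 2 * d)| + 1))
    (by linarith [abs_nonneg (L - ζ t₁ (a + 2 * d))]) (a + 2 * d) (by linarith) (by linarith)
  have h3 := le_abs_self (L - ζ t₁ (a + 2 * d))
  linarith

theorem exists_interval_of_pos {f : ℝ → ℝ} (hf : Continuous f) {x : ℝ} (hx : 0 < f x) :
    ∃ a b δ : ℝ, a < b ∧ 0 < δ ∧ ∀ y ∈ Icc a b, δ ≤ f y := by
  have h1 : ∀ᶠ y in 𝓝 x, f x / 2 < f y := hf.continuousAt.eventually (lt_mem_nhds (by linarith))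
  obtain ⟨ε, hε, hball⟩ := Metric.nhds_basis_closedBall.mem_iff.1 h1
  rw [Real.closedBall_eq_Icc] at hball
  exact ⟨x - ε, x + ε, f x / 2, by linarith, by linarith, fun y hy => (hball hy).le⟩

namespace LagrangianSolution

variable {κ : ℝ} {m : ℝ → ℝ} {J : Set ℝ} {ζ V dV : ℝ → ℝ → ℝ}

theorem mul_exp_le_integral (h : LagrangianSolution κ m J ζ V dV) {t : ℝ} (ht : t ∈ J)
    {x y δ L k : ℝ} (hδ : 0 ≤ δ) (hxy : x ≤ y) (hL : ∀ z ∈ Icc x y, L ≤ k * ζ t z) :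
    δ * (y - x) * Real.exp L ≤ ∫ φ in x..y, δ * Real.exp (k * ζ t φ) := by
  have hζ := h.continuous_ζ ht
  calc δ * (y - x) * Real.exp L = ∫ φ in x..y, δ * Real.exp L := by
        rw [intervalIntegral.integral_const, smul_eq_mul]; ring
    _ ≤ ∫ φ in x..y, δ * Real.exp (k * ζ t φ) := by
        refine intervalIntegral.integral_mono_on hxy (by simp)
          (Continuous.intervalIntegrable (by fun_prop) _ _) fun φ hφ => ?_
        exact mul_le_mul_of_nonneg_left (Real.exp_le_exp.mpr (hL φ hφ)) hδ

/-- If the momentum changes sign, there is no global solution. -/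
theorem not_changesSign_of_global (hκ : κ = 1 ∨ κ = 2) {ε : ℝ} (hε : 0 < ε)
    (h : LagrangianSolution κ m (Ioi (-ε)) ζ V dV) : ¬ ChangesSign m := by
  rintro ⟨⟨x₁, hx₁⟩, ⟨x₂, hx₂⟩⟩
  have hκ0 : 0 < κ := by rcases hκ with rfl | rfl <;> norm_num
  have hJ : ∀ t, 0 ≤ t → t ∈ Ioi (-ε) := fun t ht => mem_Ioi.mpr (by linarith)
  obtain ⟨A, B, hA, hB, hAB⟩ := h.exists_forcing_bound hκ
  obtain ⟨R, hR⟩ := exists_lower_bound_of_riccati (β := κ / 2) (by positivity) hA hB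
  have hlow : ∀ t, 0 ≤ t → ∀ θ, -R * (1 + t) ≤ V t θ := fun t ht θ =>
    hR (fun s => V s θ) (fun s => dV s θ) (fun s hs => h.deriv_V s (hJ s hs) θ)
      (fun s hs => by
        have := (abs_le.mp (hAB s (hJ s hs) hs θ)).2
        linarith) t ht
  -- The sign of `σ` selects the interval: where `m < 0` and `σ ≥ 0`, both terms of `V_θ` are
  -- nonnegative.
  rcases le_total 0 (circleMean m) with hσ | hσ
  · obtain ⟨a, b, δ, hab, hδ, hm⟩ := exists_interval_of_pos (f := fun x => -m x)
      h.cont_m.neg (by linarith : 0 < -m x₁)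
    obtain ⟨n, hn, hmass⟩ := h.exists_mean_exp_bound a b
    have hV : ∀ t, 0 ≤ t → ∀ x y, a ≤ x → x ≤ y → y ≤ b →
        ∫ φ in x..y, δ * Real.exp (-κ * ζ t φ) ≤ V t y - V t x := by
      intro t ht x y hx hxy hy
      have hζ := h.continuous_ζ (hJ t ht)
      have hmc := h.cont_m
      rw [h.V_sub (hJ t ht)]
      refine intervalIntegral.integral_mono_on hxy
        (Continuous.intervalIntegrable (by fun_prop) _ _)
        (Continuous.intervalIntegrable (by fun_prop) _ _) fun φ hφ => ?_
      have h1 := mul_le_mul_of_nonneg_right (hm φ ⟨hx.trans hφ.1, hφ.2.trans hy⟩)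
        (Real.exp_pos (-κ * ζ t φ)).le
      have h2 := mul_nonneg hσ (Real.exp_pos (ζ t φ)).le
      linarith
    refine false_of_increasing_strain (a := a) (b := b) (R := R) (C := n) hκ0 hδ hab
      (by exact_mod_cast hn) h.ζ_zero
      (fun t ht => h.deriv_ζ t (hJ t ht)) (fun t ht x y hx hxy hy => ?_)
      (fun t ht x y L hx hxy hy hL => ?_) (fun t ht x y L hx hxy hy hL => ?_) hlow
    · have h1 : 0 ≤ ∫ φ in x..y, δ * Real.exp (-κ * ζ t φ) :=
        intervalIntegral.integral_nonneg hxy fun φ _ => by positivity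
      linarith [hV t ht x y hx hxy hy]
    · exact (h.mul_exp_le_integral (hJ t ht) hδ.le hxy fun z hz => by nlinarith [hL z hz]).trans
        (hV t ht x y hx hxy hy)
    · have h1 := h.mul_exp_le_integral (hJ t ht) (k := 1) zero_le_one hxy
        (fun z hz => by simpa using hL z hz)
      simp only [one_mul] at h1
      have hζ := h.continuous_ζ (hJ t ht)
      have h2 : ∫ φ in x..y, Real.exp (ζ t φ) ≤ ∫ φ in a..b, Real.exp (ζ t φ) :=
        intervalIntegral.integral_mono_interval hx hxy hy
          (Eventually.of_forall fun φ => (Real.exp_pos _).le)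
          (Continuous.intervalIntegrable (by fun_prop) _ _)
      linarith [hmass t (hJ t ht)]
  -- For `σ ≤ 0` an interval with `m ≥ δ` serves; there `V` decreases in `θ`, and the reflection `θ
  -- ↦ -θ` reduces to the previous situation. The end points are named so that the reflected
  -- interval is `[-a, -b]`.
  · obtain ⟨b, a, δ, hab, hδ, hm⟩ := exists_interval_of_pos h.cont_m hx₂
    obtain ⟨n, hn, hmass⟩ := h.exists_mean_exp_bound b a
    have hV : ∀ t, 0 ≤ t → ∀ x y, b ≤ x → x ≤ y → y ≤ a →
        ∫ φ in x..y, δ * Real.exp (-κ * ζ t φ) ≤ V t x - V t y := by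
      intro t ht x y hx hxy hy
      have hζ := h.continuous_ζ (hJ t ht)
      have hmc := h.cont_m
      rw [← neg_sub, h.V_sub (hJ t ht), ← intervalIntegral.integral_neg]
      refine intervalIntegral.integral_mono_on hxy
        (Continuous.intervalIntegrable (by fun_prop) _ _)
        (Continuous.intervalIntegrable (by fun_prop) _ _) fun φ hφ => ?_
      have h1 := mul_le_mul_of_nonneg_right (hm φ ⟨hx.trans hφ.1, hφ.2.trans hy⟩)
        (Real.exp_pos (-κ * ζ t φ)).le
      have h2 := mul_nonneg (neg_nonneg.mpr hσ) (Real.exp_pos (ζ t φ)).le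
      linarith
    refine false_of_increasing_strain (a := -a) (b := -b) (R := R) (C := n)
      (ζ := fun t θ => ζ t (-θ)) (V := fun t θ => V t (-θ)) hκ0 hδ (by linarith)
      (by exact_mod_cast hn) (fun θ => h.ζ_zero _)
      (fun t ht θ => h.deriv_ζ t (hJ t ht) _) (fun t ht x y hx hxy hy => ?_)
      (fun t ht x y L hx hxy hy hL => ?_) (fun t ht x y L hx hxy hy hL => ?_)
      fun t ht θ => hlow t ht _
    · have h1 : 0 ≤ ∫ φ in (-y)..(-x), δ * Real.exp (-κ * ζ t φ) :=
        intervalIntegral.integral_nonneg (by linarith) fun φ _ => by positivity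
      linarith [hV t ht (-y) (-x) (by linarith) (by linarith) (by linarith)]
    · have h1 := h.mul_exp_le_integral (hJ t ht) (x := -y) (y := -x) (L := -κ * L) (k := -κ) hδ.le
        (by linarith) fun z hz => by
          have := hL (-z) ⟨by linarith [hz.2], by linarith [hz.1]⟩
          rw [neg_neg] at this
          nlinarith
      have e : -x - -y = y - x := by ring
      rw [e] at h1
      exact h1.trans (hV t ht (-y) (-x) (by linarith) (by linarith) (by linarith))
    · have h1 := h.mul_exp_le_integral (hJ t ht) (x := -y) (y := -x) (L := L) (k := 1) zero_le_one
        (by linarith) fun z hz => by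
          have := hL (-z) ⟨by linarith [hz.2], by linarith [hz.1]⟩
          rw [neg_neg] at this
          linarith
      simp only [one_mul] at h1
      have hζ := h.continuous_ζ (hJ t ht)
      have h2 : ∫ φ in (-y)..(-x), Real.exp (ζ t φ) ≤ ∫ φ in b..a, Real.exp (ζ t φ) :=
        intervalIntegral.integral_mono_interval (by linarith) (by linarith) (by linarith)
          (Eventually.of_forall fun φ => (Real.exp_pos _).le)
          (Continuous.intervalIntegrable (by fun_prop) _ _)
      have e : -x - -y = y - x := by ring
      rw [e] at h1
      linarith [hmass t (hJ t ht)]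

end LagrangianSolution

/-! ### Blow-up at a finite breakdown time -/

/-- A Lipschitz function on `[0, T)` is Cauchy at `T`. The explicit rate is kept because, with `C`
uniform in `θ`, it yields uniform convergence. -/
theorem exists_limit_of_bounded_deriv {T C : ℝ} (hT : 0 < T) {f f' : ℝ → ℝ}
    (hf : ∀ t ∈ Ico 0 T, HasDerivAt f (f' t) t) (hC : ∀ t ∈ Ico 0 T, |f' t| ≤ C) :
    ∃ y, Tendsto f (𝓝[<] T) (𝓝 y) ∧ ∀ t ∈ Ico 0 T, |f t - y| ≤ C * (T - t) := by
  have hC0 : 0 ≤ C := (abs_nonneg _).trans (hC 0 ⟨le_rfl, hT⟩)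
  have hle : ∀ s ∈ Ico 0 T, ∀ t ∈ Ico 0 T, |f t - f s| ≤ C * |t - s| := fun s hs t ht =>
    (convex_Ico 0 T).norm_image_sub_le_of_norm_hasDerivWithin_le
      (fun r hr => (hf r hr).hasDerivWithinAt) hC hs ht
  have hlip : LipschitzOnWith (Real.toNNReal C) f (Ico 0 T) :=
    LipschitzOnWith.of_dist_le_mul fun t ht s hs => by
      rw [Real.coe_toNNReal _ hC0]; exact hle s hs t ht
  have hcauchy : Cauchy (map f (𝓝[<] T)) := by
    have h1 : Cauchy (𝓝[<] T) := cauchy_nhds.mono nhdsWithin_le_nhds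
    exact h1.map_of_le hlip.uniformContinuousOn (le_principal_iff.mpr (Ico_mem_nhdsLT hT))
  obtain ⟨y, hy⟩ := CompleteSpace.complete hcauchy
  refine ⟨y, hy, fun t ht => ?_⟩
  have h1 : Tendsto (fun s => |f t - f s|) (𝓝[<] T) (𝓝 |f t - y|) :=
    (tendsto_const_nhds.sub hy).abs
  refine le_of_tendsto h1 ?_
  filter_upwards [Ioo_mem_nhdsLT ht.2] with s hs
  have h2 := hle s ⟨ht.1.trans hs.1.le, hs.2⟩ t ht
  refine h2.trans (mul_le_mul_of_nonneg_left ?_ hC0)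
  rw [abs_sub_comm, abs_of_pos (by linarith [hs.1])]
  linarith [hs.2]

/-- Two-sided exponential bounds for `f` with `|f'| ≤ c f`. -/
theorem exp_bounds_of_abs_deriv_le {T c : ℝ} {f f' : ℝ → ℝ}
    (hf : ∀ t ∈ Ico 0 T, HasDerivAt f (f' t) t) (hc : ∀ t ∈ Ico 0 T, |f' t| ≤ c * f t) :
    ∀ t ∈ Ico 0 T, f 0 * Real.exp (-c * t) ≤ f t ∧ f t ≤ f 0 * Real.exp (c * t) := by
  have hsub : ∀ t ∈ Ico 0 T, Icc 0 t ⊆ Ico 0 T := fun t ht s hs => ⟨hs.1, hs.2.trans_lt ht.2⟩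
  have hd : ∀ k t : ℝ, t ∈ Ico 0 T → HasDerivAt (fun s => f s * Real.exp (k * s))
      ((f' t + k * f t) * Real.exp (k * t)) t := by
    intro k t ht
    refine ((hf t ht).mul (((hasDerivAt_id t).const_mul k).exp)).congr_deriv ?_
    simp; ring
  intro t ht
  have h1 : f 0 * Real.exp (c * 0) ≤ f t * Real.exp (c * t) := by
    have : MonotoneOn (fun s => f s * Real.exp (c * s)) (Icc 0 t) := by
      refine monotoneOn_of_hasDerivWithinAt_nonneg (convex_Icc 0 t)
        (fun s hs => (hd c s (hsub t ht hs)).continuousAt.continuousWithinAt)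
        (fun s hs => (hd c s (hsub t ht (interior_subset hs))).hasDerivWithinAt) fun s hs => ?_
      have := (abs_le.mp (hc s (hsub t ht (interior_subset hs)))).1
      exact mul_nonneg (by linarith) (Real.exp_pos _).le
    exact this ⟨le_rfl, ht.1⟩ ⟨ht.1, le_rfl⟩ ht.1
  have h2 : f t * Real.exp (-c * t) ≤ f 0 * Real.exp (-c * 0) := by
    have : AntitoneOn (fun s => f s * Real.exp (-c * s)) (Icc 0 t) := by
      refine antitoneOn_of_hasDerivWithinAt_nonpos (convex_Icc 0 t)
        (fun s hs => (hd (-c) s (hsub t ht hs)).continuousAt.continuousWithinAt)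
        (fun s hs => (hd (-c) s (hsub t ht (interior_subset hs))).hasDerivWithinAt) fun s hs => ?_
      have := (abs_le.mp (hc s (hsub t ht (interior_subset hs)))).2
      exact mul_nonpos_of_nonpos_of_nonneg (by linarith) (Real.exp_pos _).le
    exact this ⟨le_rfl, ht.1⟩ ⟨ht.1, le_rfl⟩ ht.1
  have h3 : Real.exp (c * t) * Real.exp (-c * t) = 1 := by
    rw [← Real.exp_add]; simp
  simp only [mul_zero, Real.exp_zero, mul_one] at h1 h2
  constructor
  · calc f 0 * Real.exp (-c * t) ≤ f t * Real.exp (c * t) * Real.exp (-c * t) := by gcongr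
      _ = f t := by rw [mul_assoc, h3, mul_one]
  · calc f t = f t * Real.exp (-c * t) * Real.exp (c * t) := by
          rw [mul_assoc, mul_comm (Real.exp (-c * t)), h3, mul_one]
      _ ≤ f 0 * Real.exp (c * t) := by gcongr

namespace LagrangianSolution

variable {κ : ℝ} {m : ℝ → ℝ} {ζ V dV : ℝ → ℝ → ℝ}

/-- If the solution breaks down at the finite time `T`, then `u_θ → -∞` along a particle path that
starts where the momentum changes from positive to negative. -/
theorem exists_blowup (hκ : κ = 1 ∨ κ = 2) {ε T : ℝ} (hε : 0 < ε) (hT : 0 < T)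
    (h : LagrangianSolution κ m (Ioo (-ε) T) ζ V dV)
    (hunb : ∀ t₀ < T, ∀ C, ∃ t ∈ Ioo t₀ T, ∃ θ, C < |V t θ|) :
    ∃ θ, ChangesPosToNegAt m θ ∧ Tendsto (fun t => V t θ) (𝓝[<] T) atBot := by
  have hκ0 : 0 < κ := by rcases hκ with rfl | rfl <;> norm_num
  have hJ : ∀ t ∈ Ico 0 T, t ∈ Ioo (-ε) T := fun t ht => ⟨by linarith [ht.1], ht.2⟩
  obtain ⟨A, B, hA, hB, hAB⟩ := h.exists_forcing_bound hκ
  set β := κ / 2 with hβ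
  have hβ0 : 0 < β := by positivity
  set Q := A + B * T with hQ
  have hQ0 : 0 ≤ Q := by positivity
  have hq : ∀ t ∈ Ico 0 T, ∀ θ, |dV t θ + β * V t θ ^ 2| ≤ Q := fun t ht θ =>
    (hAB t (hJ t ht) ht.1 θ).trans (by rw [hQ]; nlinarith [ht.2])
  -- Linearisation of the Riccati equation: `χ = φ_t` and `φ_tt = β q φ`, with `|q| ≤ Q` the
  -- forcing.
  set φ : ℝ → ℝ → ℝ := fun t θ => Real.exp (β * ζ t θ) with hφ
  set χ : ℝ → ℝ → ℝ := fun t θ => β * V t θ * φ t θ with hχ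
  have hφpos : ∀ t θ, 0 < φ t θ := fun t θ => Real.exp_pos _
  have hdφ : ∀ t ∈ Ico 0 T, ∀ θ, HasDerivAt (fun s => φ s θ) (χ t θ) t := by
    intro t ht θ
    refine (((h.deriv_ζ t (hJ t ht) θ).const_mul β).exp).congr_deriv ?_
    simp only [hχ, hφ]; ring
  have hdχ : ∀ t ∈ Ico 0 T, ∀ θ, HasDerivAt (fun s => χ s θ)
      (β * (dV t θ + β * V t θ ^ 2) * φ t θ) t := by
    intro t ht θ
    refine (((h.deriv_V t (hJ t ht) θ).const_mul β).mul (hdφ t ht θ)).congr_deriv ?_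
    simp only [hχ]; ring
  set c := 1 + β * Q with hc
  have hc0 : 0 ≤ c := by positivity
  -- A linear system with bounded coefficients can change the norm of `(φ, χ)` only by a bounded
  -- factor. The upper bound gives convergence at `T`; the lower one keeps both limits from
  -- vanishing together.
  have hN : ∀ θ, ∀ t ∈ Ico 0 T,
      (φ 0 θ ^ 2 + χ 0 θ ^ 2) * Real.exp (-c * t) ≤ φ t θ ^ 2 + χ t θ ^ 2 ∧
      φ t θ ^ 2 + χ t θ ^ 2 ≤ (φ 0 θ ^ 2 + χ 0 θ ^ 2) * Real.exp (c * t) := by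
    intro θ
    refine exp_bounds_of_abs_deriv_le (f := fun t => φ t θ ^ 2 + χ t θ ^ 2)
      (f' := fun t => 2 * φ t θ * χ t θ * (1 + β * (dV t θ + β * V t θ ^ 2))) (fun t ht => ?_)
      fun t ht => ?_
    · refine (((hdφ t ht θ).pow 2).add ((hdχ t ht θ).pow 2)).congr_deriv ?_
      simp only [Nat.cast_ofNat, Nat.add_one_sub_one, pow_one]
      ring
    · have h1 : |1 + β * (dV t θ + β * V t θ ^ 2)| ≤ c := by
        refine (abs_add_le _ _).trans ?_
        rw [abs_one, abs_mul, abs_of_pos hβ0, hc]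
        gcongr
        exact hq t ht θ
      have h2 : |2 * φ t θ * χ t θ| ≤ φ t θ ^ 2 + χ t θ ^ 2 := by
        rw [abs_le]
        constructor <;> nlinarith [sq_nonneg (φ t θ + χ t θ), sq_nonneg (φ t θ - χ t θ)]
      rw [abs_mul, mul_comm c]
      exact mul_le_mul h2 h1 (abs_nonneg _) (by positivity)
  have hφ0 : ∀ θ, φ 0 θ = 1 := fun θ => by simp [hφ, h.ζ_zero]
  obtain ⟨C₀, hC₀⟩ := exists_bound_of_continuousOn (K := {0}) isCompact_singleton
    h.cont_V (by simpa using h.zero_mem) 0 1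
  have hχ0 : ∀ θ, χ 0 θ ^ 2 ≤ (β * C₀) ^ 2 := by
    intro θ
    obtain ⟨ψ, hψ, hψθ⟩ := (h.periodic_V 0).exists_mem_Ico₀ one_pos θ
    have h1 := hC₀ 0 rfl ψ (Ico_subset_Icc_self hψ)
    simp only [hχ, hφ0, mul_one, hψθ, mul_pow]
    refine mul_le_mul_of_nonneg_left ?_ (by positivity)
    exact sq_le_sq' (abs_le.mp h1).1 (abs_le.mp h1).2
  obtain ⟨C₁, hC₁0, hC₁⟩ : ∃ C₁, 0 < C₁ ∧ ∀ t ∈ Ico 0 T, ∀ θ, |φ t θ| ≤ C₁ ∧ |χ t θ| ≤ C₁ := by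
    refine ⟨(1 + (β * C₀) ^ 2) * Real.exp (c * T) + 1, by positivity, fun t ht θ => ?_⟩
    have h1 : φ t θ ^ 2 + χ t θ ^ 2 ≤ (1 + (β * C₀) ^ 2) * Real.exp (c * T) := by
      refine (hN θ t ht).2.trans ?_
      rw [hφ0, one_pow]
      have := hχ0 θ
      have h2 := ht.2.le
      gcongr
    have key : ∀ x M : ℝ, x ^ 2 ≤ M → |x| ≤ M + 1 := fun x M hx => by
      rw [abs_le]
      constructor <;> nlinarith [sq_nonneg (x + 1), sq_nonneg (x - 1)]
    exact ⟨key _ _ (by nlinarith [sq_nonneg (χ t θ)]), key _ _ (by nlinarith [sq_nonneg (φ t θ)])⟩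
  choose f hf hfC using fun θ => exists_limit_of_bounded_deriv hT (fun t ht => hdφ t ht θ)
    (fun t ht => (hC₁ t ht θ).2)
  choose g hg _ using fun θ => exists_limit_of_bounded_deriv (C := β * Q * C₁) hT
    (fun t ht => hdχ t ht θ) (fun t ht => by
      rw [abs_mul, abs_mul, abs_of_pos hβ0]
      have h1 := hq t ht θ
      have h2 := (hC₁ t ht θ).1
      gcongr)
  have hmem : ∀ᶠ t in 𝓝[<] T, t ∈ Ico 0 T := Ico_mem_nhdsLT hT
  have hf0 : ∀ θ, 0 ≤ f θ := fun θ =>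
    ge_of_tendsto (hf θ) (Eventually.of_forall fun t => (hφpos t θ).le)
  have hVeq : ∀ t θ, V t θ = χ t θ / (β * φ t θ) := by
    intro t θ
    have := (hφpos t θ).ne'
    simp only [hχ]
    field_simp
  have hfcont : Continuous f := by
    have hu : TendstoUniformly φ f (𝓝[<] T) := by
      rw [Metric.tendstoUniformly_iff]
      intro e he
      have h1 : Ioo (T - e / C₁) T ∈ 𝓝[<] T := Ioo_mem_nhdsLT (by linarith [div_pos he hC₁0])
      filter_upwards [hmem, h1] with t ht ht' θ
      rw [dist_comm, Real.dist_eq]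
      refine (hfC θ t ht).trans_lt ?_
      have : T - t < e / C₁ := by linarith [ht'.1]
      rw [lt_div_iff₀ hC₁0] at this
      linarith
    refine hu.continuous (Eventually.frequently ?_)
    filter_upwards [hmem] with t ht
    have := h.continuous_ζ (hJ t ht)
    fun_prop
  have hfper : Function.Periodic f 1 := fun θ => by
    refine tendsto_nhds_unique (hf (θ + 1)) ?_
    simp only [hφ, h.periodic_ζ _ θ]
    exact hf θ
  -- If `f` had no zero, it would have a positive minimum by continuity and periodicity, and `V = χ
  -- / (βφ)` would be bounded near `T`.
  obtain ⟨θ₀, hθ₀⟩ : ∃ θ₀, f θ₀ = 0 := by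
    by_contra! hne
    obtain ⟨ψ, -, hmin⟩ := isCompact_Icc.exists_isMinOn (nonempty_Icc.mpr (zero_le_one (α := ℝ)))
      hfcont.continuousOn
    have hψ : 0 < f ψ := lt_of_le_of_ne (hf0 ψ) (hne ψ).symm
    have hmin' : ∀ θ, f ψ ≤ f θ := fun θ => by
      obtain ⟨y, hy, hyθ⟩ := hfper.exists_mem_Ico₀ one_pos θ
      rw [hyθ]
      exact hmin (Ico_subset_Icc_self hy)
    obtain ⟨t, ht, θ, hlt⟩ := hunb (max 0 (T - f ψ / (2 * C₁)))
      (max_lt hT (by linarith [div_pos hψ (by positivity : 0 < 2 * C₁)])) (2 * C₁ / (β * f ψ))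
    have ht' : t ∈ Ico 0 T := ⟨((le_max_left _ _).trans_lt ht.1).le, ht.2⟩
    have h1 := (le_max_right _ _).trans_lt ht.1
    have h2 : C₁ * (T - t) ≤ f ψ / 2 := by
      have : T - t < f ψ / (2 * C₁) := by linarith
      rw [lt_div_iff₀ (by positivity)] at this
      linarith
    have h3 : f ψ / 2 ≤ φ t θ := by
      have := (abs_le.mp ((hfC θ t ht').trans h2)).1
      linarith [hmin' θ]
    rw [hVeq, abs_div, abs_of_pos (mul_pos hβ0 (hφpos t θ))] at hlt
    refine hlt.not_ge ?_
    rw [div_le_div_iff₀ (mul_pos hβ0 (hφpos t θ)) (by positivity)]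
    have h4 := (hC₁ t ht' θ).2
    calc |χ t θ| * (β * f ψ) ≤ C₁ * (β * (2 * φ t θ)) := by
          gcongr
          linarith
      _ = 2 * C₁ * (β * φ t θ) := by ring
  have hbad : ∀ θ, f θ = 0 → Tendsto (fun t => V t θ) (𝓝[<] T) atBot := by
    intro θ hθ
    have hg2 : Real.exp (-c * T) ≤ g θ ^ 2 := by
      have h1 : Tendsto (fun t => φ t θ ^ 2 + χ t θ ^ 2) (𝓝[<] T) (𝓝 (f θ ^ 2 + g θ ^ 2)) :=
        ((hf θ).pow 2).add ((hg θ).pow 2)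
      rw [hθ, zero_pow two_ne_zero, zero_add] at h1
      refine ge_of_tendsto h1 ?_
      filter_upwards [hmem] with t ht
      refine le_trans ?_ (hN θ t ht).1
      rw [hφ0, one_pow]
      have h3 : Real.exp (-c * T) ≤ Real.exp (-c * t) := Real.exp_le_exp.mpr (by nlinarith [ht.2])
      nlinarith [sq_nonneg (χ 0 θ), Real.exp_pos (-c * t)]
    -- `g` is the limit of `φ_t`. Were it positive, the positive function `φ` would increase near
    -- `T` and could not tend to zero.
    have hgneg : g θ < 0 := by
      by_contra hge
      have hgpos : 0 < g θ := lt_of_le_of_ne (not_lt.mp hge) fun h0 => by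
        rw [← h0, zero_pow two_ne_zero] at hg2
        exact hg2.not_gt (Real.exp_pos _)
      obtain ⟨l, hl, hlt⟩ := (mem_nhdsLT_iff_exists_Ioo_subset).mp
        (((hg θ).eventually (lt_mem_nhds hgpos)).and hmem)
      set t₁ := (l + T) / 2 with ht₁
      have hl' : l < T := hl
      have hmono : MonotoneOn (fun t => φ t θ) (Ico t₁ T) := by
        have hs : ∀ s ∈ Ico t₁ T, s ∈ Ioo l T := fun s hs =>
          ⟨by rw [ht₁] at hs; linarith [hs.1], hs.2⟩
        refine monotoneOn_of_hasDerivWithinAt_nonneg (convex_Ico _ _)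
          (fun s h1 => (hdφ s (hlt (hs s h1)).2 θ).continuousAt.continuousWithinAt)
          (fun s h1 => (hdφ s (hlt (hs s (interior_subset h1))).2 θ).hasDerivWithinAt)
          fun s h1 => (hlt (hs s (interior_subset h1))).1.le
      have h1 : φ t₁ θ ≤ f θ := by
        refine ge_of_tendsto (hf θ) ?_
        filter_upwards [Ioo_mem_nhdsLT (by rw [ht₁]; linarith : t₁ < T)] with t ht
        exact hmono ⟨le_rfl, by rw [ht₁]; linarith⟩ ⟨ht.1.le, ht.2⟩ ht.1.le
      linarith [hφpos t₁ θ]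
    have hden : Tendsto (fun t => β * φ t θ) (𝓝[<] T) (𝓝[>] 0) := by
      refine tendsto_nhdsWithin_iff.mpr ⟨?_, Eventually.of_forall fun t =>
        mem_Ioi.mpr (mul_pos hβ0 (hφpos t θ))⟩
      have := (hf θ).const_mul β
      rwa [hθ, mul_zero] at this
    have := (hg θ).neg_mul_atTop hgneg (tendsto_inv_nhdsGT_zero.comp hden)
    refine this.congr fun t => ?_
    rw [hVeq, div_eq_mul_inv]
    rfl
  have hgood : ∀ θ, f θ ≠ 0 → ¬ Tendsto (fun t => V t θ) (𝓝[<] T) atBot := by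
    intro θ hθ hbot
    have h1 : Tendsto (fun t => V t θ) (𝓝[<] T) (𝓝 (g θ / (β * f θ))) := by
      refine ((hg θ).div ((hf θ).const_mul β) (mul_ne_zero hβ0.ne' hθ)).congr fun t => ?_
      exact (hVeq t θ).symm
    exact not_tendsto_nhds_of_tendsto_atBot hbot _ h1
  -- If `f` vanished identically, the uniform rate would give `e^ζ < 1` everywhere at a time close
  -- to `T`, contrary to its mean being one.
  obtain ⟨ψ, hψ⟩ : ∃ ψ, f ψ ≠ 0 := by
    by_contra! hzero
    have h1 : Ioo (T - 1 / C₁) T ∈ 𝓝[<] T :=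
      Ioo_mem_nhdsLT (by linarith [div_pos one_pos hC₁0])
    obtain ⟨t, ht, ht'⟩ := ((hmem.and h1)).exists
    have hlt : ∀ θ, Real.exp (ζ t θ) < 1 := by
      intro θ
      have h2 := hfC θ t ht
      rw [hzero θ, sub_zero, abs_of_pos (hφpos t θ)] at h2
      have h3 : T - t < 1 / C₁ := by linarith [ht'.1]
      rw [lt_div_iff₀ hC₁0] at h3
      have h4 : φ t θ < 1 := by linarith
      have h5 : β * ζ t θ < 0 := Real.exp_lt_one_iff.mp h4
      exact Real.exp_lt_one_iff.mpr (by nlinarith)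
    have hζ := h.continuous_ζ (hJ t ht)
    have h6 := intervalIntegral.integral_lt_integral_of_continuousOn_of_le_of_exists_lt
      (a := 0) (b := 1) (f := fun θ => Real.exp (ζ t θ)) (g := fun _ => (1 : ℝ)) one_pos
      (by fun_prop) (by fun_prop) (fun θ _ => (hlt θ).le) ⟨0, ⟨le_rfl, zero_le_one⟩, hlt 0⟩
    rw [h.mean_exp t (hJ t ht)] at h6
    simp at h6
  -- In `V(y) - V(x)` the `σ` term is bounded by `M` uniformly in time, and the `m` term has a sign.
  -- This is how `V → -∞` propagates.
  have hV : ∀ x y, ∃ M : ℝ, ∀ t ∈ Ico 0 T, ((∀ z ∈ Icc x y, 0 ≤ m z) → V t y ≤ V t x + M) ∧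
      ((∀ z ∈ Icc x y, m z ≤ 0) → V t x ≤ V t y + M) ∨ y < x := by
    intro x y
    obtain ⟨n, -, hn⟩ := h.exists_mean_exp_bound x y
    refine ⟨|circleMean m| * n, fun t ht => ?_⟩
    rcases lt_or_ge y x with hxy | hxy
    · exact Or.inr hxy
    have hζ := h.continuous_ζ (hJ t ht)
    have hmc := h.cont_m
    have hb : ∫ z in x..y, |circleMean m| * Real.exp (ζ t z) ≤ |circleMean m| * n := by
      rw [intervalIntegral.integral_const_mul]
      exact mul_le_mul_of_nonneg_left (hn t (hJ t ht)) (abs_nonneg _)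
    refine Or.inl ⟨fun hm => ?_, fun hm => ?_⟩
    · have h1 := h.V_sub (hJ t ht) x y
      have h2 : ∫ z in x..y, (circleMean m * Real.exp (ζ t z) - m z * Real.exp (-κ * ζ t z)) ≤
          ∫ z in x..y, |circleMean m| * Real.exp (ζ t z) := by
        refine intervalIntegral.integral_mono_on hxy
          (Continuous.intervalIntegrable (by fun_prop) _ _)
          (Continuous.intervalIntegrable (by fun_prop) _ _) fun z hz => ?_
        have h3 := mul_nonneg (hm z hz) (Real.exp_pos (-κ * ζ t z)).le
        have h4 := mul_le_mul_of_nonneg_right (le_abs_self (circleMean m))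
          (Real.exp_pos (ζ t z)).le
        linarith
      linarith
    · have h1 := h.V_sub (hJ t ht) x y
      have h2 : ∫ z in x..y, -(|circleMean m| * Real.exp (ζ t z)) ≤
          ∫ z in x..y, (circleMean m * Real.exp (ζ t z) - m z * Real.exp (-κ * ζ t z)) := by
        refine intervalIntegral.integral_mono_on hxy
          (Continuous.intervalIntegrable (by fun_prop) _ _)
          (Continuous.intervalIntegrable (by fun_prop) _ _) fun z hz => ?_
        have h3 := mul_nonneg (neg_nonneg.mpr (hm z hz)) (Real.exp_pos (-κ * ζ t z)).le
        have h4 := mul_le_mul_of_nonneg_right (neg_abs_le (circleMean m))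
          (Real.exp_pos (ζ t z)).le
        linarith
      rw [intervalIntegral.integral_neg] at h2
      linarith
  have hshift : ∀ n : ℤ, f (ψ + n) ≠ 0 := fun n => by
    have := (hfper.int_mul n) ψ
    rw [mul_one] at this
    rwa [this]
  refine exists_changesPosToNegAt h.cont_m
    (Bad := fun θ => Tendsto (fun t => V t θ) (𝓝[<] T) atBot) ?_ ?_ ?_ ?_ (hbad θ₀ hθ₀)
  · intro x y hxy hm hx
    obtain ⟨M, hM⟩ := hV x y
    refine tendsto_atBot_mono' _ ?_ (tendsto_atBot_add_const_right _ M hx)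
    filter_upwards [hmem] with t ht
    exact ((hM t ht).resolve_right hxy.not_gt).1 hm
  · intro x y hxy hm hy
    obtain ⟨M, hM⟩ := hV x y
    refine tendsto_atBot_mono' _ ?_ (tendsto_atBot_add_const_right _ M hy)
    filter_upwards [hmem] with t ht
    exact ((hM t ht).resolve_right hxy.not_gt).2 hm
  · intro x
    obtain ⟨n, hn⟩ := exists_int_lt (x - ψ)
    exact ⟨ψ + n, by linarith, hgood _ (hshift n)⟩
  · intro x
    obtain ⟨n, hn⟩ := exists_int_gt (x - ψ)
    exact ⟨ψ + n, by linarith, hgood _ (hshift n)⟩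

end LagrangianSolution

/-! ### Partial derivatives and time-dependent inverses -/

section PartialDerivatives

variable {J : Set ℝ} {F Ft Fθ : ℝ → ℝ → ℝ}

theorem hasFDerivAt_of_continuous_partials (hJ : IsOpen J)
    (hFt : ∀ t ∈ J, ∀ θ, HasDerivAt (fun s => F s θ) (Ft t θ) t)
    (hFθ : ∀ t ∈ J, ∀ θ, HasDerivAt (F t) (Fθ t θ) θ)
    (ct : ContinuousOn (fun p : ℝ × ℝ => Ft p.1 p.2) (J ×ˢ univ))
    (cθ : ContinuousOn (fun p : ℝ × ℝ => Fθ p.1 p.2) (J ×ˢ univ)) {t : ℝ} (ht : t ∈ J) (θ : ℝ) :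
    HasFDerivAt (fun p : ℝ × ℝ => F p.1 p.2)
      (Ft t θ • ContinuousLinearMap.fst ℝ ℝ ℝ + Fθ t θ • ContinuousLinearMap.snd ℝ ℝ ℝ) (t, θ) := by
  have hopen : J ×ˢ (univ : Set ℝ) ∈ 𝓝 (t, θ) :=
    (hJ.prod isOpen_univ).mem_nhds ⟨ht, mem_univ _⟩
  have h := hasStrictFDerivAt_uncurry_coprod (𝕜 := ℝ) (u := (t, θ)) (f := F)
    (f₁ := fun t θ => ContinuousLinearMap.toSpanSingleton ℝ (Ft t θ))
    (f₂ := fun t θ => ContinuousLinearMap.toSpanSingleton ℝ (Fθ t θ))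
    (by filter_upwards [hopen] with p hp using (hFt p.1 hp.1 p.2).hasFDerivAt)
    (by filter_upwards [hopen] with p hp using (hFθ p.1 hp.1 p.2).hasFDerivAt)
    ((ContinuousLinearMap.toSpanSingletonCLE (𝕜 := ℝ) (E := ℝ)).continuous.continuousAt.comp
      (ct.continuousAt hopen))
    ((ContinuousLinearMap.toSpanSingletonCLE (𝕜 := ℝ) (E := ℝ)).continuous.continuousAt.comp
      (cθ.continuousAt hopen))
  refine h.hasFDerivAt.congr_fderiv ?_
  ext <;> simp [Function.HasUncurry.uncurry]

theorem HasFDerivAt.hasDerivAt_comp_graph {a b : ℝ} {ξ : ℝ → ℝ} {ξ' t : ℝ}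
    (hF : HasFDerivAt (fun p : ℝ × ℝ => F p.1 p.2)
      (a • ContinuousLinearMap.fst ℝ ℝ ℝ + b • ContinuousLinearMap.snd ℝ ℝ ℝ) (t, ξ t))
    (hξ : HasDerivAt ξ ξ' t) : HasDerivAt (fun s => F s (ξ s)) (a + b * ξ') t := by
  have := hF.comp_hasDerivAt t ((hasDerivAt_id t).prodMk hξ)
  refine this.congr_deriv ?_
  simp

/-- The time derivative of the spatial inverse `ξ` of a time-dependent map `F`. -/
theorem HasFDerivAt.hasDerivAt_inverse {a b x t : ℝ} (hb : b ≠ 0) {ξ : ℝ → ℝ → ℝ}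
    (hF : HasFDerivAt (fun p : ℝ × ℝ => F p.1 p.2)
      (a • ContinuousLinearMap.fst ℝ ℝ ℝ + b • ContinuousLinearMap.snd ℝ ℝ ℝ) (t, ξ t x))
    (hξ : ContinuousAt (fun p : ℝ × ℝ => ξ p.1 p.2) (t, x))
    (hinv : ∀ᶠ p : ℝ × ℝ in 𝓝 (t, x), F p.1 (ξ p.1 p.2) = p.2) :
    HasDerivAt (fun s => ξ s x) (-(a / b)) t := by
  -- The derivative of `(t, θ) ↦ (t, F t θ)` is triangular with diagonal `1, b`, hence invertible;
  -- the time derivative of `ξ` is read off from its inverse.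
  let e : (ℝ × ℝ) ≃L[ℝ] (ℝ × ℝ) := ContinuousLinearEquiv.equivOfInverse
    ((ContinuousLinearMap.fst ℝ ℝ ℝ).prod
      (a • ContinuousLinearMap.fst ℝ ℝ ℝ + b • ContinuousLinearMap.snd ℝ ℝ ℝ))
    ((ContinuousLinearMap.fst ℝ ℝ ℝ).prod
      (b⁻¹ • (ContinuousLinearMap.snd ℝ ℝ ℝ - a • ContinuousLinearMap.fst ℝ ℝ ℝ)))
    (fun p => by ext <;> simp [hb]) (fun p => by ext <;> simp [hb])
  have hG : HasFDerivAt (fun p : ℝ × ℝ => (p.1, F p.1 p.2)) (e : (ℝ × ℝ) →L[ℝ] (ℝ × ℝ))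
      (t, ξ t x) := hasFDerivAt_fst.prodMk hF
  have hinvd : HasFDerivAt (fun p : ℝ × ℝ => (p.1, ξ p.1 p.2))
      (e.symm : (ℝ × ℝ) →L[ℝ] (ℝ × ℝ)) (t, x) := by
    refine HasFDerivAt.of_local_left_inverse (f := fun p : ℝ × ℝ => (p.1, F p.1 p.2))
      (continuousAt_fst.prodMk hξ) hG ?_
    filter_upwards [hinv] with p hp
    simp [hp]
  have h1 := (hasFDerivAt_snd (𝕜 := ℝ) (p := (t, ξ t x))).comp (t, x) hinvd
  have h2 := HasFDerivAt.comp_hasDerivAt (f := fun s : ℝ => (s, x)) t h1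
    ((hasDerivAt_id t).prodMk (hasDerivAt_const t x))
  refine h2.congr_deriv ?_
  simp [e]
  field_simp

end PartialDerivatives

theorem intervalIntegral_deriv_periodic {f f' : ℝ → ℝ} (hp : Function.Periodic f 1)
    (hf : ∀ x, HasDerivAt f (f' x) x) (hc : Continuous f') : ∫ x in (0 : ℝ)..1, f' x = 0 := by
  rw [intervalIntegral.integral_eq_sub_of_hasDerivAt (fun x _ => hf x) (hc.intervalIntegrable _ _)]
  have := hp 0
  rw [zero_add] at this
  rw [this, sub_self]

theorem Function.Periodic.deriv_periodic {f : ℝ → ℝ} {c : ℝ} (hp : Function.Periodic f c) :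
    Function.Periodic (deriv f) c := fun x => by
  rw [← deriv_comp_add_const, show (fun y => f (y + c)) = f from funext hp]

/-! ### The initial momentum -/

section Momentum

variable {u₀ : ℝ → ℝ} (hper : Function.Periodic u₀ 1) (hC2 : ContDiff ℝ 2 u₀)
include hC2

theorem ContDiff.hasDerivAt_two (x : ℝ) :
    HasDerivAt u₀ (deriv u₀ x) x ∧ HasDerivAt (deriv u₀) (deriv (deriv u₀) x) x := by
  have h1 : ContDiff ℝ 1 (deriv u₀) :=
    ((contDiff_succ_iff_deriv (n := 1)).mp (by simpa [one_add_one_eq_two] using hC2)).2.2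
  exact ⟨(hC2.differentiable two_ne_zero x).hasDerivAt,
    (h1.differentiable one_ne_zero x).hasDerivAt⟩

theorem ContDiff.continuous_deriv_two : Continuous (deriv u₀) ∧ Continuous (deriv (deriv u₀)) := by
  have h1 : ContDiff ℝ 1 (deriv u₀) :=
    ((contDiff_succ_iff_deriv (n := 1)).mp (by simpa [one_add_one_eq_two] using hC2)).2.2
  exact ⟨h1.continuous, h1.continuous_deriv le_rfl⟩

theorem continuous_momentum : Continuous (momentum u₀) :=
  continuous_const.sub hC2.continuous_deriv_two.2

include hper

omit hC2 in
theorem periodic_momentum : Function.Periodic (momentum u₀) 1 := fun x => by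
  simp only [momentum, hper.deriv_periodic.deriv_periodic x]

theorem circleMean_momentum : circleMean (momentum u₀) = circleMean u₀ := by
  have h1 := intervalIntegral_deriv_periodic hper.deriv_periodic
    (fun x => (hC2.hasDerivAt_two x).2) hC2.continuous_deriv_two.2
  have h2 := hC2.continuous_deriv_two.2
  unfold circleMean momentum
  rw [intervalIntegral.integral_sub (by simp) (h2.intervalIntegrable _ _), h1]
  simp [circleMean]

end Momentum

/-! ### From Lagrangian to Eulerian variables -/

namespace LagrangianSolution

/-- The Lagrangian flow. -/
noncomputable def flow (σ : ℝ) (ζ V : ℝ → ℝ → ℝ) (t θ : ℝ) : ℝ :=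
  (∫ s in (0 : ℝ)..t, velocity σ ζ V s 0) + ∫ φ in (0 : ℝ)..θ, Real.exp (ζ t φ)

/-- The inverse of the Lagrangian flow. -/
noncomputable def backToLabels (σ : ℝ) (ζ V : ℝ → ℝ → ℝ) (t : ℝ) : ℝ → ℝ :=
  Function.invFun (flow σ ζ V t)

/-- The velocity field in Eulerian variables. -/
noncomputable def eulerVelocity (σ : ℝ) (ζ V : ℝ → ℝ → ℝ) (t x : ℝ) : ℝ :=
  velocity σ ζ V t (backToLabels σ ζ V t x)

variable {κ : ℝ} {m : ℝ → ℝ} {J : Set ℝ} {ζ V dV : ℝ → ℝ → ℝ}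
  (h : LagrangianSolution κ m J ζ V dV)
include h

theorem hasDerivAt_flow_space {t : ℝ} (ht : t ∈ J) (θ : ℝ) :
    HasDerivAt (flow (circleMean m) ζ V t) (Real.exp (ζ t θ)) θ := by
  have hζ := h.continuous_ζ ht
  exact (hasDerivAt_primitive (by fun_prop) 0 θ).const_add _

theorem hasDerivAt_flow_time {t : ℝ} (ht : t ∈ J) (θ : ℝ) :
    HasDerivAt (fun s => flow (circleMean m) ζ V s θ) (velocity (circleMean m) ζ V t θ) t := by
  have hc : ContinuousOn (fun s => velocity (circleMean m) ζ V s 0) J :=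
    h.cont_velocity.comp (f := fun s : ℝ => ((s, 0) : ℝ × ℝ)) (by fun_prop)
      fun s hs => ⟨hs, mem_univ _⟩
  have hsub : uIcc 0 t ⊆ J := h.preconnected.ordConnected.uIcc_subset h.zero_mem ht
  have h1 : HasDerivAt (fun s => ∫ r in (0 : ℝ)..s, velocity (circleMean m) ζ V r 0)
      (velocity (circleMean m) ζ V t 0) t :=
    intervalIntegral.integral_hasDerivAt_right (hc.mono hsub).intervalIntegrable
      (hc.stronglyMeasurableAtFilter h.isOpen t ht) (hc.continuousAt (h.isOpen.mem_nhds ht))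
  have h2 := hasDerivAt_intervalIntegral h.isOpen (f := fun t φ => Real.exp (ζ t φ))
    (f' := fun t φ => V t φ * Real.exp (ζ t φ)) h.cont_ζ.rexp (h.cont_V.mul h.cont_ζ.rexp)
    (fun s hs φ => h.hasDerivAt_exp hs φ) ht 0 θ
  refine (h1.add h2).congr_deriv ?_
  simp only [velocity, relVelocity, intervalIntegral.integral_same, add_zero]

theorem cont_flow : ContinuousOn (fun p : ℝ × ℝ => flow (circleMean m) ζ V p.1 p.2)
    (J ×ˢ univ) := fun p hp =>
  (hasFDerivAt_of_continuous_partials h.isOpen (fun _ ht θ => h.hasDerivAt_flow_time ht θ)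
    (fun _ ht θ => h.hasDerivAt_flow_space ht θ) h.cont_velocity h.cont_ζ.rexp hp.1
    p.2).continuousAt.continuousWithinAt

theorem flow_add_one {t : ℝ} (ht : t ∈ J) (θ : ℝ) :
    flow (circleMean m) ζ V t (θ + 1) = flow (circleMean m) ζ V t θ + 1 := by
  have hζ := h.continuous_ζ ht
  have hc : Continuous fun φ => Real.exp (ζ t φ) := by fun_prop
  have hp : Function.Periodic (fun φ => Real.exp (ζ t φ)) 1 := fun φ => by
    simp only [h.periodic_ζ t φ]
  have h1 := intervalIntegral.integral_add_adjacent_intervals (μ := MeasureTheory.volume)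
    (hc.intervalIntegrable 0 θ) (hc.intervalIntegrable θ (θ + 1))
  have h2 := hp.intervalIntegral_add_eq θ 0
  rw [zero_add, h.mean_exp t ht] at h2
  simp only [flow, ← h1, h2]
  ring

theorem strictMono_flow {t : ℝ} (ht : t ∈ J) : StrictMono (flow (circleMean m) ζ V t) :=
  strictMono_of_hasDerivAt_pos (fun θ => h.hasDerivAt_flow_space ht θ) fun _ => Real.exp_pos _

theorem continuous_flow {t : ℝ} (ht : t ∈ J) : Continuous (flow (circleMean m) ζ V t) :=
  h.cont_flow.slice ht

theorem surjective_flow {t : ℝ} (ht : t ∈ J) :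
    Function.Surjective (flow (circleMean m) ζ V t) := by
  have hn : ∀ n : ℤ, flow (circleMean m) ζ V t n = flow (circleMean m) ζ V t 0 + n := by
    have hp : Function.Periodic (fun θ => flow (circleMean m) ζ V t θ - θ) 1 := fun θ => by
      simp only [h.flow_add_one ht]; ring
    intro n
    have := hp.int_mul n 0
    simp only [mul_one, zero_add, sub_zero] at this
    linarith
  intro x
  obtain ⟨a, ha⟩ := exists_int_lt (x - flow (circleMean m) ζ V t 0)
  obtain ⟨b, hb⟩ := exists_int_gt (x - flow (circleMean m) ζ V t 0)
  refine mem_range_of_exists_le_of_exists_ge (h.continuous_flow ht) ⟨a, ?_⟩ ⟨b, ?_⟩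
  · rw [hn]; linarith
  · rw [hn]; linarith

theorem flow_backToLabels {t : ℝ} (ht : t ∈ J) (x : ℝ) :
    flow (circleMean m) ζ V t (backToLabels (circleMean m) ζ V t x) = x :=
  Function.rightInverse_invFun (h.surjective_flow ht) x

theorem backToLabels_flow {t : ℝ} (ht : t ∈ J) (θ : ℝ) :
    backToLabels (circleMean m) ζ V t (flow (circleMean m) ζ V t θ) = θ :=
  Function.leftInverse_invFun (h.strictMono_flow ht).injective θ

theorem backToLabels_add_one {t : ℝ} (ht : t ∈ J) (x : ℝ) :
    backToLabels (circleMean m) ζ V t (x + 1) = backToLabels (circleMean m) ζ V t x + 1 := by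
  refine (h.strictMono_flow ht).injective ?_
  rw [h.flow_backToLabels ht, h.flow_add_one ht, h.flow_backToLabels ht]

/-- By monotonicity, comparing the inverse at `(s, y)` with `a` amounts to comparing `y` with the
image of `a` at time `s`, an open condition because the flow is continuous in time at fixed label.
-/
theorem continuousAt_backToLabels {t : ℝ} (ht : t ∈ J) (x : ℝ) :
    ContinuousAt (fun p : ℝ × ℝ => backToLabels (circleMean m) ζ V p.1 p.2) (t, x) := by
  have hJ : J ×ˢ (univ : Set ℝ) ∈ 𝓝 (t, x) :=
    (h.isOpen.prod isOpen_univ).mem_nhds ⟨ht, mem_univ _⟩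
  have hflow : ∀ θ, Tendsto (fun p : ℝ × ℝ => flow (circleMean m) ζ V p.1 θ) (𝓝 (t, x))
      (𝓝 (flow (circleMean m) ζ V t θ)) := fun θ =>
    (h.hasDerivAt_flow_time ht θ).continuousAt.tendsto.comp
      (f := fun p : ℝ × ℝ => p.1) (continuousAt_fst (p := (t, x))).tendsto
  set ξ := backToLabels (circleMean m) ζ V t x with hξ
  have hx : flow (circleMean m) ζ V t ξ = x := h.flow_backToLabels ht x
  have hsnd : Tendsto (fun p : ℝ × ℝ => p.2) (𝓝 (t, x)) (𝓝 x) :=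
    (continuousAt_snd (p := (t, x))).tendsto
  refine tendsto_order.mpr ⟨fun a ha => ?_, fun b hb => ?_⟩
  · have h1 : flow (circleMean m) ζ V t a < x := hx ▸ h.strictMono_flow ht ha
    filter_upwards [hJ, (hflow a).eventually_lt hsnd h1] with p hp hlt
    rw [← h.flow_backToLabels hp.1 p.2] at hlt
    exact (h.strictMono_flow hp.1).lt_iff_lt.mp hlt
  · have h1 : x < flow (circleMean m) ζ V t b := hx ▸ h.strictMono_flow ht hb
    filter_upwards [hJ, hsnd.eventually_lt (hflow b) h1] with p hp hlt
    rw [← h.flow_backToLabels hp.1 p.2] at hlt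
    exact (h.strictMono_flow hp.1).lt_iff_lt.mp hlt

theorem cont_comp_backToLabels {F : ℝ → ℝ → ℝ}
    (hF : ContinuousOn (fun p : ℝ × ℝ => F p.1 p.2) (J ×ˢ univ)) :
    ContinuousOn (fun p : ℝ × ℝ => F p.1 (backToLabels (circleMean m) ζ V p.1 p.2))
      (J ×ˢ univ) := by
  have h1 : ContinuousOn (fun p : ℝ × ℝ => (p.1, backToLabels (circleMean m) ζ V p.1 p.2))
      (J ×ˢ univ) := continuousOn_fst.prodMk fun p hp =>
    (h.continuousAt_backToLabels hp.1 p.2).continuousWithinAt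
  exact hF.comp h1 fun p hp => ⟨hp.1, mem_univ _⟩

theorem hasDerivAt_backToLabels_space {t : ℝ} (ht : t ∈ J) (x : ℝ) :
    HasDerivAt (backToLabels (circleMean m) ζ V t)
      (Real.exp (ζ t (backToLabels (circleMean m) ζ V t x)))⁻¹ x := by
  refine HasDerivAt.of_local_left_inverse ?_ (h.hasDerivAt_flow_space ht _) (Real.exp_pos _).ne'
    (Eventually.of_forall fun y => h.flow_backToLabels ht y)
  exact ContinuousAt.comp (f := fun y : ℝ => ((t, y) : ℝ × ℝ))
    (h.continuousAt_backToLabels ht x) (by fun_prop)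

theorem hasDerivAt_backToLabels_time {t : ℝ} (ht : t ∈ J) (x : ℝ) :
    HasDerivAt (fun s => backToLabels (circleMean m) ζ V s x)
      (-(velocity (circleMean m) ζ V t (backToLabels (circleMean m) ζ V t x) /
        Real.exp (ζ t (backToLabels (circleMean m) ζ V t x)))) t := by
  refine HasFDerivAt.hasDerivAt_inverse (F := flow (circleMean m) ζ V) (Real.exp_pos _).ne'
    (hasFDerivAt_of_continuous_partials h.isOpen (fun _ ht θ => h.hasDerivAt_flow_time ht θ)
    (fun _ ht θ => h.hasDerivAt_flow_space ht θ) h.cont_velocity h.cont_ζ.rexp ht _)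
    (h.continuousAt_backToLabels ht x) ?_
  filter_upwards [(h.isOpen.prod isOpen_univ).mem_nhds (⟨ht, mem_univ x⟩ : (t, x) ∈ J ×ˢ univ)]
    with p hp using h.flow_backToLabels hp.1 p.2

theorem hasDerivAt_eulerVelocity {t : ℝ} (ht : t ∈ J) (x : ℝ) :
    HasDerivAt (eulerVelocity (circleMean m) ζ V t)
      (V t (backToLabels (circleMean m) ζ V t x)) x := by
  refine ((h.hasDerivAt_velocity_space ht _).comp x
    (h.hasDerivAt_backToLabels_space ht x)).congr_deriv ?_
  rw [mul_assoc, mul_inv_cancel₀ (Real.exp_pos _).ne', mul_one]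

theorem deriv_eulerVelocity {t : ℝ} (ht : t ∈ J) : deriv (eulerVelocity (circleMean m) ζ V t) =
    fun x => V t (backToLabels (circleMean m) ζ V t x) :=
  funext fun x => (h.hasDerivAt_eulerVelocity ht x).deriv

theorem hasDerivAt_deriv_eulerVelocity {t : ℝ} (ht : t ∈ J) (x : ℝ) :
    HasDerivAt (deriv (eulerVelocity (circleMean m) ζ V t))
      ((fun θ => (circleMean m * Real.exp (ζ t θ) - m θ * Real.exp (-κ * ζ t θ)) *
        (Real.exp (ζ t θ))⁻¹) (backToLabels (circleMean m) ζ V t x)) x := by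
  rw [h.deriv_eulerVelocity ht]
  exact (h.hasDerivAt_V_space ht _).comp x (h.hasDerivAt_backToLabels_space ht x)

theorem deriv_deriv_eulerVelocity {t : ℝ} (ht : t ∈ J) (x : ℝ) :
    deriv (deriv (eulerVelocity (circleMean m) ζ V t)) x =
      (fun θ => (circleMean m * Real.exp (ζ t θ) - m θ * Real.exp (-κ * ζ t θ)) *
        (Real.exp (ζ t θ))⁻¹) (backToLabels (circleMean m) ζ V t x) :=
  (h.hasDerivAt_deriv_eulerVelocity ht x).deriv

theorem periodic_eulerVelocity {t : ℝ} (ht : t ∈ J) :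
    Function.Periodic (eulerVelocity (circleMean m) ζ V t) 1 := fun x => by
  simp only [eulerVelocity, h.backToLabels_add_one ht, h.periodic_velocity ht _]

theorem cont_eulerVelocity :
    ContinuousOn (fun p : ℝ × ℝ => eulerVelocity (circleMean m) ζ V p.1 p.2) (J ×ˢ univ) :=
  h.cont_comp_backToLabels h.cont_velocity

theorem cont_strainDensity_div : ContinuousOn (fun p : ℝ × ℝ =>
    (circleMean m * Real.exp (ζ p.1 p.2) - m p.2 * Real.exp (-κ * ζ p.1 p.2)) *
      (Real.exp (ζ p.1 p.2))⁻¹) (J ×ˢ univ) := by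
  have cm := ContinuousOn.comp_snd_univ h.cont_m J
  exact (((continuousOn_const.mul h.cont_ζ.rexp).sub
    (cm.mul (continuousOn_const.mul h.cont_ζ).rexp))).mul
    (h.cont_ζ.rexp.inv₀ fun p _ => (Real.exp_pos _).ne')

theorem cont_deriv_eulerVelocity : ContinuousOn
    (fun p : ℝ × ℝ => deriv (eulerVelocity (circleMean m) ζ V p.1) p.2) (J ×ˢ univ) := by
  refine (h.cont_comp_backToLabels h.cont_V).congr fun p hp => ?_
  rw [h.deriv_eulerVelocity hp.1]

theorem cont_deriv_deriv_eulerVelocity : ContinuousOn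
    (fun p : ℝ × ℝ => deriv (deriv (eulerVelocity (circleMean m) ζ V p.1)) p.2)
    (J ×ˢ univ) := by
  refine (h.cont_comp_backToLabels (F := fun t θ =>
    (circleMean m * Real.exp (ζ t θ) - m θ * Real.exp (-κ * ζ t θ)) *
      (Real.exp (ζ t θ))⁻¹) h.cont_strainDensity_div).congr fun p hp => ?_
  exact h.deriv_deriv_eulerVelocity hp.1 p.2

theorem contDiff_eulerVelocity {t : ℝ} (ht : t ∈ J) :
    ContDiff ℝ 2 (eulerVelocity (circleMean m) ζ V t) := by
  have h1 : ContDiff ℝ 1 (deriv (eulerVelocity (circleMean m) ζ V t)) :=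
    contDiff_one_iff_deriv.mpr
      ⟨fun x => (h.hasDerivAt_deriv_eulerVelocity ht x).differentiableAt,
        h.cont_deriv_deriv_eulerVelocity.slice
          (f := fun t => deriv (deriv (eulerVelocity (circleMean m) ζ V t))) ht⟩
  have h2 := (contDiff_succ_iff_deriv (n := 1) (f := eulerVelocity (circleMean m) ζ V t)).mpr
    ⟨fun x => (h.hasDerivAt_eulerVelocity ht x).differentiableAt, by simp, h1⟩
  simpa [one_add_one_eq_two] using h2

theorem circleMean_eulerVelocity {t : ℝ} (ht : t ∈ J) :
    circleMean (eulerVelocity (circleMean m) ζ V t) = circleMean m := by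
  have hζ := h.continuous_ζ ht
  have h1 := intervalIntegral.integral_comp_mul_deriv (a := 0) (b := 1)
    (f := flow (circleMean m) ζ V t) (f' := fun θ => Real.exp (ζ t θ))
    (g := eulerVelocity (circleMean m) ζ V t)
    (fun θ _ => h.hasDerivAt_flow_space ht θ) (by fun_prop)
    (h.cont_eulerVelocity.slice (f := eulerVelocity (circleMean m) ζ V) ht)
  have h2 := h.flow_add_one ht 0
  rw [zero_add] at h2
  have h3 := (h.periodic_eulerVelocity ht).intervalIntegral_add_eq
    (flow (circleMean m) ζ V t 0) 0
  rw [h2, h3, zero_add] at h1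
  simp only [Function.comp, eulerVelocity, h.backToLabels_flow ht, h.mean_velocity ht] at h1
  exact h1.symm

/-- `u_θ(t, x) = V(t, ξ(t, x))` with `ξ` the inverse flow; the chain rule and `ξ_t = -u / η_θ`
produce the transport term. -/
theorem hasDerivAt_deriv_eulerVelocity_time {t : ℝ} (ht : t ∈ J) (x : ℝ) :
    HasDerivAt (fun s => deriv (eulerVelocity (circleMean m) ζ V s) x)
      (dV t (backToLabels (circleMean m) ζ V t x) - eulerVelocity (circleMean m) ζ V t x *
        deriv (deriv (eulerVelocity (circleMean m) ζ V t)) x) t := by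
  have cm := ContinuousOn.comp_snd_univ h.cont_m J
  have hF := hasFDerivAt_of_continuous_partials h.isOpen h.deriv_V
    (fun _ ht θ => h.hasDerivAt_V_space ht θ) h.cont_dV ((continuousOn_const.mul h.cont_ζ.rexp).sub
    (cm.mul (continuousOn_const.mul h.cont_ζ).rexp)) ht (backToLabels (circleMean m) ζ V t x)
  have h1 := hF.hasDerivAt_comp_graph (ξ := fun s => backToLabels (circleMean m) ζ V s x)
    (h.hasDerivAt_backToLabels_time ht x)
  refine (h1.congr_of_eventuallyEq ?_).congr_deriv ?_
  · filter_upwards [h.isOpen.mem_nhds ht] with s hs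
    rw [h.deriv_eulerVelocity hs]
  · rw [h.deriv_deriv_eulerVelocity ht x, eulerVelocity]
    ring

end LagrangianSolution

/-! ### Lagrangian solutions give `C²` solutions -/

namespace LagrangianSolution

variable {κ : ℝ} {u₀ : ℝ → ℝ} {J J' : Set ℝ} {ζ V dV : ℝ → ℝ → ℝ}
  (hper : Function.Periodic u₀ 1) (hC2 : ContDiff ℝ 2 u₀)
  (h : LagrangianSolution κ (momentum u₀) J ζ V dV)
include h

theorem flow_zero (θ : ℝ) : flow (circleMean (momentum u₀)) ζ V 0 θ = θ := by
  simp [flow, h.ζ_zero]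

include hper hC2

/-- At `t = 0` one has `V_θ = u₀''`. The two constants of integration are fixed by `∫ V = 0` and by
the mean of `u₀`. -/
theorem velocity_zero : velocity (circleMean (momentum u₀)) ζ V 0 = u₀ := by
  have c1 := hC2.continuous_deriv_two.1
  have c2 := hC2.continuous_deriv_two.2
  have hV : ∀ θ, V 0 θ - V 0 0 = deriv u₀ θ - deriv u₀ 0 := by
    intro θ
    rw [h.strain_eq 0 h.zero_mem]
    simp only [h.ζ_zero, mul_zero, Real.exp_zero, mul_one, circleMean_momentum hper hC2, momentum,
      sub_sub_cancel]
    exact intervalIntegral.integral_eq_sub_of_hasDerivAt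
      (fun x _ => (hC2.hasDerivAt_two x).2) (c2.intervalIntegrable _ _)
  have hV0 : V 0 0 - deriv u₀ 0 = 0 := by
    have h1 := h.mean_V 0 h.zero_mem
    have h2 : ∀ θ, V 0 θ = deriv u₀ θ + (V 0 0 - deriv u₀ 0) := fun θ => by linarith [hV θ]
    simp only [h.ζ_zero, Real.exp_zero, mul_one] at h1
    rw [intervalIntegral.integral_congr fun θ _ => h2 θ, intervalIntegral.integral_add (c1.intervalIntegrable _ _) (by simp),
      intervalIntegral_deriv_periodic hper (fun x => (hC2.hasDerivAt_two x).1) c1] at h1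
    simpa using h1
  have hVeq : ∀ θ, V 0 θ = deriv u₀ θ := fun θ => by linarith [hV θ]
  have hY : ∀ θ, relVelocity ζ V 0 θ = u₀ θ - u₀ 0 := by
    intro θ
    simp only [relVelocity, hVeq, h.ζ_zero, Real.exp_zero, mul_one]
    exact intervalIntegral.integral_eq_sub_of_hasDerivAt
      (fun x _ => (hC2.hasDerivAt_two x).1) (c1.intervalIntegrable _ _)
  ext θ
  simp only [velocity, hY, h.ζ_zero, Real.exp_zero, mul_one]
  rw [intervalIntegral.integral_sub (hC2.continuous.intervalIntegrable _ _) (by simp),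
    circleMean_momentum hper hC2, circleMean]
  simp

theorem isC2Solution (hJ : J' ⊆ J) :
    IsC2Solution (κ + 1) u₀ J' (eulerVelocity (circleMean (momentum u₀)) ζ V) where
  initial := by
    ext x
    have h1 := h.flow_backToLabels h.zero_mem x
    rw [h.flow_zero] at h1
    rw [eulerVelocity, h1, velocity_zero hper hC2 h]
  periodic t ht := h.periodic_eulerVelocity (hJ ht)
  contDiff t ht := h.contDiff_eulerVelocity (hJ ht)
  cont₀ := h.cont_eulerVelocity.mono (prod_mono hJ subset_rfl)
  cont₁ := h.cont_deriv_eulerVelocity.mono (prod_mono hJ subset_rfl)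
  cont₂ := h.cont_deriv_deriv_eulerVelocity.mono (prod_mono hJ subset_rfl)
  equation := by
    -- `I` is the `θ`-independent term of `dV_eq`, and `σ' = 0`.
    refine ⟨fun _ => 0, fun t => (κ / 2 - 1) *
      (∫ φ in (0 : ℝ)..1, V t φ ^ 2 * Real.exp (ζ t φ)) -
      (κ + 1) * circleMean (momentum u₀) ^ 2, fun t ht => ⟨?_, fun x => ?_⟩⟩
    · refine (hasDerivWithinAt_const t J' (circleMean (momentum u₀))).congr
        (fun s hs => h.circleMean_eulerVelocity (hJ hs)) (h.circleMean_eulerVelocity (hJ ht))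
    · refine (h.hasDerivAt_deriv_eulerVelocity_time (hJ ht) x).hasDerivWithinAt.congr_deriv ?_
      rw [h.dV_eq (hJ ht), h.circleMean_eulerVelocity (hJ ht), h.deriv_eulerVelocity (hJ ht)]
      simp only [eulerVelocity]
      ring

omit hper hC2 in
theorem isFlow (hJ : J' ⊆ J) : IsFlow J' (eulerVelocity (circleMean (momentum u₀)) ζ V)
    (flow (circleMean (momentum u₀)) ζ V) := fun θ => by
  refine ⟨h.flow_zero θ, fun t ht => ?_⟩
  rw [eulerVelocity, h.backToLabels_flow (hJ ht)]
  exact (h.hasDerivAt_flow_time (hJ ht) θ).hasDerivWithinAt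

omit hper hC2 in
theorem deriv_eulerVelocity_flow {t : ℝ} (ht : t ∈ J) (θ : ℝ) :
    deriv (eulerVelocity (circleMean (momentum u₀)) ζ V t)
      (flow (circleMean (momentum u₀)) ζ V t θ) = V t θ := by
  simp only [h.deriv_eulerVelocity ht, h.backToLabels_flow ht]

end LagrangianSolution

/-! ### Uniqueness -/

/-- Poincaré inequality, in the uniform norm, for functions of mean zero. -/
theorem sq_le_integral_deriv_sq {w w' : ℝ → ℝ} (hw : ∀ x, HasDerivAt w (w' x) x)
    (hc : Continuous w') (hmean : ∫ x in (0 : ℝ)..1, w x = 0) {x : ℝ} (hx : x ∈ Icc (0 : ℝ) 1) :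
    w x ^ 2 ≤ ∫ y in (0 : ℝ)..1, w' y ^ 2 := by
  have hwc : Continuous w := continuous_iff_continuousAt.mpr fun y => (hw y).continuousAt
  set a := ∫ y in (0 : ℝ)..1, |w' y| with ha
  have hosc : ∀ y ∈ Icc (0 : ℝ) 1, |w x - w y| ≤ a := by
    intro y hy
    rw [← intervalIntegral.integral_eq_sub_of_hasDerivAt (fun z _ => hw z)
      (hc.intervalIntegrable _ _)]
    have key : ∀ p q : ℝ, 0 ≤ p → p ≤ q → q ≤ 1 → |∫ z in p..q, w' z| ≤ a := fun p q hp hpq hq =>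
      (intervalIntegral.abs_integral_le_integral_abs hpq).trans
        (intervalIntegral.integral_mono_interval hp hpq hq
          (Eventually.of_forall fun _ => abs_nonneg _) (hc.abs.intervalIntegrable _ _))
    rcases le_total x y with hxy | hxy
    · rw [intervalIntegral.integral_symm, abs_neg]
      exact key x y hx.1 hxy hy.2
    · exact key y x hy.1 hxy hx.2
  have h1 : |w x| ≤ a := by
    have h2 : w x = ∫ y in (0 : ℝ)..1, (w x - w y) := by
      rw [intervalIntegral.integral_sub (by simp) (hwc.intervalIntegrable _ _), hmean]
      simp
    rw [h2]
    have h3 := intervalIntegral.norm_integral_le_of_norm_le_const (a := (0 : ℝ)) (b := 1) (C := a)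
      (f := fun y => w x - w y) fun y hy => hosc y (by
        rw [uIoc_of_le zero_le_one] at hy
        exact ⟨hy.1.le, hy.2⟩)
    simpa using h3
  have h4 : a ^ 2 ≤ ∫ y in (0 : ℝ)..1, w' y ^ 2 := by
    have h5 : 0 ≤ ∫ y in (0 : ℝ)..1, (|w' y| - a) ^ 2 :=
      intervalIntegral.integral_nonneg zero_le_one fun y _ => sq_nonneg _
    have h6 : ∀ y, (|w' y| - a) ^ 2 = w' y ^ 2 - 2 * a * |w' y| + a ^ 2 := fun y => by
      rw [← sq_abs (w' y)]; ring
    simp only [h6] at h5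
    rw [intervalIntegral.integral_add (Continuous.intervalIntegrable (by fun_prop) _ _) (by simp),
      intervalIntegral.integral_sub (Continuous.intervalIntegrable (by fun_prop) _ _)
      (Continuous.intervalIntegrable (by fun_prop) _ _), intervalIntegral.integral_const_mul,
      ← ha] at h5
    simp only [intervalIntegral.integral_const, sub_zero, smul_eq_mul, one_mul] at h5
    linarith
  calc w x ^ 2 = |w x| ^ 2 := (sq_abs _).symm
    _ ≤ a ^ 2 := pow_le_pow_left₀ (abs_nonneg _) h1 2
    _ ≤ _ := h4

/-- The energy estimate for the linearised equation: `u`, `v` are the velocities, primes are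
derivatives. -/
theorem energy_estimate {a b M : ℝ} {u u' u'' v v' v'' : ℝ → ℝ}
    (hu : ∀ x, HasDerivAt u (u' x) x) (hu' : ∀ x, HasDerivAt u' (u'' x) x) (cu : Continuous u'')
    (hv : ∀ x, HasDerivAt v (v' x) x) (hv' : ∀ x, HasDerivAt v' (v'' x) x) (cv : Continuous v'')
    (pu : Function.Periodic u 1) (pu' : Function.Periodic u' 1) (pv' : Function.Periodic v' 1)
    (hmean : ∫ x in (0 : ℝ)..1, (u x - v x) = 0)
    (hM : ∀ x ∈ Icc (0 : ℝ) 1, |u' x| ≤ M ∧ |v' x| ≤ M ∧ |v'' x| ≤ M) :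
    ∫ x in (0 : ℝ)..1, 2 * (u' x - v' x) * (a * (u x - v x) - b * (u' x ^ 2 - v' x ^ 2) -
      (u x * u'' x - v x * v'' x)) ≤
      (2 * |a| + 4 * |b| * M + 3 * M) * ∫ x in (0 : ℝ)..1, (u' x - v' x) ^ 2 := by
  have c0 : Continuous u := continuous_iff_continuousAt.mpr fun y => (hu y).continuousAt
  have c1 : Continuous u' := continuous_iff_continuousAt.mpr fun y => (hu' y).continuousAt
  have c2 : Continuous v := continuous_iff_continuousAt.mpr fun y => (hv y).continuousAt
  have c3 : Continuous v' := continuous_iff_continuousAt.mpr fun y => (hv' y).continuousAt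
  set e := ∫ x in (0 : ℝ)..1, (u' x - v' x) ^ 2 with he
  have hM0 : 0 ≤ M := (abs_nonneg _).trans (hM 0 ⟨le_rfl, zero_le_one⟩).1
  have hP : ∀ x ∈ Icc (0 : ℝ) 1, (u x - v x) ^ 2 ≤ e := fun x hx =>
    sq_le_integral_deriv_sq (w := fun x => u x - v x) (w' := fun x => u' x - v' x)
      (fun y => (hu y).sub (hv y)) (by fun_prop) hmean hx
  have hzero : ∫ x in (0 : ℝ)..1,
      (u' x * (u' x - v' x) ^ 2 + u x * (2 * (u' x - v' x) * (u'' x - v'' x))) = 0 := by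
    refine intervalIntegral_deriv_periodic (f := fun x => u x * (u' x - v' x) ^ 2)
      (fun x => by simp only [pu x, pu' x, pv' x]) (fun x => ?_) (by fun_prop)
    refine ((hu x).mul (((hu' x).sub (hv' x)).pow 2)).congr_deriv ?_
    simp
  -- Write `u u'' - v v'' = u (u'' - v'') + (u - v) v''`. The first part is integrated by parts
  -- against `u' - v'`, so no bound on `u''` is needed.
  have hsplit : ∀ x, 2 * (u' x - v' x) * (a * (u x - v x) - b * (u' x ^ 2 - v' x ^ 2) -
      (u x * u'' x - v x * v'' x)) =
      (2 * (u x - v x) * (u' x - v' x) * (a - v'' x) +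
        (u' x - 2 * b * (u' x + v' x)) * (u' x - v' x) ^ 2) -
      (u' x * (u' x - v' x) ^ 2 + u x * (2 * (u' x - v' x) * (u'' x - v'' x))) :=
    fun x => by ring
  simp only [hsplit]
  rw [intervalIntegral.integral_sub (Continuous.intervalIntegrable (by fun_prop) _ _)
    (Continuous.intervalIntegrable (by fun_prop) _ _), hzero, sub_zero]
  have hmono : ∫ x in (0 : ℝ)..1, (2 * (u x - v x) * (u' x - v' x) * (a - v'' x) +
        (u' x - 2 * b * (u' x + v' x)) * (u' x - v' x) ^ 2) ≤
      ∫ x in (0 : ℝ)..1, ((|a| + M) * e +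
        (|a| + M + (M + 4 * |b| * M)) * (u' x - v' x) ^ 2) := by
    refine intervalIntegral.integral_mono_on zero_le_one
      (Continuous.intervalIntegrable (by fun_prop) _ _)
      (Continuous.intervalIntegrable (by fun_prop) _ _) fun x hx => ?_
    obtain ⟨h1, h2, h3⟩ := hM x hx
    have h4 : 2 * (u x - v x) * (u' x - v' x) * (a - v'' x) ≤
        (e + (u' x - v' x) ^ 2) * (|a| + M) := by
      refine (le_abs_self _).trans ?_
      rw [abs_mul]
      have h5 : |a - v'' x| ≤ |a| + M := (abs_sub _ _).trans (by linarith)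
      have h6 : |2 * (u x - v x) * (u' x - v' x)| ≤ e + (u' x - v' x) ^ 2 := by
        have := hP x hx
        rw [abs_le]
        constructor <;> nlinarith [sq_nonneg ((u x - v x) + (u' x - v' x)),
          sq_nonneg ((u x - v x) - (u' x - v' x))]
      exact mul_le_mul h6 h5 (abs_nonneg _) ((abs_nonneg _).trans h6)
    have h7 : u' x - 2 * b * (u' x + v' x) ≤ M + 4 * |b| * M := by
      have h8 : |2 * b * (u' x + v' x)| ≤ 2 * |b| * (2 * M) := by
        rw [abs_mul, abs_mul, abs_two]
        have : |u' x + v' x| ≤ 2 * M := (abs_add_le _ _).trans (by linarith)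
        gcongr
      have h9 := (abs_le.mp h8).1
      have h10 := (abs_le.mp h1).2
      linarith
    have h11 := mul_le_mul_of_nonneg_right h7 (sq_nonneg (u' x - v' x))
    linarith
  refine hmono.trans (le_of_eq ?_)
  rw [intervalIntegral.integral_add (by simp)
    (Continuous.intervalIntegrable (by fun_prop) _ _), intervalIntegral.integral_const,
    intervalIntegral.integral_const_mul, ← he]
  simp only [sub_zero, smul_eq_mul, one_mul]
  ring

/-- The covariance with a function of mean zero is not affected by additive constants. -/
theorem covariance_sub_const {w S : ℝ → ℝ} (hw : Continuous w) (hS : Continuous S)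
    (hmean : ∫ x in (0 : ℝ)..1, w x = 0) (k l : ℝ) :
    (∫ x in (0 : ℝ)..1, (w x - k) * (S x - l)) -
      (∫ x in (0 : ℝ)..1, (w x - k)) * ∫ x in (0 : ℝ)..1, (S x - l) =
      ∫ x in (0 : ℝ)..1, w x * S x := by
  have h1 : ∀ x, (w x - k) * (S x - l) = w x * S x - l * w x - k * (S x - l) := fun x => by ring
  simp only [h1]
  rw [intervalIntegral.integral_sub (Continuous.intervalIntegrable (by fun_prop) _ _)
    (Continuous.intervalIntegrable (by fun_prop) _ _),
    intervalIntegral.integral_sub (Continuous.intervalIntegrable (by fun_prop) _ _)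
    (Continuous.intervalIntegrable (by fun_prop) _ _), intervalIntegral.integral_const_mul,
    intervalIntegral.integral_const_mul, intervalIntegral.integral_sub
    (hw.intervalIntegrable _ _) (by simp), hmean]
  simp

namespace IsC2Solution

variable {lam : ℝ} {u₀ : ℝ → ℝ} {T : ℝ} {u v : ℝ → ℝ → ℝ}

/-- Compare the equation at `θ = 0` and at `θ = 1`: every term but `σ' θ` is periodic, so `σ' = 0`
and the mean is conserved. -/
theorem exists_equation (hu : IsC2Solution lam u₀ (Ico 0 T) u) :
    ∃ I : ℝ → ℝ, ∀ t ∈ Ico 0 T, circleMean (u t) = circleMean u₀ ∧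
      ∀ θ : ℝ, HasDerivWithinAt (fun s => deriv (u s) θ)
        (I t + (lam * circleMean u₀ * u t θ - (lam - 1) / 2 * (deriv (u t) θ) ^ 2 -
          u t θ * deriv (deriv (u t)) θ)) (Ico 0 T) t := by
  obtain ⟨dσ, I, heq⟩ := hu.equation
  have hdσ : ∀ t ∈ Ico 0 T, dσ t = 0 := by
    intro t ht
    have h1 := ((heq t ht).2 (0 + 1)).congr (f₁ := fun s => deriv (u s) 0)
      (fun s hs => ((hu.periodic s hs).deriv_periodic 0).symm)
      ((hu.periodic t ht).deriv_periodic 0).symm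
    have h2 := (uniqueDiffOn_Ico 0 T t ht).eq_deriv _ h1 ((heq t ht).2 0)
    rw [hu.periodic t ht, (hu.periodic t ht).deriv_periodic,
      (hu.periodic t ht).deriv_periodic.deriv_periodic] at h2
    linarith
  have hmean : ∀ t ∈ Ico 0 T, circleMean (u t) = circleMean u₀ := by
    intro t ht
    have h1 := (convex_Ico 0 T).norm_image_sub_le_of_norm_hasDerivWithin_le
      (f := fun s => circleMean (u s)) (C := 0) (fun s hs => (heq s hs).1)
      (fun s hs => by simp [hdσ s hs]) ⟨le_rfl, ht.1.trans_lt ht.2⟩ ht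
    rw [hu.initial, zero_mul] at h1
    exact sub_eq_zero.mp (norm_le_zero_iff.mp h1)
  refine ⟨I, fun t ht => ⟨hmean t ht, fun θ => ((heq t ht).2 θ).congr_deriv ?_⟩⟩
  rw [hdσ t ht, hmean t ht]
  ring

theorem unique (hu : IsC2Solution lam u₀ (Ico 0 T) u) (hv : IsC2Solution lam u₀ (Ico 0 T) v)
    {t : ℝ} (ht : t ∈ Ico 0 T) : u t = v t := by
  obtain ⟨Iu, heu⟩ := hu.exists_equation
  obtain ⟨Iv, hev⟩ := hv.exists_equation
  set a := lam * circleMean u₀ with ha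
  set b := (lam - 1) / 2 with hb
  set S : ℝ → ℝ → ℝ := fun s θ => a * (u s θ - v s θ) -
    b * (deriv (u s) θ ^ 2 - deriv (v s) θ ^ 2) -
    (u s θ * deriv (deriv (u s)) θ - v s θ * deriv (deriv (v s)) θ) with hS
  -- Nothing is known about the regularity of `I` in time. Subtracting the value at `θ = 0` removes
  -- it, so that `p` has a jointly continuous time derivative.
  set p : ℝ → ℝ → ℝ := fun s θ => (deriv (u s) θ - deriv (v s) θ) -
    (deriv (u s) 0 - deriv (v s) 0) with hp
  have hsub : Ioo 0 T ⊆ Ico 0 T := Ioo_subset_Ico_self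
  have cS : ContinuousOn (fun q : ℝ × ℝ => S q.1 q.2) (Ico 0 T ×ˢ univ) :=
    ((continuousOn_const.mul (hu.cont₀.sub hv.cont₀)).sub
      (continuousOn_const.mul ((hu.cont₁.pow 2).sub (hv.cont₁.pow 2)))).sub
      ((hu.cont₀.mul hu.cont₂).sub (hv.cont₀.mul hv.cont₂))
  have czero : ∀ {F : ℝ → ℝ → ℝ}, ContinuousOn (fun q : ℝ × ℝ => F q.1 q.2) (Ico 0 T ×ˢ univ) →
      ContinuousOn (fun q : ℝ × ℝ => F q.1 0) (Ico 0 T ×ˢ univ) := fun hF =>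
    hF.comp (f := fun q : ℝ × ℝ => ((q.1, 0) : ℝ × ℝ)) (by fun_prop)
      fun q hq => ⟨hq.1, mem_univ _⟩
  have cw : ContinuousOn (fun q : ℝ × ℝ => deriv (u q.1) q.2 - deriv (v q.1) q.2)
      (Ico 0 T ×ˢ univ) := hu.cont₁.sub hv.cont₁
  have cp : ContinuousOn (fun q : ℝ × ℝ => p q.1 q.2) (Ico 0 T ×ˢ univ) :=
    cw.sub (czero (F := fun s θ => deriv (u s) θ - deriv (v s) θ) cw)
  have cp' : ContinuousOn (fun q : ℝ × ℝ => S q.1 q.2 - S q.1 0) (Ico 0 T ×ˢ univ) :=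
    cS.sub (czero cS)
  have hdp : ∀ s ∈ Ioo 0 T, ∀ θ, HasDerivAt (fun s => p s θ) (S s θ - S s 0) s := by
    intro s hs θ
    have hnhds : Ico 0 T ∈ 𝓝 s := Ico_mem_nhds hs.1 hs.2
    have h1 := fun θ => ((heu s (hsub hs)).2 θ).hasDerivAt hnhds
    have h2 := fun θ => ((hev s (hsub hs)).2 θ).hasDerivAt hnhds
    refine (((h1 θ).sub (h2 θ)).sub ((h1 0).sub (h2 0))).congr_deriv ?_
    simp only [hS]
    ring
  have hmeanw : ∀ s ∈ Ico 0 T, ∫ θ in (0 : ℝ)..1, (deriv (u s) θ - deriv (v s) θ) = 0 := by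
    intro s hs
    have cu := (hu.contDiff s hs).continuous_deriv_two.1
    have cv := (hv.contDiff s hs).continuous_deriv_two.1
    rw [intervalIntegral.integral_sub (cu.intervalIntegrable _ _) (cv.intervalIntegrable _ _),
      intervalIntegral_deriv_periodic (hu.periodic s hs)
        (fun x => ((hu.contDiff s hs).hasDerivAt_two x).1) cu,
      intervalIntegral_deriv_periodic (hv.periodic s hs)
        (fun x => ((hv.contDiff s hs).hasDerivAt_two x).1) cv, sub_zero]
  -- A variance ignores the constant subtracted in `p`, so `E` equals `∫ (u_θ - v_θ)²`, yet is
  -- differentiable without reference to `I`.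
  set E : ℝ → ℝ := fun s => (∫ θ in (0 : ℝ)..1, p s θ ^ 2) - (∫ θ in (0 : ℝ)..1, p s θ) ^ 2 with hE
  have hEeq : ∀ s ∈ Ico 0 T, E s = ∫ θ in (0 : ℝ)..1, (deriv (u s) θ - deriv (v s) θ) ^ 2 := by
    intro s hs
    have c := (cw.slice (f := fun s θ => deriv (u s) θ - deriv (v s) θ) hs)
    have h1 := covariance_sub_const c c (hmeanw s hs) (deriv (u s) 0 - deriv (v s) 0)
      (deriv (u s) 0 - deriv (v s) 0)
    simp only [hE, hp, pow_two]
    exact h1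
  have hEcont : ContinuousOn E (Ico 0 T) :=
    (continuousOn_intervalIntegral (f := fun s θ => p s θ ^ 2) (cp.pow 2) 0 1).sub
      ((continuousOn_intervalIntegral cp 0 1).pow 2)
  have hEderiv : ∀ s ∈ Ioo 0 T, HasDerivAt E
      (∫ θ in (0 : ℝ)..1, 2 * (deriv (u s) θ - deriv (v s) θ) * S s θ) s := by
    intro s hs
    have hmono : Ioo 0 T ×ˢ (univ : Set ℝ) ⊆ Ico 0 T ×ˢ univ := prod_mono hsub subset_rfl
    have h1 := hasDerivAt_intervalIntegral isOpen_Ioo (f := fun s θ => p s θ ^ 2)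
      (f' := fun s θ => 2 * p s θ * (S s θ - S s 0)) ((cp.pow 2).mono hmono)
      (((continuousOn_const.mul cp).mul cp').mono hmono)
      (fun r hr θ => ((hdp r hr θ).pow 2).congr_deriv (by simp)) hs 0 1
    have h2 := hasDerivAt_intervalIntegral isOpen_Ioo (f := p)
      (f' := fun s θ => S s θ - S s 0) (cp.mono hmono) (cp'.mono hmono) hdp hs 0 1
    refine (h1.sub (h2.pow 2)).congr_deriv ?_
    have cSs := cS.slice (hsub hs)
    have c := (cw.slice (f := fun s θ => deriv (u s) θ - deriv (v s) θ) (hsub hs))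
    have h3 := covariance_sub_const c cSs (hmeanw s (hsub hs)) (deriv (u s) 0 - deriv (v s) 0)
      (S s 0)
    simp only [mul_assoc, intervalIntegral.integral_const_mul, ← h3, Nat.cast_ofNat,
      Nat.add_one_sub_one, pow_one, hp]
    ring
  have hcpt : Icc 0 t ⊆ Ico 0 T := fun s hs => ⟨hs.1, hs.2.trans_lt ht.2⟩
  obtain ⟨M₁, hM₁⟩ := exists_bound_of_continuousOn (f := fun s => deriv (u s)) isCompact_Icc hu.cont₁
    hcpt 0 1
  obtain ⟨M₂, hM₂⟩ := exists_bound_of_continuousOn (f := fun s => deriv (v s)) isCompact_Icc hv.cont₁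
    hcpt 0 1
  obtain ⟨M₃, hM₃⟩ := exists_bound_of_continuousOn (f := fun s => deriv (deriv (v s))) isCompact_Icc hv.cont₂
    hcpt 0 1
  set M := max M₁ (max M₂ M₃) with hM
  set C := 2 * |a| + 4 * |b| * M + 3 * M with hC
  have hmean0 : ∀ s ∈ Ico 0 T, ∫ θ in (0 : ℝ)..1, (u s θ - v s θ) = 0 := by
    intro s hs
    have h1 : circleMean (u s) = circleMean (v s) := by
      rw [(heu s hs).1, (hev s hs).1]
    rw [intervalIntegral.integral_sub ((hu.contDiff s hs).continuous.intervalIntegrable _ _)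
      ((hv.contDiff s hs).continuous.intervalIntegrable _ _)]
    exact sub_eq_zero.mpr h1
  have hEle : ∀ s ∈ Ioo 0 t,
      ∫ θ in (0 : ℝ)..1, 2 * (deriv (u s) θ - deriv (v s) θ) * S s θ ≤ C * E s := by
    intro s hs
    have hsT : s ∈ Ico 0 T := hcpt ⟨hs.1.le, hs.2.le⟩
    have hst : s ∈ Icc 0 t := ⟨hs.1.le, hs.2.le⟩
    rw [hEeq s hsT]
    exact energy_estimate (fun x => ((hu.contDiff s hsT).hasDerivAt_two x).1)
      (fun x => ((hu.contDiff s hsT).hasDerivAt_two x).2)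
      (hu.contDiff s hsT).continuous_deriv_two.2
      (fun x => ((hv.contDiff s hsT).hasDerivAt_two x).1)
      (fun x => ((hv.contDiff s hsT).hasDerivAt_two x).2)
      (hv.contDiff s hsT).continuous_deriv_two.2 (hu.periodic s hsT)
      (hu.periodic s hsT).deriv_periodic (hv.periodic s hsT).deriv_periodic (hmean0 s hsT)
      fun x hx => ⟨(hM₁ s hst x hx).trans (le_max_left _ _),
        (hM₂ s hst x hx).trans ((le_max_left _ _).trans (le_max_right _ _)),
        (hM₃ s hst x hx).trans ((le_max_right _ _).trans (le_max_right _ _))⟩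
  -- Grönwall's inequality in integrating-factor form. Only a one-sided bound of `E'` on the open
  -- interval is needed.
  have hanti : AntitoneOn (fun s => E s * Real.exp (-C * s)) (Icc 0 t) := by
    refine antitoneOn_of_hasDerivWithinAt_nonpos (convex_Icc 0 t)
      (f' := fun s => ((∫ θ in (0 : ℝ)..1, 2 * (deriv (u s) θ - deriv (v s) θ) * S s θ) -
        C * E s) * Real.exp (-C * s))
      ((hEcont.mono hcpt).mul (by fun_prop)) (fun s hs => ?_) fun s hs => ?_
    · rw [interior_Icc] at hs ⊢
      refine HasDerivAt.hasDerivWithinAt ?_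
      refine ((hEderiv s ⟨hs.1, hs.2.trans ht.2⟩).mul
        (((hasDerivAt_id s).const_mul (-C)).exp)).congr_deriv ?_
      simp only [id, mul_one]
      ring
    · rw [interior_Icc] at hs
      exact mul_nonpos_of_nonpos_of_nonneg (sub_nonpos.mpr (hEle s hs)) (Real.exp_pos _).le
  have hE0 : E 0 = 0 := by
    rw [hEeq 0 ⟨le_rfl, ht.1.trans_lt ht.2⟩, hu.initial, hv.initial]
    simp
  have hEt : E t ≤ 0 := by
    have h1 := hanti ⟨le_rfl, ht.1⟩ ⟨ht.1, le_rfl⟩ ht.1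
    simp only [hE0, zero_mul] at h1
    exact nonpos_of_mul_nonpos_left h1 (Real.exp_pos _)
  have hper : Function.Periodic (fun x => u t x - v t x) 1 := fun x => by
    simp only [hu.periodic t ht x, hv.periodic t ht x]
  ext x
  obtain ⟨y, hy, hxy⟩ := hper.exists_mem_Ico₀ one_pos x
  have h1 := sq_le_integral_deriv_sq (w := fun x => u t x - v t x)
    (fun x => (((hu.contDiff t ht).hasDerivAt_two x).1).sub
      (((hv.contDiff t ht).hasDerivAt_two x).1))
    (cw.slice (f := fun s θ => deriv (u s) θ - deriv (v s) θ) ht) (hmean0 t ht)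
    (Ico_subset_Icc_self hy)
  rw [← hEeq t ht] at h1
  have h2 : u t y - v t y = 0 := pow_eq_zero_iff two_ne_zero |>.mp
    (le_antisymm (h1.trans hEt) (sq_nonneg _))
  have h3 : u t x - v t x = u t y - v t y := hxy
  linarith

theorem mono {J J' : Set ℝ} (hu : IsC2Solution lam u₀ J u) (h : J' ⊆ J) :
    IsC2Solution lam u₀ J' u where
  initial := hu.initial
  periodic t ht := hu.periodic t (h ht)
  contDiff t ht := hu.contDiff t (h ht)
  cont₀ := hu.cont₀.mono (prod_mono h subset_rfl)
  cont₁ := hu.cont₁.mono (prod_mono h subset_rfl)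
  cont₂ := hu.cont₂.mono (prod_mono h subset_rfl)
  equation := by
    obtain ⟨dσ, I, heq⟩ := hu.equation
    exact ⟨dσ, I, fun t ht => ⟨(heq t (h ht)).1.mono h, fun θ => ((heq t (h ht)).2 θ).mono h⟩⟩

end IsC2Solution

/-! ### Conclusion -/

theorem exists_blowup_of_changesSign {lam : ℝ} (hlam : lam = 2 ∨ lam = 3) {u₀ : ℝ → ℝ}
    (hper : Function.Periodic u₀ 1) (hC2 : ContDiff ℝ 2 u₀) (hsign : ChangesSign (momentum u₀)) :
    ∃ T : ℝ, 0 < T ∧ ∃ u : ℝ → ℝ → ℝ, IsC2Solution lam u₀ (Ico 0 T) u ∧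
      ∃ η : ℝ → ℝ → ℝ, IsFlow (Ico 0 T) u η ∧
        ∃ θs : ℝ, ChangesPosToNegAt (momentum u₀) θs ∧
          Tendsto (fun t => deriv (u t) (η t θs)) (𝓝[<] T) atBot := by
  have hκ : lam - 1 = 1 ∨ lam - 1 = 2 := by
    rcases hlam with rfl | rfl <;> norm_num
  obtain ⟨ε, hε, ζ, V, dV, h | ⟨T, hT, h, hunb⟩⟩ := exists_lagrangianSolution (lam - 1)
    (continuous_momentum hC2) (periodic_momentum hper)
  · exact absurd hsign (h.not_changesSign_of_global hκ hε)
  · have hJ : Ico 0 T ⊆ Ioo (-ε) T := fun t ht => ⟨by linarith [ht.1], ht.2⟩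
    obtain ⟨θs, hθs, hlim⟩ := h.exists_blowup hκ hε hT hunb
    have hsol := LagrangianSolution.isC2Solution hper hC2 h hJ
    rw [sub_add_cancel] at hsol
    refine ⟨T, hT, _, hsol, _, h.isFlow hJ, θs, hθs, hlim.congr' ?_⟩
    filter_upwards [Ico_mem_nhdsLT hT] with t ht
    exact (h.deriv_eulerVelocity_flow (hJ ht) θs).symm

/-- A finite breakdown would produce a change from positive to negative, hence values of both signs.
-/
theorem exists_global_of_not_changesSign {lam : ℝ} (hlam : lam = 2 ∨ lam = 3) {u₀ : ℝ → ℝ}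
    (hper : Function.Periodic u₀ 1) (hC2 : ContDiff ℝ 2 u₀)
    (hsign : ¬ ChangesSign (momentum u₀)) :
    ∃ u : ℝ → ℝ → ℝ, IsC2Solution lam u₀ (Ici 0) u := by
  have hκ : lam - 1 = 1 ∨ lam - 1 = 2 := by
    rcases hlam with rfl | rfl <;> norm_num
  obtain ⟨ε, hε, ζ, V, dV, h | ⟨T, hT, h, hunb⟩⟩ := exists_lagrangianSolution (lam - 1)
    (continuous_momentum hC2) (periodic_momentum hper)
  · have hsol := LagrangianSolution.isC2Solution (J' := Ici 0) hper hC2 h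
      fun t (ht : 0 ≤ t) => mem_Ioi.mpr (by linarith)
    rw [sub_add_cancel] at hsol
    exact ⟨_, hsol⟩
  · obtain ⟨θs, ⟨p, q, -, -, -, hpos, hneg⟩, -⟩ := h.exists_blowup hκ hε hT hunb
    exact absurd ⟨hneg.exists, hpos.exists⟩ hsign

theorem theorem1p1 (lam : ℝ) (hlam : lam = 2 ∨ lam = 3) (u₀ : ℝ → ℝ)
    (hper : Function.Periodic u₀ 1) (hC2 : ContDiff ℝ 2 u₀) :
    -- `C²` solutions are unique
    (∀ (T : ℝ) (u v : ℝ → ℝ → ℝ), IsC2Solution lam u₀ (Ico 0 T) u →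
      IsC2Solution lam u₀ (Ico 0 T) v → ∀ t ∈ Ico 0 T, u t = v t) ∧
    -- the solution exists and stays in `C²` for all time iff `m₀` never changes sign
    ((∃ u : ℝ → ℝ → ℝ, IsC2Solution lam u₀ (Ici 0) u) ↔ ¬ ChangesSign (momentum u₀)) ∧
    -- if `m₀` changes sign, then `u_θ → -∞` in finite time along the particle path from `θs`
    (ChangesSign (momentum u₀) →
      ∃ T : ℝ, 0 < T ∧ ∃ u : ℝ → ℝ → ℝ, IsC2Solution lam u₀ (Ico 0 T) u ∧
        ∃ η : ℝ → ℝ → ℝ, IsFlow (Ico 0 T) u η ∧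
          ∃ θs : ℝ, ChangesPosToNegAt (momentum u₀) θs ∧
            Tendsto (fun t => deriv (u t) (η t θs)) (𝓝[<] T) atBot) := by
  refine ⟨fun T u v hu hv t ht => hu.unique hv ht, ⟨?_, ?_⟩,
    exists_blowup_of_changesSign hlam hper hC2⟩
  -- By uniqueness a global solution coincides on `[0, T)` with the one that blows up, but its `u_θ`
  -- is bounded on the compact interval `[0, T]`.
  · rintro ⟨u, hu⟩ hsign
    obtain ⟨T, hT, v, hv, η, -, θs, -, hlim⟩ :=
      exists_blowup_of_changesSign hlam hper hC2 hsign
    have huT := hu.mono (J' := Ico 0 T) fun t ht => mem_Ici.mpr ht.1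
    obtain ⟨M, hM⟩ := exists_bound_of_continuousOn (K := Icc 0 T)
      (f := fun s => deriv (u s)) isCompact_Icc hu.cont₁
      (fun t ht => mem_Ici.mpr ht.1) 0 1
    obtain ⟨t, ht, htT⟩ := ((hlim.eventually_lt_atBot (-M)).and (Ico_mem_nhdsLT hT)).exists
    rw [← huT.unique hv htT] at ht
    obtain ⟨y, hy, hyx⟩ := (huT.periodic t htT).deriv_periodic.exists_mem_Ico₀ one_pos (η t θs)
    have h1 := (abs_le.mp (hM t (Ico_subset_Icc_self htT) y (Ico_subset_Icc_self hy))).1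
    rw [hyx] at ht
    linarith
  · exact exists_global_of_not_changesSign hlam hper hC2
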